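/- Let $n\ge 2$ and let $W_{\mathrm{af}}$ be the affine symmetric group, i.e. the group of permutations of $\mathbb Z$ generated by the simple reflections $s_i$ ($i\in\mathbb Z/n\mathbb Z$), where $s_i$ exchanges $k$ and $k+1$ for all $k\equiv i \pmod n$ and fixes the other integers. Let $\ell$ be the length function with respect to the $s_i$, let $\lessdot$ denote covers in the Bruhat order, and for $i\not\equiv j \pmod n$ let $t_{ij}$ exchange $i+kn$ and $j+kn$ for all $k\in\mathbb Z$ and fix the other integers. Put $\rho_i=s_{i-1}\cdots s_1s_0$ for $i\ge 0$ (indices modulo $n$, $\rho_0=1$). Strong strips. A marked strong cover $u\overset{a}{\longrightarrow}v$ consists of $u,v\in W_{\mathrm{af}}$ and $a\in\mathbb Z$ such that $v\lessdot u$ and, for some $i\le 0<j$ with $i\not\equiv j \pmod n$, $u=vt_{ij}$ and $a=u(j)=v(i)$. A strong strip of length $i$ from $w$ to $u$ is a path $w\overset{a_1}{\longrightarrow}u_1\overset{a_2}{\longrightarrow}\cdots\overset{a_i}{\longrightarrow}u_i=u$ of marked strong covers with $a_1>a_2>\cdots>a_i$. Coproduct. Let $P=\mathbb Z^n/\mathbb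 Z(1,\dots,1)$ be the weight lattice of $SL_n$, with coordinates indexed by $\mathbb Z/n\mathbb Z$, on which $w\in W_{\mathrm{af}}$ acts by $e_r\mapsto e_{w(r)}$ (level zero action); let $\alpha_i=e_i-e_{i+1}$, $S=\mathrm{Sym}(P)$, $F=\mathrm{Frac}(S)$, and let $F_{W_{\mathrm{af}}}=\bigoplus_{w} Fw$ with product $(pv)(qw)=p\,(v\cdot q)\,vw$. Let $A_i=\alpha_i^{-1}(1-s_i)$, let $A_w=A_{i_1}\cdots A_{i_l}$ for a reduced word $w=s_{i_1}\cdots s_{i_l}$, and let $\mathbb A_0$ be the subring of $F_{W_{\mathrm{af}}}$ generated by the $A_i$. Let $\Delta:F_{W_{\mathrm{af}}}\to F_{W_{\mathrm{af}}}\otimes_F F_{W_{\mathrm{af}}}$ be the left $F$-linear map with $\Delta(w)=w\otimes w$. The structure constants $p^w_{u,v}\in S$ are the coefficients in the finite expansion $\Delta(A_w)=\sum_{u,v}p^w_{u,v}\,A_u\otimes A_v$; this expansion, with coefficients in $S$, exists and is unique. Theorem. There are only finitely many strong strips of given length starting at a given $w\in W_{\mathrm{af}}$. For $w,u\in W_{\mathrm{af}}$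 with $i=\ell(w)-\ell(u)\ge 0$, the structure constant $p^w_{\rho_i,u}$ equals the number of strong strips (necessarily of length $i$) from $w$ to $u$. Equivalently, for every $i\ge 0$, the cap operator $D_{\rho_i}$ and the Pieri operator $D'_i$, i.e. the unique $\mathbb Z$-linear maps $\mathbb A_0\to\mathbb A_0$ with $$D_{\rho_i}(A_w)=\sum_{\ell(v)=\ell(w)-\ell(\rho_i)}p^w_{\rho_i,v}\,A_v,\qquad D'_i(A_w)=\sum_{w\to_{(i)}u}A_u \quad (w\in W_{\mathrm{af}}),$$ the second sum being over all strong strips of length $i$ starting at $w$, exist and are equal; here the $p^w_{\rho_i,v}$ in the first sum are integers. -/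

import Mathlib

open scoped TensorProduct

noncomputable section

namespace AffinePieri

/-! ### The affine symmetric group -/

theorem zmod_succ_ne {n : ℕ} [n.AtLeastTwo] (i : ZMod n) : i + 1 ≠ i := by
  have : Fact (1 < n) := ⟨Nat.AtLeastTwo.prop⟩
  simp

/-- The underlying function of `simplePerm`: it exchanges `k` and `k + 1` for all `k ≡ i` modulo
`n`, and fixes all other integers. -/
def simpleFun (n : ℕ) (i : ZMod n) (k : ℤ) : ℤ :=
  if (k : ZMod n) = i then k + 1 else if (k : ZMod n) = i + 1 then k - 1 else k

theorem simpleFun_involutive (n : ℕ) [n.AtLeastTwo] (i : ZMod n) :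
    Function.Involutive (simpleFun n i) := by
  intro k
  have h := zmod_succ_ne i
  unfold simpleFun
  split_ifs <;> simp_all

/-- The simple reflection `s_i` as a permutation of `ℤ`. -/
def simplePerm (n : ℕ) [n.AtLeastTwo] (i : ZMod n) : Equiv.Perm ℤ :=
  (simpleFun_involutive n i).toPerm

/-- The affine symmetric group, realised as the group of permutations of `ℤ` generated by the
simple reflections `s_i`, `i ∈ ℤ/nℤ`. -/
def affineSymmetricGroup (n : ℕ) [n.AtLeastTwo] : Subgroup (Equiv.Perm ℤ) :=
  Subgroup.closure (Set.range (simplePerm n))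

/-- The type of elements of the affine symmetric group. -/
abbrev W (n : ℕ) [n.AtLeastTwo] : Type := affineSymmetricGroup n

variable {n : ℕ} [n.AtLeastTwo]

/-- The simple reflection `s_i`. -/
def s (i : ZMod n) : W n :=
  ⟨simplePerm n i, Subgroup.subset_closure ⟨i, rfl⟩⟩

/-- The value `w(k)` of an affine permutation. -/
def value (w : W n) (k : ℤ) : ℤ := (w : Equiv.Perm ℤ) k

/-- The product `s_{i_1} ⋯ s_{i_l}` of a word. -/
def wordProd (l : List (ZMod n)) : W n := (l.map s).prod

/-- The length `ℓ(w)`: the minimal number of letters of a word for `w`. -/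
def length (w : W n) : ℕ := sInf {m | ∃ l : List (ZMod n), wordProd l = w ∧ l.length = m}

/-- `l` is a reduced word of `w`. -/
def IsReducedWord (l : List (ZMod n)) (w : W n) : Prop :=
  wordProd l = w ∧ l.length = length w

theorem s_mul_s (i : ZMod n) : s i * s i = 1 :=
  Subtype.ext (Equiv.ext (simpleFun_involutive n i))

theorem exists_word (w : W n) : ∃ l : List (ZMod n), wordProd l = w := by
  obtain ⟨w, hw⟩ := w
  suffices ∃ l : List (ZMod n), ((wordProd l : W n) : Equiv.Perm ℤ) = w by
    obtain ⟨l, hl⟩ := this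
    exact ⟨l, Subtype.ext hl⟩
  induction hw using Subgroup.closure_induction with
  | mem x hx =>
    obtain ⟨i, rfl⟩ := hx
    exact ⟨[i], by simp [wordProd, s]⟩
  | one => exact ⟨[], rfl⟩
  | mul x y _ _ hx hy =>
    obtain ⟨l, rfl⟩ := hx
    obtain ⟨m, rfl⟩ := hy
    exact ⟨l ++ m, by simp [wordProd]⟩
  | inv x _ hx =>
    obtain ⟨l, rfl⟩ := hx
    refine ⟨l.reverse, ?_⟩
    rw [← Subgroup.coe_inv, Subtype.coe_inj, wordProd, wordProd, List.prod_inv_reverse,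
      List.map_map, List.map_reverse]
    refine congrArg (fun L : List (W n) => L.reverse.prod) (List.map_congr_left fun i _ => ?_)
    exact eq_inv_of_mul_eq_one_left (s_mul_s i)

theorem exists_reducedWord (w : W n) : ∃ l : List (ZMod n), IsReducedWord l w := by
  obtain ⟨l, hl⟩ := exists_word w
  exact Nat.sInf_mem (s := {m | ∃ l : List (ZMod n), wordProd l = w ∧ l.length = m}) ⟨_, l, hl, rfl⟩

/-- A reduced word of `w`. -/
def reducedWord (w : W n) : List (ZMod n) := (exists_reducedWord w).choose

/-- The Bruhat (strong) order: some reduced word of `v` is a subword of some reduced word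
of `w`. -/
def BruhatLE (v w : W n) : Prop :=
  ∃ l m : List (ZMod n), IsReducedWord l v ∧ IsReducedWord m w ∧ l.Sublist m

/-- `v ⋖ w`: `v < w` in the Bruhat order and `ℓ(v) = ℓ(w) - 1`. -/
def BruhatCover (v w : W n) : Prop := BruhatLE v w ∧ length v + 1 = length w

/-- The Pieri element `ρ_i = s_{i-1} ⋯ s_1 s_0`, indices modulo `n`. -/
def rho (n : ℕ) [n.AtLeastTwo] : ℕ → W n
  | 0 => 1
  | i + 1 => s (i : ZMod n) * rho n i

/-! ### Strong strips -/

/-- For `i ≢ j` modulo `n`, the affine transposition `t_{ij}`: it exchanges `i + k n` and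
`j + k n` for all integers `k`, and fixes all other integers. -/
def transposition (n : ℕ) (i j k : ℤ) : ℤ :=
  if (k : ZMod n) = (i : ZMod n) then k + (j - i)
  else if (k : ZMod n) = (j : ZMod n) then k - (j - i) else k

/-- `(u, a, v)` is a marked strong cover `u → v` with marking `a`: `v ⋖ u`, and
`u = v t_{ij}`, `a = u(j) = v(i)` for some `i ≤ 0 < j`. -/
def MarkedStrongCover (u : W n) (a : ℤ) (v : W n) : Prop :=
  BruhatCover v u ∧ ∃ i j : ℤ, i ≤ 0 ∧ 0 < j ∧ (i : ZMod n) ≠ (j : ZMod n) ∧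
    (∀ k, value u k = value v (transposition n i j k)) ∧ a = value u j ∧ a = value v i

/-- A strong strip of length `i` from `w` to `u`: a path
`w = x_0 → x_1 → ⋯ → x_i = u` of marked strong covers with strictly decreasing markings
`a_1 > a_2 > ⋯ > a_i`. -/
structure StrongStrip (w u : W n) (i : ℕ) where
  vertex : Fin (i + 1) → W n
  mark : Fin i → ℤ
  vertex_zero : vertex 0 = w
  vertex_last : vertex (Fin.last i) = u
  cover : ∀ j : Fin i, MarkedStrongCover (vertex j.castSucc) (mark j) (vertex j.succ)
  mark_anti : StrictAnti mark

/-! ### Weights and the level zero action -/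

theorem value_add_period (w : W n) (k : ℤ) : value w (k + n) = value w k + n := by
  have hle : affineSymmetricGroup n ≤ Subgroup.centralizer {Equiv.addRight (n : ℤ)} := by
    refine (Subgroup.closure_le _).2 ?_
    rintro _ ⟨i, rfl⟩
    refine Subgroup.mem_centralizer_singleton_iff.2 (Equiv.ext fun k => ?_)
    change simpleFun n i (k + n) = simpleFun n i k + n
    simp only [simpleFun, Int.cast_add, Int.cast_natCast, CharP.cast_eq_zero, add_zero]
    split_ifs <;> ring
  have h := Subgroup.mem_centralizer_singleton_iff.1 (hle w.2)
  exact congrArg (fun e : Equiv.Perm ℤ => e k) h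

theorem value_add_mul_period (w : W n) (k m : ℤ) :
    value w (k + m * n) = value w k + m * n := by
  induction m using Int.induction_on with
  | zero => simp
  | succ m ih =>
    rw [show k + ((m : ℤ) + 1) * n = (k + m * n) + n by ring, value_add_period, ih]; ring
  | pred m ih =>
    have := value_add_period w (k + (-(m : ℤ) - 1) * n)
    rw [show k + (-(m : ℤ) - 1) * n + n = k + -(m : ℤ) * n by ring, ih] at this
    linarith

theorem value_cast_congr (w : W n) {k l : ℤ} (h : (k : ZMod n) = (l : ZMod n)) :
    (value w k : ZMod n) = (value w l : ZMod n) := by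
  obtain ⟨m, hm⟩ := (ZMod.intCast_eq_intCast_iff_dvd_sub k l n).1 h
  rw [show l = k + m * n by linarith, value_add_mul_period]
  simp

/-- The permutation of the residues modulo `n` induced by an affine permutation. -/
def residue (w : W n) (r : ZMod n) : ZMod n := (value w (r.val : ℤ) : ZMod n)

theorem residue_one (r : ZMod n) : residue (1 : W n) r = r := by
  simp [residue, value]

theorem residue_mul (v w : W n) (r : ZMod n) : residue (v * w) r = residue v (residue w r) := by
  change ((value v (value w _) : ℤ) : ZMod n) = _
  exact value_cast_congr v (by simp [residue])

/-- The group homomorphism to the permutations of the residues modulo `n`. -/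
def residueHom (n : ℕ) [n.AtLeastTwo] : W n →* Equiv.Perm (ZMod n) where
  toFun w :=
    { toFun := residue w
      invFun := residue w⁻¹
      left_inv := fun r => by rw [← residue_mul, inv_mul_cancel, residue_one]
      right_inv := fun r => by rw [← residue_mul, mul_inv_cancel, residue_one] }
  map_one' := Equiv.ext residue_one
  map_mul' v w := Equiv.ext (residue_mul v w)

/-- The span of `(1, …, 1)` in `ℤⁿ`. -/
def diagonal (n : ℕ) : Submodule ℤ (ZMod n → ℤ) := Submodule.span ℤ {fun _ => 1}

/-- The weight lattice `P` of `SL_n`: the quotient of `ℤⁿ` (with coordinates indexed by `ℤ/nℤ`) by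
`(1, …, 1)`. The fundamental weights are the classes of `e_1 + ⋯ + e_i`, `0 < i < n`. -/
abbrev P (n : ℕ) : Type := (ZMod n → ℤ) ⧸ diagonal n

/-- The image in `P` of the simple affine root `α_i`: the class of `e_i - e_{i+1}`. In
particular `α_0 = e_n - e_1 = -θ`, as the null root is sent to `0`. -/
def simpleRoot (n : ℕ) (i : ZMod n) : P n :=
  (diagonal n).mkQ (Pi.single i 1 - Pi.single (i + 1) 1)

theorem mem_diagonal {m : ℕ} {f : ZMod m → ℤ} : f ∈ diagonal m ↔ ∃ c : ℤ, ∀ r, f r = c := by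
  rw [diagonal, Submodule.mem_span_singleton]
  constructor
  · rintro ⟨c, rfl⟩
    exact ⟨c, fun r => by simp⟩
  · rintro ⟨c, hc⟩
    exact ⟨c, funext fun r => by simp [hc r]⟩

instance P_free : Module.Free ℤ (P n) := by
  have : Module.IsTorsionFree ℤ (P n) := by
    refine Module.isTorsionFree_iff_smul_eq_zero.2 ?_
    intro m x hx
    obtain ⟨f, rfl⟩ := (diagonal n).mkQ_surjective x
    rw [← map_smul] at hx
    simp only [Submodule.mkQ_apply, Submodule.Quotient.mk_eq_zero] at hx ⊢
    by_cases hm : m = 0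
    · exact Or.inl hm
    · obtain ⟨c, hc⟩ := mem_diagonal.1 hx
      refine Or.inr (mem_diagonal.2 ⟨f 0, fun r => ?_⟩)
      exact mul_left_cancel₀ hm ((hc r).trans (hc 0).symm)
  infer_instance

/-- The level zero action of `W n` on `P`: it sends the class of `e_r` to the class of
`e_{w(r)}`, so that `s_i` acts by `λ ↦ λ - ⟨α_i^∨, λ⟩ α_i` with `⟨α_i^∨, λ⟩ = λ_i - λ_{i+1}`. -/
def weightMap (w : W n) : P n →ₗ[ℤ] P n :=
  (diagonal n).mapQ (diagonal n) (LinearMap.funLeft ℤ ℤ (residueHom n w⁻¹)) (by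
    intro f hf
    obtain ⟨c, hc⟩ := mem_diagonal.1 hf
    exact mem_diagonal.2 ⟨c, fun r => hc _⟩)

theorem weightMap_one (x : P n) : weightMap (1 : W n) x = x := by
  obtain ⟨f, rfl⟩ := (diagonal n).mkQ_surjective x
  simp [weightMap, LinearMap.funLeft]

theorem weightMap_mul (v w : W n) (x : P n) :
    weightMap (v * w) x = weightMap v (weightMap w x) := by
  obtain ⟨f, rfl⟩ := (diagonal n).mkQ_surjective x
  simp [weightMap, LinearMap.funLeft, Function.comp_assoc]

/-- `S = Sym(P)`. -/
abbrev S (n : ℕ) : Type := SymmetricAlgebra ℤ (P n)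

/-- The evaluation `φ : S → ℤ` at `0` (the constant term). -/
def evalZero (n : ℕ) : S n →ₐ[ℤ] ℤ := SymmetricAlgebra.algebraMapInv

/-- The induced map on `S`. -/
def symMap (w : W n) : S n →ₐ[ℤ] S n :=
  SymmetricAlgebra.lift (SymmetricAlgebra.ι ℤ (P n) ∘ₗ weightMap w)

theorem symMap_one : symMap (1 : W n) = AlgHom.id ℤ (S n) :=
  SymmetricAlgebra.algHom_ext (LinearMap.ext fun x => by simp [symMap, weightMap_one])

theorem symMap_mul (v w : W n) : symMap (v * w) = (symMap v).comp (symMap w) :=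
  SymmetricAlgebra.algHom_ext (LinearMap.ext fun x => by simp [symMap, weightMap_mul])

/-- The level zero action on `S`, by ring automorphisms. -/
instance actionS : MulSemiringAction (W n) (S n) where
  smul w p := symMap w p
  one_smul p := congrArg (fun f : S n →ₐ[ℤ] S n => f p) symMap_one
  mul_smul v w p := congrArg (fun f : S n →ₐ[ℤ] S n => f p) (symMap_mul v w)
  smul_zero w := map_zero (symMap w)
  smul_add w := map_add (symMap w)
  smul_one w := map_one (symMap w)
  smul_mul w := map_mul (symMap w)

/-- `F = Frac(S)`. -/
abbrev F (n : ℕ) [n.AtLeastTwo] : Type := FractionRing (S n)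

/-- The level zero action on `F`, extending the one on `S`. -/
instance actionF : MulSemiringAction (W n) (F n) :=
  IsFractionRing.mulSemiringAction (W n) (S n) (F n)

/-! ### The nilHecke ring and its coproduct -/

/-- The twisted group algebra `F_W = ⨁ F w` with product `(p v)(q w) = p (v • q) v w`. -/
abbrev FW (n : ℕ) [n.AtLeastTwo] : Type := SkewMonoidAlgebra (F n) (W n)

/-- `A_i = α_i⁻¹ (1 - s_i)`. -/
def simpleA (i : ZMod n) : FW n :=
  (algebraMap (S n) (F n) (SymmetricAlgebra.ι ℤ (P n) (simpleRoot n i)))⁻¹ •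
    (1 - SkewMonoidAlgebra.single (s i) 1)

/-- `A_w = A_{i_1} ⋯ A_{i_l}` for a reduced word `s_{i_1} ⋯ s_{i_l}` of `w`. -/
def A (w : W n) : FW n := ((reducedWord w).map simpleA).prod

/-- The nilCoxeter ring `𝔸₀`: the subring of `F_W` generated by the `A_i`. -/
def nilCoxeter (n : ℕ) [n.AtLeastTwo] : Subring (FW n) :=
  Subring.closure (Set.range (simpleA (n := n)))

theorem A_mem (w : W n) : A w ∈ nilCoxeter n := by
  refine list_prod_mem fun x hx => ?_
  obtain ⟨i, -, rfl⟩ := List.mem_map.1 hx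
  exact Subring.subset_closure ⟨i, rfl⟩

/-- `A_w` as an element of the nilCoxeter ring. -/
def A0 (w : W n) : nilCoxeter n := ⟨A w, A_mem w⟩

/-- The left `F`-linear coproduct `Δ : F_W → F_W ⊗_F F_W` with `Δ(w) = w ⊗ w`. -/
def coproduct (n : ℕ) [n.AtLeastTwo] : FW n →ₗ[F n] FW n ⊗[F n] FW n :=
  SkewMonoidAlgebra.basisSingleOne.constr (F n) fun w : W n =>
    SkewMonoidAlgebra.single w (1 : F n) ⊗ₜ[F n] SkewMonoidAlgebra.single w (1 : F n)

/-- `Δ(A_w) = ∑ c(u, v) A_u ⊗ A_v`, a finite sum with coefficients in `S`. -/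
def IsCoproductExpansion (w : W n) (c : W n × W n →₀ S n) : Prop :=
  coproduct n (A w) = c.sum fun uv p => algebraMap (S n) (F n) p • (A uv.1 ⊗ₜ[F n] A uv.2)

open Classical in
/-- The equivariant Schubert structure constant `p^w_{u,v} ∈ S`, the coefficient of `A_u ⊗ A_v` in
the expansion of `Δ(A_w)`. -/
def structureConst (w u v : W n) : S n :=
  if h : ∃ c, IsCoproductExpansion w c then h.choose (u, v) else 0

/-! ### The operators -/

/-- `D` is the cap operator `D_u` on the nilCoxeter ring:
`D_u(A_w) = ∑_{ℓ(v) = ℓ(w) - ℓ(u)} p^w_{u,v} A_v`; these `p^w_{u,v}` are integer constants, which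
are read off by evaluation at `0`. -/
def IsCapOperator (u : W n) (D : nilCoxeter n →ₗ[ℤ] nilCoxeter n) : Prop :=
  ∀ w, D (A0 w) =
    ∑ᶠ (v : W n) (_ : length v + length u = length w), evalZero n (structureConst w u v) • A0 v

/-- `D` is the Pieri operator `D'_i` on the nilCoxeter ring: `D'_i(A_w)` is the sum of `A_u` over
all strong strips of length `i` from `w` to some `u`. -/
def IsPieriOperator (i : ℕ) (D : nilCoxeter n →ₗ[ℤ] nilCoxeter n) : Prop :=
  ∀ w, D (A0 w) = ∑ᶠ x : Σ u : W n, StrongStrip w u i, A0 x.1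

end AffinePieri

end

noncomputable section

namespace AffinePieri

/-!
Write `y_r = 1 - t e_r` with an indeterminate `t`, and let `K_c` be the operator on the free module
on `W` that takes `w` to `y_c w + t ∑ u` over the marked strong covers `w → u` of marking `c` if the
value `c` has positive position in `w`, and to `w` otherwise. The Pieri rule is the coefficientwise
form of the product formula
`∑_m t^m y_{m+1} ⋯ y_N ∑_u p^w_{ρ_m,u} u = K_{1-M} ⋯ K_0 K_1 ⋯ K_N w`, valid for `M, N ≥ ℓ(w)`.

Both sides satisfy the same recursion along left ascents. Let `s_i` act on the free module by its
action on coefficients followed by `1 - α_i A_i`, which is left multiplication in terms of the basis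
`A_w`. For the left hand side, apply `s_i ⊗ s_i` to `Δ(A_w)` and use `α_i A_i = 1 - s_i`; among the
`ρ_m`, only `ρ_{m+1}` with `m ≡ i` has `i` as a left descent. For the right hand side, `s_i`
commutes with `K_c` for `c ≢ i, i + 1` and with the product `K_c K_{c+1}` for `c ≡ i`, by the
interaction of Bruhat covers with left multiplication by `s_i`; hence it commutes with the whole
product once `-M, N ≢ i`.
-/

/-! ### Reflections -/

section Transposition

variable {n : ℕ}

theorem simpleFun_left (k : ℤ) : simpleFun n (k : ZMod n) k = k + 1 := by simp [simpleFun]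

theorem simpleFun_of_ne {i : ZMod n} {k : ℤ} (h : (k : ZMod n) ≠ i) (h' : (k : ZMod n) ≠ i + 1) :
    simpleFun n i k = k := by simp [simpleFun, h, h']

theorem simpleFun_eq_transposition (k : ℤ) :
    simpleFun n (k : ZMod n) = transposition n k (k + 1) := by
  funext l
  unfold simpleFun transposition
  push_cast
  split_ifs <;> ring

theorem abs_simpleFun_sub_le (i : ZMod n) (k : ℤ) : |simpleFun n i k - k| ≤ 1 := by
  unfold simpleFun
  split_ifs <;> simp

theorem exists_eq_add_mul {k l : ℤ} (h : (k : ZMod n) = (l : ZMod n)) :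
    ∃ m : ℤ, l = k + m * n := by
  obtain ⟨m, hm⟩ := (ZMod.intCast_eq_intCast_iff_dvd_sub k l n).1 h
  exact ⟨m, by linarith⟩

theorem cast_ne_cast_add_mul {i j : ℤ} (h : (i : ZMod n) ≠ j) (a : ℤ) :
    (i : ZMod n) ≠ ((j + a * n : ℤ) : ZMod n) := by
  simpa using h

theorem transposition_add_left (i j m : ℤ) : transposition n i j (i + m * n) = j + m * n := by
  simp only [transposition, Int.cast_add, Int.cast_mul, Int.cast_natCast, CharP.cast_eq_zero,
    mul_zero, add_zero, if_true]
  ring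

theorem transposition_add_right {i j : ℤ} (h : (i : ZMod n) ≠ j) (m : ℤ) :
    transposition n i j (j + m * n) = i + m * n := by
  simp [transposition, h.symm, add_comm]

theorem transposition_left (i j : ℤ) : transposition n i j i = j := by
  simpa using transposition_add_left (n := n) i j 0

theorem transposition_right {i j : ℤ} (h : (i : ZMod n) ≠ j) : transposition n i j j = i := by
  simpa using transposition_add_right h 0

theorem transposition_of_ne {i j k : ℤ} (hi : (i : ZMod n) ≠ k) (hj : (j : ZMod n) ≠ k) :
    transposition n i j k = k := by
  simp [transposition, hi.symm, hj.symm]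

theorem transposition_cases {i j : ℤ} {p : ℤ → Prop} (left : ∀ m : ℤ, p (i + m * n))
    (right : ∀ m : ℤ, p (j + m * n))
    (other : ∀ k : ℤ, (i : ZMod n) ≠ k → (j : ZMod n) ≠ k → p k) (k : ℤ) : p k := by
  by_cases hi : (i : ZMod n) = k
  · obtain ⟨m, rfl⟩ := exists_eq_add_mul hi
    exact left m
  by_cases hj : (j : ZMod n) = k
  · obtain ⟨m, rfl⟩ := exists_eq_add_mul hj
    exact right m
  exact other k hi hj

theorem transposition_involutive {i j : ℤ} (h : (i : ZMod n) ≠ j) :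
    Function.Involutive (transposition n i j) :=
  transposition_cases (fun m => by rw [transposition_add_left, transposition_add_right h])
    (fun m => by rw [transposition_add_right h, transposition_add_left])
    (fun k hi hj => by rw [transposition_of_ne hi hj, transposition_of_ne hi hj])

theorem transposition_comm {i j : ℤ} (h : (i : ZMod n) ≠ j) :
    transposition n i j = transposition n j i :=
  funext <| transposition_cases
    (fun m => by rw [transposition_add_left, transposition_add_right h.symm])
    (fun m => by rw [transposition_add_right h, transposition_add_left])
    (fun k hi hj => by rw [transposition_of_ne hi hj, transposition_of_ne hj hi])

end Transposition

variable {n : ℕ} [n.AtLeastTwo]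

theorem two_le_period : (2 : ℤ) ≤ n := by exact_mod_cast (Nat.AtLeastTwo.prop : 2 ≤ n)

theorem intCast_succ_ne (k : ℤ) : ((k + 1 : ℤ) : ZMod n) ≠ k := by
  push_cast
  exact zmod_succ_ne _

theorem simpleFun_right (k : ℤ) : simpleFun n (k : ZMod n) (k + 1) = k := by
  simp [simpleFun, zmod_succ_ne (k : ZMod n)]

theorem eq_succ_of_simpleFun_lt {i : ZMod n} {x y : ℤ} (h : x < y)
    (h' : simpleFun n i y < simpleFun n i x) : (x : ZMod n) = i ∧ y = x + 1 := by
  have hx := abs_le.1 (abs_simpleFun_sub_le i x)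
  have hy := abs_le.1 (abs_simpleFun_sub_le i y)
  obtain rfl : y = x + 1 := by omega
  refine ⟨?_, rfl⟩
  by_contra hne
  have hx' : simpleFun n i x ≤ x := by unfold simpleFun; split_ifs <;> omega
  have hy' : simpleFun n i (x + 1) = x := by omega
  have := simpleFun_involutive n i (x + 1)
  rw [hy'] at this
  omega

theorem value_mul (v w : W n) (k : ℤ) : value (v * w) k = value v (value w k) := rfl

theorem value_one (k : ℤ) : value (1 : W n) k = k := rfl

theorem value_s (i : ZMod n) (k : ℤ) : value (s i) k = simpleFun n i k := rfl

theorem ext_value {v w : W n} (h : ∀ k, value v k = value w k) : v = w :=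
  Subtype.ext (Equiv.ext h)

/-- The position `w⁻¹(a)` of the value `a` in the affine permutation `w`. The Bruhat covers of a
fixed `w` are described by values, so that positions occur more often than values. -/
def pos (w : W n) (a : ℤ) : ℤ := value w⁻¹ a

theorem value_pos (w : W n) (a : ℤ) : value w (pos w a) = a := by
  rw [pos, ← value_mul, mul_inv_cancel, value_one]

theorem pos_value (w : W n) (a : ℤ) : pos w (value w a) = a := by
  rw [pos, ← value_mul, inv_mul_cancel, value_one]

theorem pos_mul (v w : W n) (a : ℤ) : pos (v * w) a = pos w (pos v a) := by
  rw [pos, mul_inv_rev, value_mul, pos, pos]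

theorem pos_one (a : ℤ) : pos (1 : W n) a = a := by rw [pos, inv_one, value_one]

theorem pos_injective (w : W n) : Function.Injective (pos w) :=
  Function.LeftInverse.injective (value_pos w)

theorem pos_add_mul (w : W n) (a m : ℤ) : pos w (a + m * n) = pos w a + m * n :=
  value_add_mul_period w⁻¹ a m

theorem pos_cast_eq_iff (w : W n) {k l : ℤ} :
    (pos w k : ZMod n) = (pos w l : ZMod n) ↔ (k : ZMod n) = (l : ZMod n) :=
  ⟨fun h => by simpa only [value_pos] using value_cast_congr w h, value_cast_congr w⁻¹⟩

theorem value_cast_eq_iff (w : W n) {k l : ℤ} :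
    (value w k : ZMod n) = (value w l : ZMod n) ↔ (k : ZMod n) = (l : ZMod n) := by
  rw [← pos_cast_eq_iff w, pos_value, pos_value]

theorem s_inv (i : ZMod n) : (s i)⁻¹ = s i := (eq_inv_of_mul_eq_one_left (s_mul_s i)).symm

theorem s_mul_s_mul (i : ZMod n) (w : W n) : s i * (s i * w) = w := by
  rw [← mul_assoc, s_mul_s, one_mul]

theorem pos_s_mul (i : ZMod n) (w : W n) (k : ℤ) :
    pos (s i * w) k = pos w (simpleFun n i k) := by
  rw [pos_mul, pos.eq_1 (s i), s_inv, value_s]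

theorem value_transposition (w : W n) {i j : ℤ} (h : (i : ZMod n) ≠ j) (k : ℤ) :
    value w (transposition n i j k) = transposition n (value w i) (value w j) (value w k) := by
  induction k using transposition_cases (n := n) (i := i) (j := j) with
  | left m =>
    rw [transposition_add_left, value_add_mul_period, value_add_mul_period, transposition_add_left]
  | right m =>
    rw [transposition_add_right h, value_add_mul_period, value_add_mul_period,
      transposition_add_right ((value_cast_eq_iff w).not.2 h)]
  | other k hi hj =>
    rw [transposition_of_ne hi hj, transposition_of_ne ((value_cast_eq_iff w).not.2 hi)
      ((value_cast_eq_iff w).not.2 hj)]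

theorem exists_value_eq_transposition_of_lt {i j : ℤ} (hij : i < j) (hne : (i : ZMod n) ≠ j) :
    ∃ t : W n, ∀ k, value t k = transposition n i j k := by
  induction hd : (j - i).toNat using Nat.strong_induction_on generalizing i j with
  | _ d ih =>
    -- The reflections are the conjugates of the `s_k`: conjugation by a suitable `s_k` brings
    -- `i` and `j` closer together.
    have conj (i' j' k : ℤ) (hij' : i' < j') (hne' : (i' : ZMod n) ≠ j')
        (hd' : (j' - i').toNat < d) (hi : simpleFun n (k : ZMod n) i' = i)
        (hj : simpleFun n (k : ZMod n) j' = j) :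
        ∃ t : W n, ∀ l, value t l = transposition n i j l := by
      obtain ⟨t, ht⟩ := ih _ hd' hij' hne' rfl
      refine ⟨s (k : ZMod n) * t * s (k : ZMod n), fun l => ?_⟩
      rw [value_mul, value_mul, ht, value_transposition _ hne', ← value_mul, s_mul_s, value_one,
        value_s, value_s, hi, hj]
    by_cases h1 : j = i + 1
    · exact ⟨s (i : ZMod n), fun k => by rw [value_s, simpleFun_eq_transposition, h1]⟩
    by_cases h2 : (i : ZMod n) = ((j - 1 : ℤ) : ZMod n)
    · have hi1 : ((i + 1 : ℤ) : ZMod n) ≠ ((j - 1 : ℤ) : ZMod n) := by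
        rw [← h2]; exact intCast_succ_ne i
      have : i + 1 ≠ j - 1 := ne_of_apply_ne _ hi1
      refine conj (i + 1) (j - 1) i (by omega) hi1 (by omega) (simpleFun_right i) ?_
      rw [h2, simpleFun_left, sub_add_cancel]
    · refine conj i (j - 1) (j - 1) (by omega) h2 (by omega) (simpleFun_of_ne h2 ?_) ?_
      · push_cast; rwa [sub_add_cancel]
      · rw [simpleFun_left, sub_add_cancel]

theorem exists_value_eq_transposition {i j : ℤ} (hne : (i : ZMod n) ≠ j) :
    ∃ t : W n, ∀ k, value t k = transposition n i j k := by
  rcases lt_or_gt_of_ne (ne_of_apply_ne _ hne : i ≠ j) with h | h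
  · exact exists_value_eq_transposition_of_lt h hne
  · rw [transposition_comm hne]
    exact exists_value_eq_transposition_of_lt h hne.symm

open Classical in
/-- The reflection `t_{ij}` as an element of the affine symmetric group; by convention it is `1`
if `i ≡ j` modulo `n`. -/
def reflection (i j : ℤ) : W n :=
  if h : (i : ZMod n) ≠ j then (exists_value_eq_transposition h).choose else 1

theorem value_reflection {i j : ℤ} (h : (i : ZMod n) ≠ j) (k : ℤ) :
    value (reflection i j : W n) k = transposition n i j k := by
  rw [reflection, dif_pos h]
  exact (exists_value_eq_transposition h).choose_spec k

theorem reflection_of_eq {i j : ℤ} (h : (i : ZMod n) = j) : (reflection i j : W n) = 1 := by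
  rw [reflection, dif_neg (not_not.2 h)]

theorem reflection_comm (i j : ℤ) : (reflection i j : W n) = reflection j i := by
  by_cases h : (i : ZMod n) = j
  · rw [reflection_of_eq h, reflection_of_eq h.symm]
  · exact ext_value fun k => by
      rw [value_reflection h, value_reflection (Ne.symm h), transposition_comm h]

theorem reflection_mul_self (i j : ℤ) : (reflection i j : W n) * reflection i j = 1 := by
  by_cases h : (i : ZMod n) = j
  · rw [reflection_of_eq h, one_mul]
  · exact ext_value fun k => by
      rw [value_mul, value_reflection h, value_reflection h, transposition_involutive h, value_one]

theorem reflection_mul_reflection_mul (i j : ℤ) (w : W n) :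
    reflection i j * (reflection i j * w) = w := by
  rw [← mul_assoc, reflection_mul_self, one_mul]

theorem reflection_inv (i j : ℤ) : (reflection i j : W n)⁻¹ = reflection i j :=
  (eq_inv_of_mul_eq_one_left (reflection_mul_self i j)).symm

theorem reflection_succ (k : ℤ) : (reflection k (k + 1) : W n) = s (k : ZMod n) :=
  ext_value fun l => by
    rw [value_reflection (intCast_succ_ne k).symm, value_s, simpleFun_eq_transposition]

theorem mul_reflection (w : W n) (i j : ℤ) :
    w * reflection i j = reflection (value w i) (value w j) * w := by
  by_cases h : (i : ZMod n) = j
  · rw [reflection_of_eq h, reflection_of_eq ((value_cast_eq_iff w).2 h), one_mul, mul_one]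
  · refine ext_value fun k => ?_
    rw [value_mul, value_mul, value_reflection h,
      value_reflection ((value_cast_eq_iff w).not.2 h), value_transposition w h]

theorem s_mul_reflection (i : ZMod n) (a b : ℤ) :
    s i * reflection a b = reflection (simpleFun n i a) (simpleFun n i b) * s i :=
  mul_reflection _ _ _

theorem value_reflection_left {i j : ℤ} (h : (i : ZMod n) ≠ j) :
    value (reflection i j : W n) i = j := by
  rw [value_reflection h, transposition_left]

theorem value_reflection_right {i j : ℤ} (h : (i : ZMod n) ≠ j) :
    value (reflection i j : W n) j = i := by
  rw [value_reflection h, transposition_right h]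

theorem value_reflection_of_ne {i j k : ℤ} (h : (i : ZMod n) ≠ j) (hi : (i : ZMod n) ≠ k)
    (hj : (j : ZMod n) ≠ k) : value (reflection i j : W n) k = k := by
  rw [value_reflection h, transposition_of_ne hi hj]

theorem pos_reflection_mul {a b : ℤ} (h : (a : ZMod n) ≠ b) (w : W n) (c : ℤ) :
    pos (reflection a b * w) c = pos w (transposition n a b c) := by
  rw [pos_mul, pos.eq_1 (reflection a b), reflection_inv, value_reflection h]

theorem pos_reflection_mul_left {w : W n} {a b : ℤ} (h : (a : ZMod n) ≠ b) :
    pos (reflection a b * w) a = pos w b := by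
  rw [pos_reflection_mul h, transposition_left]

theorem pos_reflection_mul_right {w : W n} {a b : ℤ} (h : (a : ZMod n) ≠ b) :
    pos (reflection a b * w) b = pos w a := by
  rw [pos_reflection_mul h, transposition_right h]

theorem pos_reflection_mul_of_ne {w : W n} {a b c : ℤ} (h : (a : ZMod n) ≠ b)
    (ha : (a : ZMod n) ≠ c) (hb : (b : ZMod n) ≠ c) :
    pos (reflection a b * w) c = pos w c := by
  rw [pos_reflection_mul h, transposition_of_ne ha hb]

/-! ### Length and strong exchange -/

theorem wordProd_cons (i : ZMod n) (l : List (ZMod n)) : wordProd (i :: l) = s i * wordProd l := by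
  simp [wordProd]

theorem length_wordProd_le (l : List (ZMod n)) : length (wordProd l) ≤ l.length :=
  Nat.sInf_le ⟨l, rfl, rfl⟩

theorem length_one : length (1 : W n) = 0 := Nat.le_zero.1 (length_wordProd_le (n := n) [])

theorem strong_exchange (l : List (ZMod n)) {a b : ℤ} (hab : a < b) (hne : (a : ZMod n) ≠ b)
    (h : pos (wordProd l) b < pos (wordProd l) a) :
    ∃ l₁ i l₂, l = l₁ ++ i :: l₂ ∧ reflection a b * wordProd l = wordProd (l₁ ++ l₂) := by
  induction l generalizing a b with
  | nil =>
    change pos (1 : W n) b < pos (1 : W n) a at h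
    rw [pos_one, pos_one] at h
    omega
  | cons i l ih =>
    rw [wordProd_cons, pos_s_mul, pos_s_mul] at h
    have hne' : (simpleFun n i a : ZMod n) ≠ simpleFun n i b := (value_cast_eq_iff (s i)).not.2 hne
    rcases lt_or_gt_of_ne (ne_of_apply_ne _ hne') with hlt | hlt
    · obtain ⟨l₁, j, l₂, rfl, hl⟩ := ih hlt hne' h
      refine ⟨i :: l₁, j, l₂, rfl, ?_⟩
      have := s_mul_reflection i (simpleFun n i a) (simpleFun n i b)
      rw [simpleFun_involutive, simpleFun_involutive] at this
      rw [wordProd_cons, ← mul_assoc, ← this, mul_assoc, hl, List.cons_append, wordProd_cons]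
    · obtain ⟨rfl, rfl⟩ := eq_succ_of_simpleFun_lt hab hlt
      refine ⟨[], _, l, rfl, ?_⟩
      rw [wordProd_cons, reflection_succ, s_mul_s_mul, List.nil_append]

theorem length_reflection_mul_lt {w : W n} {a b : ℤ} (hab : a < b) (hne : (a : ZMod n) ≠ b)
    (h : pos w b < pos w a) : length (reflection a b * w) < length w := by
  obtain ⟨l, rfl, hlen⟩ := exists_reducedWord w
  obtain ⟨l₁, i, l₂, rfl, e⟩ := strong_exchange l hab hne h
  rw [e, ← hlen]
  refine (length_wordProd_le _).trans_lt ?_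
  simp

theorem lt_length_reflection_mul {w : W n} {a b : ℤ} (hab : a < b) (hne : (a : ZMod n) ≠ b)
    (h : pos w a < pos w b) : length w < length (reflection a b * w) := by
  have := length_reflection_mul_lt (w := reflection a b * w) hab hne
    (by rwa [pos_reflection_mul_left hne, pos_reflection_mul_right hne])
  rwa [reflection_mul_reflection_mul] at this

theorem lt_length_mul_reflection {w : W n} {p q : ℤ} (hpq : p < q) (hne : (p : ZMod n) ≠ q)
    (h : value w p < value w q) : length w < length (w * reflection p q) := by
  rw [mul_reflection]
  refine lt_length_reflection_mul h ((value_cast_eq_iff w).not.2 hne) ?_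
  rwa [pos_value, pos_value]

theorem length_s_mul_le (i : ZMod n) (w : W n) : length (s i * w) ≤ length w + 1 := by
  obtain ⟨l, rfl, hlen⟩ := exists_reducedWord w
  rw [← wordProd_cons, ← hlen]
  exact length_wordProd_le _

/-- `w` has a left ascent at `i`: `ℓ(s_i w) > ℓ(w)`. Otherwise `i` is a left descent. -/
def IsLeftAscent (i : ZMod n) (w : W n) : Prop := length w < length (s i * w)

theorem isLeftAscent_iff (k : ℤ) (w : W n) :
    IsLeftAscent (k : ZMod n) w ↔ pos w k < pos w (k + 1) := by
  have hne : (k : ZMod n) ≠ ((k + 1 : ℤ) : ZMod n) := (intCast_succ_ne k).symm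
  have hp : pos w k ≠ pos w (k + 1) := (pos_injective w).ne (by omega)
  rw [IsLeftAscent, ← reflection_succ]
  refine ⟨fun h => ?_, lt_length_reflection_mul (by omega) hne⟩
  by_contra hlt
  have := length_reflection_mul_lt (w := w) (show k < k + 1 by omega) hne (by omega)
  omega

theorem not_isLeftAscent_iff (k : ℤ) (w : W n) :
    ¬ IsLeftAscent (k : ZMod n) w ↔ pos w (k + 1) < pos w k := by
  have hp : pos w k ≠ pos w (k + 1) := (pos_injective w).ne (by omega)
  rw [isLeftAscent_iff]
  omega

theorem isLeftAscent_s_mul_iff (i : ZMod n) (w : W n) :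
    IsLeftAscent i (s i * w) ↔ ¬ IsLeftAscent i w := by
  obtain ⟨k, rfl⟩ := ZMod.intCast_surjective i
  rw [isLeftAscent_iff, not_isLeftAscent_iff, pos_s_mul, pos_s_mul, simpleFun_left, simpleFun_right]

theorem IsLeftAscent.length_s_mul {i : ZMod n} {w : W n} (h : IsLeftAscent i w) :
    length (s i * w) = length w + 1 :=
  le_antisymm (length_s_mul_le i w) h

theorem length_s_mul_of_not_isLeftAscent {i : ZMod n} {w : W n} (h : ¬ IsLeftAscent i w) :
    length (s i * w) + 1 = length w := by
  have := ((isLeftAscent_s_mul_iff i w).2 h).length_s_mul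
  rw [s_mul_s_mul] at this
  exact this.symm

theorem exists_not_isLeftAscent {w : W n} (h : w ≠ 1) : ∃ i, ¬ IsLeftAscent i w := by
  obtain ⟨l, rfl, hlen⟩ := exists_reducedWord w
  cases l with
  | nil => exact absurd rfl h
  | cons i l =>
    refine ⟨i, fun hi => ?_⟩
    have h1 := hi.length_s_mul
    rw [wordProd_cons, s_mul_s_mul, ← wordProd_cons] at h1
    have h2 := length_wordProd_le l
    simp only [List.length_cons] at hlen
    omega

theorem isLeftAscent_induction {p : W n → Prop} (one : p 1)
    (step : ∀ (i : ZMod n) (w : W n), IsLeftAscent i w → p w → p (s i * w)) (w : W n) : p w := by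
  induction hm : length w using Nat.strong_induction_on generalizing w with
  | _ m ih =>
    by_cases hw : w = 1
    · rwa [hw]
    · obtain ⟨i, hi⟩ := exists_not_isLeftAscent hw
      have h := step i (s i * w) ((isLeftAscent_s_mul_iff i w).2 hi)
        (ih _ (by have := length_s_mul_of_not_isLeftAscent hi; omega) _ rfl)
      rwa [s_mul_s_mul] at h

theorem abs_value_wordProd_sub_le (l : List (ZMod n)) (k : ℤ) :
    |value (wordProd l) k - k| ≤ l.length := by
  induction l with
  | nil => simp [wordProd, value_one]
  | cons i l ih =>
    rw [wordProd_cons, value_mul, value_s, List.length_cons, Nat.cast_succ, add_comm]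
    exact (abs_sub_le _ (value (wordProd l) k) _).trans (add_le_add (abs_simpleFun_sub_le i _) ih)

theorem abs_sub_pos_le (w : W n) (a : ℤ) : |a - pos w a| ≤ length w := by
  obtain ⟨l, hl, hlen⟩ := exists_reducedWord w
  have := abs_value_wordProd_sub_le l (pos w a)
  rwa [hl, value_pos, hlen] at this

theorem pos_pos_of_length_lt {w : W n} {a : ℤ} (h : length w < a) : 0 < pos w a := by
  have := abs_le.1 (abs_sub_pos_le w a)
  omega

theorem pos_nonpos_of_le_neg_length {w : W n} {a : ℤ} (h : a ≤ -length w) : pos w a ≤ 0 := by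
  have := abs_le.1 (abs_sub_pos_le w a)
  omega

/-! ### Bruhat covers -/

theorem value_reflection_add_left {i j : ℤ} (h : (i : ZMod n) ≠ j) (a m : ℤ) :
    value (reflection i (j + a * n) : W n) (i + m * n) = j + (a + m) * n := by
  rw [value_reflection (cast_ne_cast_add_mul h a), transposition_add_left]
  ring

theorem value_reflection_add_right {i j : ℤ} (h : (i : ZMod n) ≠ j) (a m : ℤ) :
    value (reflection i (j + a * n) : W n) (j + m * n) = i + (m - a) * n := by
  have := transposition_add_right (cast_ne_cast_add_mul h a) (m - a)
  rwa [show j + a * n + (m - a) * n = j + m * (n : ℤ) by ring,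
    ← value_reflection (cast_ne_cast_add_mul h a)] at this

theorem reflection_mul_reflection_mul_reflection {i j : ℤ} (h : (i : ZMod n) ≠ j) (a b c : ℤ) :
    (reflection i (j + a * n) * reflection i (j + b * n) * reflection i (j + c * n) : W n) =
      reflection i (j + (a - b + c) * n) := by
  refine ext_value fun k => ?_
  rw [value_mul, value_mul]
  induction k using transposition_cases (n := n) (i := i) (j := j) with
  | left m =>
    rw [value_reflection_add_left h, value_reflection_add_right h, value_reflection_add_left h,
      value_reflection_add_left h]
    ring
  | right m =>
    rw [value_reflection_add_right h, value_reflection_add_left h, value_reflection_add_right h,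
      value_reflection_add_right h]
    ring
  | other k hi hj =>
    have fixed (a : ℤ) : value (reflection i (j + a * n) : W n) k = k :=
      value_reflection_of_ne (cast_ne_cast_add_mul h a) hi (by simpa using hj)
    rw [fixed, fixed, fixed, fixed]

theorem length_add_three_le_of_increasing {y r₁ r₂ r₃ t : W n} (e : r₁ * r₂ * r₃ = t)
    (h₁ : length y < length (y * r₁)) (h₂ : length (y * r₁) < length (y * r₁ * r₂))
    (h₃ : length (y * r₁ * r₂) < length (y * r₁ * r₂ * r₃)) :
    length y + 3 ≤ length (y * t) := by
  rw [← e, ← mul_assoc, ← mul_assoc]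
  omega

theorem length_add_three_le_of_residues_ne {y : W n} {p q j : ℤ} (hpq : p < q) (hqj : q < j)
    (h1 : value y p < value y q) (h2 : value y q < value y j)
    (n1 : (p : ZMod n) ≠ q) (n2 : (q : ZMod n) ≠ j) (n3 : (p : ZMod n) ≠ j) :
    length y + 3 ≤ length (y * reflection p j) := by
  have fixed_j : value (reflection p q : W n) j = j := value_reflection_of_ne n1 n3 n2
  refine length_add_three_le_of_increasing (r₁ := reflection p q) (r₂ := reflection q j)
    (r₃ := reflection p q) ?_ (lt_length_mul_reflection hpq n1 h1)
    (lt_length_mul_reflection hqj n2 ?_) (lt_length_mul_reflection hpq n1 ?_)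
  · rw [mul_reflection (reflection p q) q j, value_reflection_right n1, fixed_j, mul_assoc,
      reflection_mul_self, mul_one]
  · rw [value_mul, value_mul, value_reflection_right n1, fixed_j]
    exact h1.trans h2
  · rw [value_mul, value_mul, value_mul, value_mul, value_reflection_left n2,
      value_reflection_of_ne n2 n1.symm n3.symm, value_reflection_left n1, fixed_j]
    exact h2

theorem exists_mul_lt_and_lt {D m : ℤ} (hm : 0 < m) (hmD : m < D) (h : ¬ m ∣ D) :
    ∃ x : ℤ, 0 ≤ x ∧ (x + 1) * m < D ∧ D < (x + 2) * m := by
  have hr : 0 < D % m := (Int.emod_nonneg D hm.ne').lt_of_ne'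
    fun h0 => h (Int.dvd_of_emod_eq_zero h0)
  have hr' := Int.emod_lt_of_pos D hm
  have hD := Int.emod_add_mul_ediv D m
  have hq : 1 ≤ D / m := (Int.le_ediv_iff_mul_le hm).2 (by omega)
  exact ⟨D / m - 1, by omega, by linarith, by linarith⟩

theorem length_add_three_le_of_period_lt {y : W n} {p j : ℤ} (hpj : (n : ℤ) < j - p)
    (h : (n : ℤ) < value y j - value y p) (hne : (p : ZMod n) ≠ j) :
    length y + 3 ≤ length (y * reflection p j) := by
  have hn := two_le_period (n := n)
  have hdvd : ¬ (n : ℤ) ∣ value y j - value y p := fun hd =>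
    (value_cast_eq_iff y).not.2 hne ((ZMod.intCast_eq_intCast_iff_dvd_sub _ _ n).2 hd)
  obtain ⟨x, hx0, hx1, hx2⟩ := exists_mul_lt_and_lt (by omega) h hdvd
  have := mul_nonneg hx0 (Int.natCast_nonneg n)
  have hleft (a : ℤ) : value (reflection p (j + a * n) : W n) p = j + a * n := by
    simpa using value_reflection_add_left hne a 0
  refine length_add_three_le_of_increasing (r₁ := reflection p (j + (-1) * n))
    (r₂ := reflection p (j + x * n)) (r₃ := reflection p (j + (x + 1) * n)) ?_
    (lt_length_mul_reflection (by linarith) (cast_ne_cast_add_mul hne _) ?_)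
    (lt_length_mul_reflection (by linarith) (cast_ne_cast_add_mul hne _) ?_)
    (lt_length_mul_reflection (by linarith) (cast_ne_cast_add_mul hne _) ?_)
  · rw [reflection_mul_reflection_mul_reflection hne]
    congr 1
    ring
  · rw [value_add_mul_period]
    linarith
  · rw [value_mul, value_mul, hleft, value_reflection_add_right hne, value_add_mul_period,
      value_add_mul_period]
    linarith
  · rw [value_mul, value_mul, value_mul, value_mul, hleft, value_reflection_add_right hne,
      value_reflection_add_right hne, value_reflection_add_left hne, value_add_mul_period,
      value_add_mul_period]
    linarith

theorem length_add_three_le_of_between {y : W n} {p q j : ℤ} (hpq : p < q) (hqj : q < j)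
    (h1 : value y p < value y q) (h2 : value y q < value y j) (hne : (p : ZMod n) ≠ j) :
    length y + 3 ≤ length (y * reflection p j) := by
  have := two_le_period (n := n)
  by_cases e1 : (p : ZMod n) = q
  · obtain ⟨m, rfl⟩ := exists_eq_add_mul e1
    rw [value_add_mul_period] at h1 h2
    have hm : 0 < m := by nlinarith
    exact length_add_three_le_of_period_lt (by nlinarith) (by nlinarith) hne
  by_cases e2 : (j : ZMod n) = q
  · obtain ⟨m, rfl⟩ := exists_eq_add_mul e2
    rw [value_add_mul_period] at h1 h2
    have hm : m < 0 := by nlinarith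
    exact length_add_three_le_of_period_lt (by nlinarith) (by nlinarith) hne
  exact length_add_three_le_of_residues_ne hpq hqj h1 h2 e1 (Ne.symm e2) hne

section Cover

variable {w : W n} {a b : ℤ}

theorem cast_ne_of_bruhatCover (h : BruhatCover (reflection a b * w) w) : (a : ZMod n) ≠ b := by
  intro e
  have := h.2
  rw [reflection_of_eq e, one_mul] at this
  omega

theorem lt_iff_pos_lt_of_length_lt (h : length (reflection a b * w) < length w)
    (hne : (a : ZMod n) ≠ b) : a < b ↔ pos w b < pos w a := by
  have hp : pos w a ≠ pos w b := (pos_injective w).ne (ne_of_apply_ne _ hne)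
  constructor <;> intro hlt
  · by_contra hp'
    have := lt_length_reflection_mul (w := w) hlt hne (by omega)
    omega
  · by_contra hab
    have hba : b < a := lt_of_le_of_ne (not_lt.1 hab) (ne_of_apply_ne _ hne).symm
    have := lt_length_reflection_mul (w := w) hba hne.symm hlt
    rw [reflection_comm] at this
    omega

theorem strong_exchange_of_length_lt (h : length (reflection a b * w) < length w)
    {l : List (ZMod n)} (hl : wordProd l = w) :
    ∃ l₁ i l₂, l = l₁ ++ i :: l₂ ∧ reflection a b * w = wordProd (l₁ ++ l₂) := by
  have hne : (a : ZMod n) ≠ b := by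
    intro e
    rw [reflection_of_eq e, one_mul] at h
    exact h.false
  subst hl
  rcases lt_or_gt_of_ne (ne_of_apply_ne _ hne : a ≠ b) with hab | hab
  · exact strong_exchange l hab hne ((lt_iff_pos_lt_of_length_lt h hne).1 hab)
  · rw [reflection_comm] at h ⊢
    exact strong_exchange l hab hne.symm ((lt_iff_pos_lt_of_length_lt h hne.symm).1 hab)

theorem bruhatCover_reflection_mul_iff :
    BruhatCover (reflection a b * w) w ↔ length (reflection a b * w) + 1 = length w := by
  refine ⟨fun h => h.2, fun h => ⟨?_, h⟩⟩
  obtain ⟨l, hl⟩ := exists_reducedWord w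
  obtain ⟨l₁, i, l₂, rfl, e⟩ :=
    strong_exchange_of_length_lt (w := w) (a := a) (b := b) (by omega) hl.1
  refine ⟨l₁ ++ l₂, _, ⟨e.symm, ?_⟩, hl, List.Sublist.append_left (List.sublist_cons_self i l₂) l₁⟩
  have := hl.2
  simp only [List.length_append, List.length_cons] at this ⊢
  omega

theorem lt_of_bruhatCover (ha : 0 < pos w a) (hb : pos w b ≤ 0)
    (h : BruhatCover (reflection a b * w) w) : a < b :=
  (lt_iff_pos_lt_of_length_lt (h.2 ▸ Nat.lt_succ_self _) (cast_ne_of_bruhatCover h)).2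
    (hb.trans_lt ha)

/-- A special case of the lifting property of the Bruhat order. -/
theorem not_isLeftAscent_of_bruhatCover {i : ZMod n} (hw : ¬ IsLeftAscent i w)
    (h : BruhatCover (reflection a b * w) w) (hne : reflection a b * w ≠ s i * w) :
    ¬ IsLeftAscent i (reflection a b * w) := by
  obtain ⟨l, hl, hlen⟩ := exists_reducedWord (s i * w)
  have hw' := length_s_mul_of_not_isLeftAscent hw
  have hlt := h.2
  obtain ⟨l₁, j, l₂, e, h2⟩ := strong_exchange_of_length_lt (w := w) (a := a) (b := b)
    (by omega) (show wordProd (i :: l) = w by rw [wordProd_cons, hl, s_mul_s_mul])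
  cases l₁ with
  | nil =>
    simp only [List.nil_append, List.cons.injEq] at e h2
    rw [← e.2, hl] at h2
    exact absurd h2 hne
  | cons j' l₁ =>
    simp only [List.cons_append, List.cons.injEq] at e h2
    obtain ⟨rfl, e⟩ := e
    intro hasc
    have h3 := hasc.length_s_mul
    have h4 := length_wordProd_le (l₁ ++ l₂)
    rw [h2, wordProd_cons, s_mul_s_mul, ← wordProd_cons] at h3
    rw [e] at hlen
    simp only [List.length_append, List.length_cons] at h4 hlen
    rw [h2] at hlt
    omega

theorem value_notMem_Ioo_of_bruhatCover (h : BruhatCover (reflection a b * w) w) {q : ℤ}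
    (hq : q ∈ Set.Ioo (pos w b) (pos w a)) : value (reflection a b * w) q ∉ Set.Ioo a b := by
  rintro ⟨ha, hb⟩
  have hne := cast_ne_of_bruhatCover h
  set y := reflection a b * w with hy
  have hvp : value y (pos w b) = a := by rw [← pos_reflection_mul_left hne, ← hy, value_pos]
  have hvj : value y (pos w a) = b := by rw [← pos_reflection_mul_right hne, ← hy, value_pos]
  have hw : y * reflection (pos w b) (pos w a) = w := by
    rw [mul_reflection, hvp, hvj, hy, reflection_mul_reflection_mul]
  have := length_add_three_le_of_between hq.1 hq.2 (by rwa [hvp]) (by rwa [hvj])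
    ((pos_cast_eq_iff w).not.2 hne.symm)
  rw [hw] at this
  have := h.2
  omega

end Cover

/-! ### Marked strong covers in terms of values -/

theorem markedStrongCover_iff {c : ℤ} {w y : W n} : MarkedStrongCover w c y ↔
    ∃ b, 0 < pos w c ∧ pos w b ≤ 0 ∧ y = reflection c b * w ∧
      BruhatCover (reflection c b * w) w := by
  constructor
  · rintro ⟨hcover, i, j, hi, hj, hij, hv, h1, -⟩
    have e : w = y * reflection i j :=
      ext_value fun k => by rw [value_mul, value_reflection hij, hv]
    have e1 : y = reflection (value w j) (value w i) * w := by
      rw [← mul_reflection, e, mul_assoc, reflection_comm j i, reflection_mul_self, mul_one]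
    rw [h1]
    exact ⟨value w i, by rwa [pos_value], by rwa [pos_value], e1, by rwa [← e1]⟩
  · rintro ⟨b, hc, hb, rfl, h⟩
    have hne := cast_ne_of_bruhatCover h
    have hne' : (pos w b : ZMod n) ≠ pos w c := (pos_cast_eq_iff w).not.2 hne.symm
    refine ⟨h, pos w b, pos w c, hb, hc, hne', fun k => ?_, (value_pos w c).symm, ?_⟩
    · rw [value_mul, value_transposition w hne', value_pos, value_pos, value_reflection hne,
        transposition_comm hne.symm, transposition_involutive hne]
    · rw [value_mul, value_pos, value_reflection_right hne]

section MarkedStrongCover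

variable {c k : ℤ} {w y z : W n}

theorem MarkedStrongCover.pos_pos (h : MarkedStrongCover w c y) : 0 < pos w c := by
  obtain ⟨b, hc, -⟩ := markedStrongCover_iff.1 h
  exact hc

theorem MarkedStrongCover.pos_nonpos (h : MarkedStrongCover w c y) : pos y c ≤ 0 := by
  obtain ⟨b, -, hb, rfl, hcov⟩ := markedStrongCover_iff.1 h
  rwa [pos_reflection_mul_left (cast_ne_of_bruhatCover hcov)]

theorem MarkedStrongCover.length_add_one (h : MarkedStrongCover w c y) :
    length y + 1 = length w := h.1.2

theorem le_length_of_pos_nonpos {b : ℤ} (h : pos w b ≤ 0) : b ≤ length w := by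
  by_contra hlt
  have := pos_pos_of_length_lt (not_le.1 hlt)
  omega

theorem MarkedStrongCover.lt_length (h : MarkedStrongCover w c y) : c < length w := by
  obtain ⟨b, hc, hb, rfl, hcov⟩ := markedStrongCover_iff.1 h
  exact (lt_of_bruhatCover hc hb hcov).trans_le (le_length_of_pos_nonpos hb)

theorem MarkedStrongCover.neg_length_lt (h : MarkedStrongCover w c y) : -length w < c := by
  by_contra hlt
  have := pos_nonpos_of_le_neg_length (not_lt.1 hlt)
  have := h.pos_pos
  omega

theorem finite_setOf_markedStrongCover (c : ℤ) (w : W n) :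
    {y | MarkedStrongCover w c y}.Finite := by
  refine ((Set.finite_Icc c (length w)).image fun b => reflection c b * w).subset ?_
  intro y h
  obtain ⟨b, hc, hb, rfl, hcov⟩ := markedStrongCover_iff.1 h
  exact ⟨b, ⟨(lt_of_bruhatCover hc hb hcov).le, le_length_of_pos_nonpos hb⟩, rfl⟩

/-- The finite set of all `y` with a marked strong cover `w → y` of marking `c`. -/
def markedCovers (c : ℤ) (w : W n) : Finset (W n) := (finite_setOf_markedStrongCover c w).toFinset

theorem mem_markedCovers : y ∈ markedCovers c w ↔ MarkedStrongCover w c y := by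
  simp [markedCovers]

theorem markedStrongCover_s_mul_self_iff {i : ZMod n} :
    MarkedStrongCover w c (s i * w) ↔ (c : ZMod n) = i ∧ 0 < pos w c ∧ pos w (c + 1) ≤ 0 := by
  rw [markedStrongCover_iff]
  constructor
  · rintro ⟨b, hc, hb, e, h⟩
    have hlt := lt_of_bruhatCover hc hb h
    have hv : simpleFun n i c = b := by
      rw [← value_s, mul_right_cancel e, value_reflection_left (cast_ne_of_bruhatCover h)]
    unfold simpleFun at hv
    split_ifs at hv with h1 h2
    · subst hv; exact ⟨h1, hc, hb⟩
    · omega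
    · omega
  · rintro ⟨rfl, hc, hb⟩
    refine ⟨c + 1, hc, hb, by rw [reflection_succ], bruhatCover_reflection_mul_iff.2 ?_⟩
    rw [reflection_succ]
    exact length_s_mul_of_not_isLeftAscent ((not_isLeftAscent_iff c w).2 (by omega))

theorem MarkedStrongCover.eq_s_mul {i : ZMod n} (h : MarkedStrongCover w c y)
    (hw : ¬ IsLeftAscent i w) (hy : IsLeftAscent i y) : y = s i * w := by
  obtain ⟨b, -, -, rfl, hcov⟩ := markedStrongCover_iff.1 h
  by_contra hne
  exact not_isLeftAscent_of_bruhatCover hw hcov hne hy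

theorem MarkedStrongCover.s_mul {i : ZMod n} (h : MarkedStrongCover w c y)
    (hiff : IsLeftAscent i w ↔ IsLeftAscent i y) :
    MarkedStrongCover (s i * w) (simpleFun n i c) (s i * y) := by
  have hlen : length (s i * y) + 1 = length (s i * w) := by
    have := h.length_add_one
    by_cases hw : IsLeftAscent i w
    · rw [hw.length_s_mul, (hiff.1 hw).length_s_mul, this]
    · have := length_s_mul_of_not_isLeftAscent hw
      have := length_s_mul_of_not_isLeftAscent (hiff.not.1 hw)
      omega
  obtain ⟨b, hc, hb, rfl, -⟩ := markedStrongCover_iff.1 h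
  have e : s i * (reflection c b * w) =
      reflection (simpleFun n i c) (simpleFun n i b) * (s i * w) := by
    rw [← mul_assoc, s_mul_reflection, mul_assoc]
  refine markedStrongCover_iff.2 ⟨simpleFun n i b, ?_, ?_, e,
    bruhatCover_reflection_mul_iff.2 (by rw [← e, hlen])⟩
  · rwa [pos_s_mul, simpleFun_involutive]
  · rwa [pos_s_mul, simpleFun_involutive]

theorem markedStrongCover_s_mul_iff {i : ZMod n} (hw : IsLeftAscent i w) :
    (MarkedStrongCover (s i * w) c y ∧ y ≠ w) ↔
      (MarkedStrongCover w (simpleFun n i c) (s i * y) ∧ IsLeftAscent i (s i * y)) := by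
  have hsw : ¬ IsLeftAscent i (s i * w) := (isLeftAscent_s_mul_iff i w).not.2 (not_not.2 hw)
  constructor
  · rintro ⟨h, hne⟩
    have hy : ¬ IsLeftAscent i y := fun hy => hne (by rw [h.eq_s_mul hsw hy, s_mul_s_mul])
    have h' := h.s_mul (iff_of_false hsw hy)
    rw [s_mul_s_mul] at h'
    exact ⟨h', (isLeftAscent_s_mul_iff i y).2 hy⟩
  · rintro ⟨h, hy⟩
    have h' := h.s_mul (iff_of_true hw hy)
    rw [s_mul_s_mul, simpleFun_involutive] at h'
    refine ⟨h', ?_⟩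
    rintro rfl
    exact (isLeftAscent_s_mul_iff i y).1 hy hw

theorem MarkedStrongCover.pos_succ_pos (h : MarkedStrongCover w k y)
    (hw : IsLeftAscent (k : ZMod n) w) : 0 < pos y (k + 1) := by
  rw [isLeftAscent_iff] at hw
  obtain ⟨b, hc, hb, rfl, hcov⟩ := markedStrongCover_iff.1 h
  have hne := cast_ne_of_bruhatCover hcov
  by_cases hb' : (b : ZMod n) = ((k + 1 : ℤ) : ZMod n)
  · obtain ⟨m, hm⟩ := exists_eq_add_mul hb'
    rw [pos_reflection_mul hne, hm, transposition_add_right hne, pos_add_mul]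
    rw [hm, pos_add_mul] at hw
    omega
  · rw [pos_reflection_mul_of_ne hne (intCast_succ_ne k).symm hb']
    omega

theorem MarkedStrongCover.pos_pred_nonpos (h : MarkedStrongCover w (k + 1) y)
    (hy : IsLeftAscent (k : ZMod n) y) : pos y k ≤ 0 ∧ pos w k ≤ 0 := by
  have h1 := h.pos_nonpos
  have hy' := (isLeftAscent_iff k y).1 hy
  refine ⟨by omega, ?_⟩
  have hw : IsLeftAscent (k : ZMod n) w := by
    by_contra hw
    have e := h.eq_s_mul hw hy
    rw [e, markedStrongCover_s_mul_self_iff] at h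
    exact intCast_succ_ne k h.1
  rw [isLeftAscent_iff] at hw
  by_contra hk
  obtain ⟨b, hc, hb, rfl, hcov⟩ := markedStrongCover_iff.1 h
  have hne := cast_ne_of_bruhatCover hcov
  rw [pos_reflection_mul_left hne] at hy' h1
  by_cases hb' : (b : ZMod n) = (k : ZMod n)
  · obtain ⟨m, hm⟩ := exists_eq_add_mul hb'
    have ht := transposition_add_right hne m
    rw [← hm] at ht
    rw [pos_reflection_mul hne, ht, pos_add_mul] at hy'
    rw [hm, pos_add_mul] at hk
    omega
  · rw [pos_reflection_mul_of_ne hne (intCast_succ_ne k) hb'] at hy'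
    omega

theorem lt_of_bruhatCover_bruhatCover_succ {b₁ b₂ : ℤ} (hw : pos w k < pos w (k + 1))
    (hb₁ : pos w b₁ ≤ 0) (hk : 0 < pos w k) (h₁ : BruhatCover (reflection k b₁ * w) w)
    (hb₂ : pos (reflection k b₁ * w) b₂ ≤ 0)
    (h₂ : BruhatCover (reflection (k + 1) b₂ * (reflection k b₁ * w)) (reflection k b₁ * w)) :
    b₂ < b₁ := by
  have ne₁ := cast_ne_of_bruhatCover h₁
  have ne₂ := cast_ne_of_bruhatCover h₂
  have lt₁ := lt_of_bruhatCover hk hb₁ h₁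
  have := two_le_period (n := n)
  set y := reflection k b₁ * w
  have yb : pos y b₁ = pos w k := pos_reflection_mul_right ne₁
  by_cases e : (b₂ : ZMod n) = (b₁ : ZMod n)
  · obtain ⟨m, hm⟩ := exists_eq_add_mul e
    rw [hm, pos_add_mul] at yb
    omega
  by_contra hlt
  have hlt : b₁ < b₂ := lt_of_le_of_ne (not_lt.1 hlt) (ne_of_apply_ne _ e).symm
  have e₁ : ((k + 1 : ℤ) : ZMod n) ≠ b₁ := by
    intro e₁
    obtain ⟨m, hm⟩ := exists_eq_add_mul e₁.symm
    rw [hm, pos_add_mul] at hw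
    omega
  have yk : pos y (k + 1) = pos w (k + 1) :=
    pos_reflection_mul_of_ne ne₁ (intCast_succ_ne k).symm e₁.symm
  have zv : value (reflection (k + 1) b₂ * y) (pos w k) = b₁ := by
    rw [← yb, ← pos_reflection_mul_of_ne ne₂ e₁ e, value_pos]
  have hb₁k : k + 1 ≠ b₁ := ne_of_apply_ne _ e₁
  refine value_notMem_Ioo_of_bruhatCover h₂ (q := pos w k) ⟨by omega, by rwa [yk]⟩ ?_
  rw [zv]
  exact ⟨by omega, hlt⟩

theorem not_markedStrongCover_succ (h₁ : MarkedStrongCover w k y) (hw : IsLeftAscent (k : ZMod n) w)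
    (hz : IsLeftAscent (k : ZMod n) z) : ¬ MarkedStrongCover y (k + 1) z := by
  intro h₂
  have hw' := (isLeftAscent_iff k w).1 hw
  have hz' := (isLeftAscent_iff k z).1 hz
  obtain ⟨b₁, hk, hb₁, rfl, hcov₁⟩ := markedStrongCover_iff.1 h₁
  obtain ⟨b₂, hk₁, hb₂, rfl, hcov₂⟩ := markedStrongCover_iff.1 h₂
  have ne₁ := cast_ne_of_bruhatCover hcov₁
  have ne₂ := cast_ne_of_bruhatCover hcov₂
  have lt₁ := lt_of_bruhatCover hk hb₁ hcov₁
  have lt₂ := lt_of_bruhatCover hk₁ hb₂ hcov₂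
  have hbb := lt_of_bruhatCover_bruhatCover_succ hw' hb₁ hk hcov₁ hb₂ hcov₂
  have yk : pos (reflection k b₁ * w) k = pos w b₁ := pos_reflection_mul_left ne₁
  rw [pos_reflection_mul_left ne₂] at hz'
  have hp : pos w b₁ < pos (reflection k b₁ * w) b₂ := by
    by_cases e : (k : ZMod n) = (b₂ : ZMod n)
    · obtain ⟨m, rfl⟩ := exists_eq_add_mul e
      rw [pos_add_mul, yk]
      omega
    · rwa [pos_reflection_mul_of_ne ne₂ (intCast_succ_ne k) (Ne.symm e), yk] at hz'
  refine value_notMem_Ioo_of_bruhatCover hcov₁ ⟨hp, by omega⟩ ?_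
  rw [value_pos]
  exact ⟨by omega, hbb⟩

end MarkedStrongCover

/-! ### Operators on the free module with basis the affine symmetric group -/

section Operators

variable {R R' : Type*} [CommRing R] [CommRing R']

/-- The basis vector indexed by `w`, standing for `A_w`. -/
def basisVec (R : Type*) [CommRing R] (w : W n) : W n →₀ R := Finsupp.single w 1

theorem end_ext {f g : Module.End R (W n →₀ R)} (h : ∀ w, f (basisVec R w) = g (basisVec R w)) :
    f = g :=
  Finsupp.lhom_ext' fun w => LinearMap.ext_ring (h w)

theorem linearCombination_basisVec (f : W n → (W n →₀ R)) (w : W n) :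
    Finsupp.linearCombination R f (basisVec R w) = f w := by
  simp [basisVec]

open Classical in
/-- Left multiplication by `A_i` in the basis of the `A_w`: `A_i A_w` is `A_{s_i w}` or `0`
according to whether `s_i w` is longer or shorter than `w`. -/
def upOp (R : Type*) [CommRing R] (i : ZMod n) : Module.End R (W n →₀ R) :=
  Finsupp.linearCombination R fun w => if IsLeftAscent i w then basisVec R (s i * w) else 0

/-- The projection to the span of all `w` in which the value `c` has positive position. -/
def posOp (n : ℕ) [n.AtLeastTwo] (R : Type*) [CommRing R] (c : ℤ) :
    Module.End R (W n →₀ R) :=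
  Finsupp.linearCombination R fun w => if 0 < pos w c then basisVec R w else 0

/-- The operator that takes `w` to the sum of the lower ends of its marked strong covers of
marking `c`. -/
def coverOp (n : ℕ) [n.AtLeastTwo] (R : Type*) [CommRing R] (c : ℤ) :
    Module.End R (W n →₀ R) :=
  Finsupp.linearCombination R fun w => ∑ y ∈ markedCovers c w, basisVec R y

theorem upOp_of_isLeftAscent {i : ZMod n} {w : W n} (h : IsLeftAscent i w) :
    upOp R i (basisVec R w) = basisVec R (s i * w) := by
  rw [upOp, linearCombination_basisVec, if_pos h]

theorem upOp_of_not_isLeftAscent {i : ZMod n} {w : W n} (h : ¬ IsLeftAscent i w) :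
    upOp R i (basisVec R w) = 0 := by
  rw [upOp, linearCombination_basisVec, if_neg h]

theorem posOp_of_pos {c : ℤ} {w : W n} (h : 0 < pos w c) :
    posOp n R c (basisVec R w) = basisVec R w := by
  rw [posOp, linearCombination_basisVec, if_pos h]

theorem posOp_of_nonpos {c : ℤ} {w : W n} (h : pos w c ≤ 0) : posOp n R c (basisVec R w) = 0 := by
  rw [posOp, linearCombination_basisVec, if_neg (not_lt.2 h)]

theorem coverOp_basisVec (c : ℤ) (w : W n) :
    coverOp n R c (basisVec R w) = ∑ y ∈ markedCovers c w, basisVec R y := by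
  rw [coverOp, linearCombination_basisVec]

theorem coverOp_of_nonpos {c : ℤ} {w : W n} (h : pos w c ≤ 0) :
    coverOp n R c (basisVec R w) = 0 := by
  rw [coverOp_basisVec]
  refine Finset.sum_eq_zero fun y hy => ?_
  have := (mem_markedCovers.1 hy).pos_pos
  omega

theorem upOp_mul_upOp (i : ZMod n) : upOp R i * upOp R i = 0 := by
  refine end_ext fun w => ?_
  rw [Module.End.mul_apply, LinearMap.zero_apply]
  by_cases h : IsLeftAscent i w
  · rw [upOp_of_isLeftAscent h,
      upOp_of_not_isLeftAscent ((isLeftAscent_s_mul_iff i w).not.2 (not_not.2 h))]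
  · rw [upOp_of_not_isLeftAscent h, map_zero]

theorem posOp_comm (c d : ℤ) : posOp n R c * posOp n R d = posOp n R d * posOp n R c := by
  refine end_ext fun w => ?_
  simp only [Module.End.mul_apply]
  rcases lt_or_ge 0 (pos w c) with h | h <;> rcases lt_or_ge 0 (pos w d) with h' | h' <;>
    simp [posOp_of_pos, posOp_of_nonpos, h, h']

theorem posOp_mul_self (c : ℤ) : posOp n R c * posOp n R c = posOp n R c := by
  refine end_ext fun w => ?_
  simp only [Module.End.mul_apply]
  rcases lt_or_ge 0 (pos w c) with h | h <;> simp [posOp_of_pos, posOp_of_nonpos, h]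

theorem coverOp_mul_posOp (c : ℤ) : coverOp n R c * posOp n R c = coverOp n R c := by
  refine end_ext fun w => ?_
  simp only [Module.End.mul_apply]
  rcases lt_or_ge 0 (pos w c) with h | h
  · rw [posOp_of_pos h]
  · rw [posOp_of_nonpos h, coverOp_of_nonpos h, map_zero]

theorem posOp_mul_coverOp (c : ℤ) : posOp n R c * coverOp n R c = 0 := by
  refine end_ext fun w => ?_
  rw [Module.End.mul_apply, coverOp_basisVec, map_sum]
  refine Finset.sum_eq_zero fun y hy => ?_
  exact posOp_of_nonpos (mem_markedCovers.1 hy).pos_nonpos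

theorem posOp_mul_upOp (c : ℤ) (i : ZMod n) :
    posOp n R c * upOp R i = upOp R i * posOp n R (simpleFun n i c) := by
  refine end_ext fun w => ?_
  simp only [Module.End.mul_apply]
  by_cases h : IsLeftAscent i w
  · rcases lt_or_ge 0 (pos w (simpleFun n i c)) with h' | h'
    · rw [upOp_of_isLeftAscent h, posOp_of_pos (by rwa [pos_s_mul]), posOp_of_pos h',
        upOp_of_isLeftAscent h]
    · rw [upOp_of_isLeftAscent h, posOp_of_nonpos (by rwa [pos_s_mul]), posOp_of_nonpos h',
        map_zero]
  · rw [upOp_of_not_isLeftAscent h, map_zero]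
    rcases lt_or_ge 0 (pos w (simpleFun n i c)) with h' | h'
    · rw [posOp_of_pos h', upOp_of_not_isLeftAscent h]
    · rw [posOp_of_nonpos h', map_zero]

/-- The projection to the span of all `w` with `pos w c ≤ 0 < pos w d`. -/
def sepOp (n : ℕ) [n.AtLeastTwo] (R : Type*) [CommRing R] (c d : ℤ) : Module.End R (W n →₀ R) :=
  (1 - posOp n R c) * posOp n R d

open Classical in
theorem sepOp_basisVec (c d : ℤ) (w : W n) : sepOp n R c d (basisVec R w) =
    if pos w c ≤ 0 ∧ 0 < pos w d then basisVec R w else 0 := by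
  rcases lt_or_ge 0 (pos w d) with hd | hd <;> rcases lt_or_ge 0 (pos w c) with hc | hc <;>
    simp [sepOp, posOp_of_pos, posOp_of_nonpos, hc, hd, not_le.2, not_lt.2]

open Classical in
theorem upOp_coverOp_basisVec (i : ZMod n) (c : ℤ) (w : W n) :
    upOp R i (coverOp n R c (basisVec R w)) =
      ∑ y ∈ markedCovers c w with IsLeftAscent i y, basisVec R (s i * y) := by
  rw [coverOp_basisVec, map_sum, Finset.sum_filter]
  refine Finset.sum_congr rfl fun y _ => ?_
  by_cases h : IsLeftAscent i y
  · rw [upOp_of_isLeftAscent h, if_pos h]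
  · rw [upOp_of_not_isLeftAscent h, if_neg h]

open Classical in
theorem upOp_coverOp_of_not_isLeftAscent {i : ZMod n} {w : W n} (hw : ¬ IsLeftAscent i w) (c : ℤ) :
    upOp R i (coverOp n R c (basisVec R w)) =
      if MarkedStrongCover w c (s i * w) then basisVec R w else 0 := by
  have hfilter (y : W n) (hy : y ∈ (markedCovers c w).filter (IsLeftAscent i)) :
      MarkedStrongCover w c y ∧ y = s i * w := by
    rw [Finset.mem_filter, mem_markedCovers] at hy
    exact ⟨hy.1, hy.1.eq_s_mul hw hy.2⟩
  rw [upOp_coverOp_basisVec]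
  split_ifs with h
  · rw [Finset.sum_eq_single (s i * w), s_mul_s_mul]
    · exact fun y hy hne => absurd (hfilter y hy).2 hne
    · exact fun hn => absurd
        (Finset.mem_filter.2 ⟨mem_markedCovers.2 h, (isLeftAscent_s_mul_iff i w).2 hw⟩) hn
  · exact Finset.sum_eq_zero fun y hy => absurd ((hfilter y hy).2 ▸ (hfilter y hy).1) h

open Classical in
theorem coverOp_upOp_of_isLeftAscent {i : ZMod n} {w : W n} (hw : IsLeftAscent i w) (c : ℤ) :
    coverOp n R c (upOp R i (basisVec R w)) =
      upOp R i (coverOp n R (simpleFun n i c) (basisVec R w)) +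
        if MarkedStrongCover (s i * w) c w then basisVec R w else 0 := by
  have herase : ∑ y ∈ (markedCovers c (s i * w)).erase w, basisVec R y =
      upOp R i (coverOp n R (simpleFun n i c) (basisVec R w)) := by
    rw [upOp_coverOp_basisVec]
    refine Finset.sum_nbij' (s i * ·) (s i * ·) (fun y hy => ?_) (fun y hy => ?_)
      (fun y _ => s_mul_s_mul i y) (fun y _ => s_mul_s_mul i y)
      fun y _ => by rw [s_mul_s_mul]
    · rw [Finset.mem_erase, mem_markedCovers] at hy
      rw [Finset.mem_filter, mem_markedCovers]
      exact (markedStrongCover_s_mul_iff hw).1 hy.symm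
    · rw [Finset.mem_filter, mem_markedCovers] at hy
      rw [Finset.mem_erase, mem_markedCovers]
      refine ((markedStrongCover_s_mul_iff hw).2 ?_).symm
      rwa [s_mul_s_mul]
  rw [upOp_of_isLeftAscent hw, coverOp_basisVec, ← herase]
  split_ifs with hc
  · rw [add_comm, Finset.add_sum_erase _ _ (mem_markedCovers.2 hc)]
  · rw [Finset.erase_eq_of_notMem (mem_markedCovers.not.2 hc), add_zero]

theorem markedStrongCover_s_mul_left_iff {i : ZMod n} {c : ℤ} {w : W n} :
    MarkedStrongCover (s i * w) c w ↔
      (c : ZMod n) = i ∧ pos w c ≤ 0 ∧ 0 < pos w (c + 1) := by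
  have h := markedStrongCover_s_mul_self_iff (c := c) (i := i) (w := s i * w)
  rw [s_mul_s_mul, pos_s_mul, pos_s_mul] at h
  rw [h]
  refine and_congr_right fun hc => ?_
  rw [← hc, simpleFun_left, simpleFun_right, and_comm]

theorem simpleFun_cast_eq_iff {i : ZMod n} {c : ℤ} :
    (simpleFun n i c : ZMod n) = i ↔ (c : ZMod n) = i + 1 := by
  obtain ⟨k, rfl⟩ := ZMod.intCast_surjective i
  have h := value_cast_eq_iff (s (k : ZMod n)) (k := c) (l := k + 1)
  rwa [value_s, value_s, simpleFun_right, Int.cast_add, Int.cast_one] at h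

theorem markedStrongCover_simpleFun_iff {i : ZMod n} {c : ℤ} {w : W n} :
    MarkedStrongCover w (simpleFun n i c) (s i * w) ↔
      (c : ZMod n) = i + 1 ∧ pos w c ≤ 0 ∧ 0 < pos w (c - 1) := by
  rw [markedStrongCover_s_mul_self_iff, simpleFun_cast_eq_iff]
  refine and_congr_right fun hc => ?_
  have hi : i = ((c - 1 : ℤ) : ZMod n) := by push_cast; rw [hc]; ring
  have hf : simpleFun n i c = c - 1 := by
    have := simpleFun_right (n := n) (c - 1)
    rwa [sub_add_cancel, ← hi] at this
  rw [hf, sub_add_cancel, and_comm]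

theorem coverOp_mul_upOp (c : ℤ) (i : ZMod n) :
    coverOp n R c * upOp R i = upOp R i * coverOp n R (simpleFun n i c)
      + (if (c : ZMod n) = i then sepOp n R c (c + 1) else 0)
      - (if (c : ZMod n) = i + 1 then sepOp n R c (c - 1) else 0) := by
  classical
  have hite (p : Prop) [Decidable p] (d : ℤ) (w : W n) :
      (if p then sepOp n R c d else 0) (basisVec R w) =
        if p ∧ pos w c ≤ 0 ∧ 0 < pos w d then basisVec R w else 0 := by
    by_cases hp : p <;> simp [hp, sepOp_basisVec]
  refine end_ext fun w => ?_
  simp only [Module.End.mul_apply, LinearMap.add_apply, LinearMap.sub_apply, hite,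
    ← markedStrongCover_s_mul_left_iff, ← markedStrongCover_simpleFun_iff]
  by_cases hw : IsLeftAscent i w
  · have hlen := hw.length_s_mul
    rw [coverOp_upOp_of_isLeftAscent hw,
      if_neg fun h : MarkedStrongCover w (simpleFun n i c) (s i * w) => ?_, sub_zero]
    have := h.length_add_one
    omega
  · have hlen := length_s_mul_of_not_isLeftAscent hw
    rw [upOp_of_not_isLeftAscent hw, map_zero, upOp_coverOp_of_not_isLeftAscent hw,
      if_neg fun h : MarkedStrongCover (s i * w) c w => ?_, add_zero, sub_self]
    have := h.length_add_one
    omega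

theorem mul_mul_mul_eq_of_relations {E : Type*} [Ring E] {a x₁ x₂ q₁ q₂ : E} (haa : a * a = 0)
    (h₁ : x₁ * a = a * x₂ + (1 - q₁) * q₂) (h₂ : x₂ * a = a * x₁ - (1 - q₂) * q₁)
    (h₃ : q₂ * a = a * q₁) (h₄ : a * ((1 - q₂) * q₁) = 0) (hq : q₁ * q₂ = q₂ * q₁)
    (hqq : q₂ * q₂ = q₂) (hx : x₂ * q₂ = x₂) (h₅ : a * x₂ * q₁ = 0) (h₆ : a * q₁ * x₂ = 0) :
    a * x₂ * x₁ * a = (1 - q₂) * x₁ * a := by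
  have e₁ : a * x₂ * x₁ * a = a * x₂ := by
    calc a * x₂ * x₁ * a = a * (x₂ * a) * x₂ + a * (x₂ * q₂) - a * x₂ * (q₁ * q₂) := by
          rw [mul_assoc _ x₁ a, h₁]; noncomm_ring
      _ = a * a * x₁ * x₂ - a * ((1 - q₂) * q₁) * x₂ + a * (x₂ * q₂)
          - a * (x₂ * q₂) * q₁ := by
          rw [h₂, hq]; noncomm_ring
      _ = a * x₂ := by rw [haa, h₄, hx, h₅]; noncomm_ring
  have e₂ : (1 - q₂) * x₁ * a = a * x₂ := by
    calc (1 - q₂) * x₁ * a = a * x₂ - q₂ * a * x₂ + (1 - q₁) * q₂ - q₂ * q₂ + q₂ * q₁ * q₂ := by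
          rw [mul_assoc, h₁]; noncomm_ring
      _ = a * x₂ - a * q₁ * x₂ - q₁ * q₂ + q₁ * (q₂ * q₂) := by
          rw [← hq, h₃, hqq]; rw [mul_assoc q₁, hqq]; noncomm_ring
      _ = a * x₂ := by rw [h₆, hqq]; noncomm_ring
  rw [e₁, e₂]

section Adjacent

variable (k : ℤ)

theorem sepOp_succ_of_isLeftAscent {w : W n} (hw : IsLeftAscent (k : ZMod n) w) :
    sepOp n R (k + 1) k (basisVec R w) = 0 := by
  have := (isLeftAscent_iff k w).1 hw
  rw [sepOp_basisVec, if_neg (by omega)]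

theorem upOp_mul_sepOp : upOp R (k : ZMod n) * sepOp n R (k + 1) k = 0 := by
  refine end_ext fun w => ?_
  rw [Module.End.mul_apply, LinearMap.zero_apply]
  by_cases hw : IsLeftAscent (k : ZMod n) w
  · rw [sepOp_succ_of_isLeftAscent k hw, map_zero]
  · rw [sepOp_basisVec]
    split_ifs
    · rw [upOp_of_not_isLeftAscent hw]
    · rw [map_zero]

theorem upOp_coverOp_eq_sepOp {w : W n} (hw : ¬ IsLeftAscent (k : ZMod n) w) :
    upOp R (k : ZMod n) (coverOp n R k (basisVec R w)) = sepOp n R (k + 1) k (basisVec R w) := by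
  classical
  simp only [upOp_coverOp_of_not_isLeftAscent hw, markedStrongCover_s_mul_self_iff, true_and,
    sepOp_basisVec, and_comm]

theorem posOp_succ_coverOp_of_isLeftAscent {w : W n} (hw : IsLeftAscent (k : ZMod n) w) :
    posOp n R (k + 1) (coverOp n R k (basisVec R w)) = coverOp n R k (basisVec R w) := by
  rw [coverOp_basisVec, map_sum]
  exact Finset.sum_congr rfl fun y hy => posOp_of_pos ((mem_markedCovers.1 hy).pos_succ_pos hw)

theorem coverOp_posOp_succ_of_isLeftAscent {w : W n} (hw : IsLeftAscent (k : ZMod n) w) :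
    coverOp n R k (posOp n R (k + 1) (basisVec R w)) = coverOp n R k (basisVec R w) := by
  rcases lt_or_ge 0 (pos w (k + 1)) with h | h
  · rw [posOp_of_pos h]
  · have hk := (isLeftAscent_iff k w).1 hw
    rw [posOp_of_nonpos h, map_zero, coverOp_of_nonpos (by omega)]

theorem posOp_mul_upOp_left : posOp n R k * upOp R (k : ZMod n) =
    upOp R (k : ZMod n) * posOp n R (k + 1) := by
  rw [posOp_mul_upOp, simpleFun_left]

theorem posOp_mul_upOp_right : posOp n R (k + 1) * upOp R (k : ZMod n) =
    upOp R (k : ZMod n) * posOp n R k := by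
  rw [posOp_mul_upOp, simpleFun_right]

theorem upOp_mul_posOp_succ_mul_coverOp :
    upOp R (k : ZMod n) * posOp n R (k + 1) * coverOp n R k =
      upOp R (k : ZMod n) * coverOp n R k * posOp n R (k + 1) + sepOp n R (k + 1) k := by
  refine end_ext fun w => ?_
  by_cases hw : IsLeftAscent (k : ZMod n) w
  · simp only [Module.End.mul_apply, LinearMap.add_apply, sepOp_succ_of_isLeftAscent k hw,
      posOp_succ_coverOp_of_isLeftAscent k hw, coverOp_posOp_succ_of_isLeftAscent k hw, add_zero]
  · rw [← posOp_mul_upOp_left]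
    simp only [Module.End.mul_apply, LinearMap.add_apply, upOp_coverOp_eq_sepOp k hw]
    rcases lt_or_ge 0 (pos w (k + 1)) with h | h
    · have hsep : sepOp n R (k + 1) k (basisVec R w) = 0 := by
        rw [sepOp_basisVec, if_neg (by omega)]
      rw [posOp_of_pos h, upOp_coverOp_eq_sepOp k hw, hsep, map_zero, add_zero]
    · rw [posOp_of_nonpos h, map_zero, map_zero, zero_add, sepOp_basisVec]
      split_ifs with hs
      · rw [posOp_of_pos hs.2]
      · rw [map_zero]

theorem upOp_mul_coverOp_succ_mul_posOp :
    upOp R (k : ZMod n) * coverOp n R (k + 1) * posOp n R k = 0 := by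
  classical
  refine end_ext fun w => ?_
  simp only [Module.End.mul_apply]
  rcases lt_or_ge 0 (pos w k) with h | h
  · rw [posOp_of_pos h, upOp_coverOp_basisVec]
    refine Finset.sum_eq_zero fun y hy => ?_
    rw [Finset.mem_filter, mem_markedCovers] at hy
    have := (hy.1.pos_pred_nonpos hy.2).2
    omega
  · rw [posOp_of_nonpos h, map_zero, map_zero]; rfl

theorem upOp_mul_posOp_mul_coverOp_succ :
    upOp R (k : ZMod n) * posOp n R k * coverOp n R (k + 1) = 0 := by
  refine end_ext fun w => ?_
  simp only [Module.End.mul_apply]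
  rw [coverOp_basisVec, map_sum, map_sum]
  refine Finset.sum_eq_zero fun y hy => ?_
  rw [mem_markedCovers] at hy
  rcases lt_or_ge 0 (pos y k) with h | h
  · rw [posOp_of_pos h, upOp_of_not_isLeftAscent]
    intro hy'
    have := (hy.pos_pred_nonpos hy').1
    omega
  · rw [posOp_of_nonpos h, map_zero]

theorem upOp_mul_coverOp_mul_coverOp_succ :
    upOp R (k : ZMod n) * coverOp n R k * coverOp n R (k + 1) =
      posOp n R k * coverOp n R (k + 1) := by
  refine end_ext fun w => ?_
  simp only [Module.End.mul_apply]
  rw [coverOp_basisVec (k + 1), map_sum, map_sum, map_sum]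
  refine Finset.sum_congr rfl fun y hy => ?_
  rw [mem_markedCovers] at hy
  rcases lt_or_ge 0 (pos y k) with h | h
  · have hk : ¬ IsLeftAscent (k : ZMod n) y :=
      (not_isLeftAscent_iff k y).2 (hy.pos_nonpos.trans_lt h)
    rw [posOp_of_pos h, upOp_coverOp_eq_sepOp k hk, sepOp_basisVec, if_pos ⟨hy.pos_nonpos, h⟩]
  · rw [posOp_of_nonpos h, coverOp_of_nonpos h, map_zero]

theorem coverOp_mul_upOp_left : coverOp n R k * upOp R (k : ZMod n) =
    upOp R (k : ZMod n) * coverOp n R (k + 1) + sepOp n R k (k + 1) := by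
  rw [coverOp_mul_upOp, simpleFun_left, if_pos rfl, if_neg (zmod_succ_ne _).symm]
  exact sub_zero (G := Module.End R (W n →₀ R)) _

theorem coverOp_mul_upOp_right : coverOp n R (k + 1) * upOp R (k : ZMod n) =
    upOp R (k : ZMod n) * coverOp n R k - sepOp n R (k + 1) k := by
  rw [coverOp_mul_upOp, simpleFun_right, if_neg, if_pos, add_zero, add_sub_cancel_right]
  · push_cast; rfl
  · push_cast; exact zmod_succ_ne _

theorem upOp_mul_coverOp_succ_mul_coverOp_mul_upOp :
    upOp R (k : ZMod n) * coverOp n R (k + 1) * coverOp n R k * upOp R (k : ZMod n) =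
      (1 - posOp n R (k + 1)) * coverOp n R k * upOp R (k : ZMod n) :=
  mul_mul_mul_eq_of_relations (E := Module.End R (W n →₀ R)) (upOp_mul_upOp _)
    (coverOp_mul_upOp_left k) (coverOp_mul_upOp_right k)
    (posOp_mul_upOp_right k) (upOp_mul_sepOp k) (posOp_comm _ _) (posOp_mul_self _)
    (coverOp_mul_posOp _) (upOp_mul_coverOp_succ_mul_posOp k) (upOp_mul_posOp_mul_coverOp_succ k)

theorem upOp_mul_coverOp_succ_mul_coverOp :
    upOp R (k : ZMod n) * coverOp n R (k + 1) * coverOp n R k =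
      (1 - posOp n R (k + 1)) * coverOp n R k := by
  classical
  refine end_ext fun w => ?_
  by_cases hw : IsLeftAscent (k : ZMod n) w
  · simp only [Module.End.mul_apply]
    rw [coverOp_basisVec k, map_sum, map_sum, map_sum]
    refine Finset.sum_congr rfl fun y hy => ?_
    rw [mem_markedCovers] at hy
    rw [LinearMap.sub_apply, posOp_of_pos (hy.pos_succ_pos hw), Module.End.one_apply, sub_self,
      upOp_coverOp_basisVec]
    refine Finset.sum_eq_zero fun z hz => ?_
    rw [Finset.mem_filter, mem_markedCovers] at hz
    exact absurd hz.1 (not_markedStrongCover_succ hy hw hz.2)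
  · have e : basisVec R w = upOp R (k : ZMod n) (basisVec R (s (k : ZMod n) * w)) := by
      rw [upOp_of_isLeftAscent ((isLeftAscent_s_mul_iff _ w).2 hw), s_mul_s_mul]
    rw [e, ← Module.End.mul_apply, upOp_mul_coverOp_succ_mul_coverOp_mul_upOp, Module.End.mul_apply]

end Adjacent

/-! ### The operators `K_c` and the twisted action of simple reflections -/

/-- The operator `K_c = 1 - t e Q_c + t X_c`, with `Q_c = posOp n R c` and `X_c = coverOp n R c`;
`e` stands for the weight `e_c`. -/
def kOp (n : ℕ) [n.AtLeastTwo] (t e : R) (c : ℤ) : Module.End R (W n →₀ R) :=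
  1 - (t * e) • posOp n R c + t • coverOp n R c

theorem pair_mul_eq_of_relations {E : Type*} [Ring E] [Algebra R E] {a x₁ x₂ q₁ q₂ : E}
    (h₁ : x₁ * a = a * x₂ + (1 - q₁) * q₂) (h₂ : x₂ * a = a * x₁ - (1 - q₂) * q₁)
    (h₃ : q₁ * a = a * q₂) (h₃' : q₂ * a = a * q₁) (hq : q₁ * q₂ = q₂ * q₁) (hqq : q₁ * q₁ = q₁)
    (hx : x₁ * q₁ = x₁) (hx' : q₁ * x₁ = 0)
    (h₄ : a * q₂ * x₁ = a * x₁ * q₂ + (1 - q₂) * q₁)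
    (h₅ : a * x₂ * q₁ = 0) (h₆ : a * q₁ * x₂ = 0)
    (h₇ : a * x₁ * x₂ = q₁ * x₂) (h₈ : a * x₂ * x₁ = (1 - q₂) * x₁) (t e₁ e₂ : R) :
    (1 - (t * e₁) • q₁ + t • x₁) * (1 - (t * e₂) • q₂ + t • x₂) * (1 - (e₁ - e₂) • a) =
      (1 - (e₁ - e₂) • a) *
        ((1 - (t * e₂) • q₁ + t • x₁) * (1 - (t * e₁) • q₂ + t • x₂)) := by
  have g₁ : x₁ * x₂ * a = x₁ * q₂ := by
    calc x₁ * x₂ * a = x₁ * a * x₁ - x₁ * q₁ + x₁ * (q₂ * q₁) := by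
          rw [mul_assoc, h₂]; noncomm_ring
      _ = a * x₂ * x₁ + q₂ * x₁ - q₁ * q₂ * x₁ - x₁ * q₁ + x₁ * q₁ * q₂ := by
          rw [h₁, ← hq]; noncomm_ring
      _ = x₁ * q₂ - q₂ * (q₁ * x₁) := by rw [h₈, hx, hq]; noncomm_ring
      _ = x₁ * q₂ := by rw [hx', mul_zero, sub_zero]
  have g₂ : q₁ * x₂ * a = a * x₁ * q₂ := by
    calc q₁ * x₂ * a = q₁ * a * x₁ - q₁ * q₁ + q₁ * q₂ * q₁ := by
          rw [mul_assoc, h₂]; noncomm_ring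
      _ = a * q₂ * x₁ - q₁ * q₁ + q₂ * (q₁ * q₁) := by rw [h₃, hq]; noncomm_ring
      _ = a * x₁ * q₂ := by rw [hqq, h₄]; noncomm_ring
  have g₃ : x₁ * q₂ * a = 0 := by
    calc x₁ * q₂ * a = x₁ * a * q₁ := by rw [mul_assoc, h₃', mul_assoc]
      _ = a * x₂ * q₁ + q₂ * q₁ - q₁ * q₂ * q₁ := by rw [h₁]; noncomm_ring
      _ = q₂ * q₁ - q₂ * (q₁ * q₁) := by rw [h₅, hq]; noncomm_ring
      _ = 0 := by rw [hqq, sub_self]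
  have g₄ : q₁ * q₂ * a = a * q₁ * q₂ := by
    rw [mul_assoc, h₃', ← mul_assoc, h₃, mul_assoc, mul_assoc, hq]
  have h₁' : x₁ * a = a * x₂ + q₂ - q₁ * q₂ := by rw [h₁]; noncomm_ring
  have h₂' : x₂ * a = a * x₁ - q₁ + q₁ * q₂ := by rw [h₂, hq]; noncomm_ring
  simp only [mul_add, add_mul, sub_mul, mul_sub, smul_mul_assoc, mul_smul_comm, one_mul, mul_one,
    ← mul_assoc, g₁, g₂, g₃, g₄, h₁', h₂', h₃, h₃', h₆, h₇, smul_zero]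
  module

theorem kOp_pair_mul (k : ℤ) (t e₁ e₂ : R) :
    kOp n t e₁ k * kOp n t e₂ (k + 1) * (1 - (e₁ - e₂) • upOp R (k : ZMod n)) =
      (1 - (e₁ - e₂) • upOp R (k : ZMod n)) * (kOp n t e₂ k * kOp n t e₁ (k + 1)) :=
  pair_mul_eq_of_relations (E := Module.End R (W n →₀ R)) (coverOp_mul_upOp_left k)
    (coverOp_mul_upOp_right k) (posOp_mul_upOp_left k) (posOp_mul_upOp_right k) (posOp_comm _ _)
    (posOp_mul_self _) (coverOp_mul_posOp _) (posOp_mul_coverOp _)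
    (upOp_mul_posOp_succ_mul_coverOp k) (upOp_mul_coverOp_succ_mul_posOp k)
    (upOp_mul_posOp_mul_coverOp_succ k) (upOp_mul_coverOp_mul_coverOp_succ k)
    (upOp_mul_coverOp_succ_mul_coverOp k) t e₁ e₂

theorem single_mul_eq_of_relations {E : Type*} [Ring E] [Algebra R E] {a x q : E}
    (h₁ : x * a = a * x) (h₂ : q * a = a * q) (t e α : R) :
    (1 - (t * e) • q + t • x) * (1 - α • a) = (1 - α • a) * (1 - (t * e) • q + t • x) := by
  simp only [mul_add, add_mul, sub_mul, mul_sub, smul_mul_assoc, mul_smul_comm, one_mul, mul_one,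
    h₁, h₂]
  module

theorem kOp_mul {i : ZMod n} {c : ℤ} (h₁ : (c : ZMod n) ≠ i) (h₂ : (c : ZMod n) ≠ i + 1)
    (t e α : R) : kOp n t e c * (1 - α • upOp R i) = (1 - α • upOp R i) * kOp n t e c := by
  refine single_mul_eq_of_relations (E := Module.End R (W n →₀ R)) ?_ ?_ t e α
  · rw [coverOp_mul_upOp, simpleFun_of_ne h₁ h₂, if_neg h₁, if_neg h₂, add_zero]
    exact sub_zero (G := Module.End R (W n →₀ R)) _
  · rw [posOp_mul_upOp, simpleFun_of_ne h₁ h₂]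

/-- Application of a ring homomorphism to the coefficients. -/
def coeffMap (σ : R →+* R') : (W n →₀ R) →+ (W n →₀ R') :=
  Finsupp.mapRange.addMonoidHom (σ : R →+ R')

theorem coeffMap_apply (σ : R →+* R') (m : W n →₀ R) (w : W n) : coeffMap σ m w = σ (m w) := by
  simp [coeffMap]

theorem coeffMap_basisVec (σ : R →+* R') (w : W n) :
    coeffMap σ (basisVec R w) = basisVec R' w := by
  simp [coeffMap, basisVec]

theorem coeffMap_smul (σ : R →+* R') (r : R) (m : W n →₀ R) :
    coeffMap σ (r • m) = σ r • coeffMap σ m := by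
  ext w; simp [coeffMap]

theorem coeffMap_linearCombination (σ : R →+* R') {f : W n → (W n →₀ R)}
    {f' : W n → (W n →₀ R')} (hf : ∀ w, coeffMap σ (f w) = f' w) (m : W n →₀ R) :
    coeffMap σ (Finsupp.linearCombination R f m) =
      Finsupp.linearCombination R' f' (coeffMap σ m) := by
  induction m using Finsupp.induction_linear with
  | zero => simp
  | add x y hx hy => simp [hx, hy]
  | single w r =>
    have e : Finsupp.single w r = r • basisVec R w := by simp [basisVec]
    rw [e, map_smul, coeffMap_smul, coeffMap_smul, map_smul, linearCombination_basisVec, hf,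
      coeffMap_basisVec, linearCombination_basisVec]

theorem coeffMap_upOp (σ : R →+* R') (i : ZMod n) (m : W n →₀ R) :
    coeffMap σ (upOp R i m) = upOp R' i (coeffMap σ m) :=
  coeffMap_linearCombination σ (fun w => by split_ifs <;> simp [coeffMap_basisVec]) m

theorem coeffMap_coverOp (σ : R →+* R') (c : ℤ) (m : W n →₀ R) :
    coeffMap σ (coverOp n R c m) = coverOp n R' c (coeffMap σ m) :=
  coeffMap_linearCombination σ (fun w => by simp [coeffMap_basisVec]) m

theorem coeffMap_posOp (σ : R →+* R') (c : ℤ) (m : W n →₀ R) :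
    coeffMap σ (posOp n R c m) = posOp n R' c (coeffMap σ m) :=
  coeffMap_linearCombination σ (fun w => by split_ifs <;> simp [coeffMap_basisVec]) m

theorem coeffMap_kOp (σ : R →+* R') (t e : R) (c : ℤ) (m : W n →₀ R) :
    coeffMap σ (kOp n t e c m) = kOp n (σ t) (σ e) c (coeffMap σ m) := by
  simp only [kOp, LinearMap.add_apply, LinearMap.sub_apply, LinearMap.smul_apply, map_add, map_sub,
    coeffMap_smul, coeffMap_posOp, coeffMap_coverOp, Module.End.one_apply, map_mul]

/-- The left multiplication by `s_i = 1 - α_i A_i`, twisted by its action `σ` on coefficients. -/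
def twist (σ : R →+* R) (α : R) (i : ZMod n) : (W n →₀ R) →+ (W n →₀ R) :=
  (1 - α • upOp R i : Module.End R (W n →₀ R)).toAddMonoidHom.comp (coeffMap σ)

theorem twist_apply (σ : R →+* R) (α : R) (i : ZMod n) (m : W n →₀ R) :
    twist σ α i m = (1 - α • upOp R i : Module.End R (W n →₀ R)) (coeffMap σ m) := rfl

theorem twist_smul (σ : R →+* R) (α : R) (i : ZMod n) (r : R) (m : W n →₀ R) :
    twist σ α i (r • m) = σ r • twist σ α i m := by
  rw [twist_apply, coeffMap_smul, map_smul, twist_apply]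

theorem twist_basisVec (σ : R →+* R) (α : R) {i : ZMod n} {w : W n} (h : IsLeftAscent i w) :
    twist σ α i (basisVec R w) = basisVec R w - α • basisVec R (s i * w) := by
  rw [twist_apply, coeffMap_basisVec, LinearMap.sub_apply, LinearMap.smul_apply,
    upOp_of_isLeftAscent h, Module.End.one_apply]

theorem twist_basisVec_of_not_isLeftAscent (σ : R →+* R) (α : R) {i : ZMod n} {w : W n}
    (h : ¬ IsLeftAscent i w) : twist σ α i (basisVec R w) = basisVec R w := by
  rw [twist_apply, coeffMap_basisVec, LinearMap.sub_apply, LinearMap.smul_apply,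
    upOp_of_not_isLeftAscent h, Module.End.one_apply, smul_zero, sub_zero]

theorem coeffMap_twist {f : R →+* R'} {σ : R →+* R} {σ' : R' →+* R'}
    (h : f.comp σ = σ'.comp f) (α : R) (i : ZMod n) (m : W n →₀ R) :
    coeffMap f (twist σ α i m) = twist σ' (f α) i (coeffMap f m) := by
  have hm : coeffMap f (coeffMap σ m) = coeffMap σ' (coeffMap f m) := by
    ext w
    simp only [coeffMap_apply]
    exact DFunLike.congr_fun h _
  rw [twist_apply, twist_apply, LinearMap.sub_apply, map_sub, LinearMap.smul_apply, coeffMap_smul,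
    coeffMap_upOp, Module.End.one_apply, hm]
  rfl

/-- The product `K_{c+1} K_{c+2} ⋯ K_{c+m}`. -/
def kProd (t : R) (e : ZMod n → R) : ℤ → ℕ → Module.End R (W n →₀ R)
  | _, 0 => 1
  | c, m + 1 => kOp n t (e ((c + 1 : ℤ) : ZMod n)) (c + 1) * kProd t e (c + 1) m

theorem kProd_succ_right (t : R) (e : ZMod n → R) (c : ℤ) (m : ℕ) :
    kProd t e c (m + 1) =
      kProd t e c m * kOp n t (e ((c + m + 1 : ℤ) : ZMod n)) (c + m + 1) := by
  induction m generalizing c with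
  | zero => simp [kProd]
  | succ m ih =>
    rw [kProd, ih, kProd, mul_assoc]
    congr 3 <;> push_cast <;> ring_nf

theorem twist_kOp {σ : R →+* R} {t e : R} {c : ℤ} {i : ZMod n} (ht : σ t = t) (he : σ e = e)
    (h₁ : (c : ZMod n) ≠ i) (h₂ : (c : ZMod n) ≠ i + 1) (α : R) (v : W n →₀ R) :
    twist σ α i (kOp n t e c v) = kOp n t e c (twist σ α i v) := by
  rw [twist_apply, coeffMap_kOp, ht, he, ← Module.End.mul_apply, ← kOp_mul h₁ h₂,
    Module.End.mul_apply, twist_apply]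

theorem twist_kOp_kOp_succ {σ : R →+* R} {t e₁ e₂ : R} (ht : σ t = t) (h₁ : σ e₁ = e₂)
    (h₂ : σ e₂ = e₁) (k : ℤ) (v : W n →₀ R) :
    twist σ (e₁ - e₂) (k : ZMod n) (kOp n t e₁ k (kOp n t e₂ (k + 1) v)) =
      kOp n t e₁ k (kOp n t e₂ (k + 1) (twist σ (e₁ - e₂) (k : ZMod n) v)) := by
  rw [twist_apply, coeffMap_kOp, coeffMap_kOp, ht, h₁, h₂, ← Module.End.mul_apply (kOp n t e₂ k),
    ← Module.End.mul_apply (1 - _), ← kOp_pair_mul, Module.End.mul_apply, Module.End.mul_apply,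
    twist_apply]

/-- The ring endomorphism `σ` permutes the elements `e_r` as `s_i` permutes the weights. -/
structure SwapsWeights (σ : R →+* R) (i : ZMod n) (e : ZMod n → R) : Prop where
  left : σ (e i) = e (i + 1)
  right : σ (e (i + 1)) = e i
  of_ne : ∀ r, r ≠ i → r ≠ i + 1 → σ (e r) = e r

theorem twist_kProd {σ : R →+* R} {t : R} {e : ZMod n → R} {i : ZMod n} (ht : σ t = t)
    (he : SwapsWeights σ i e) (v : W n →₀ R) (m : ℕ) : ∀ c : ℤ, (c : ZMod n) ≠ i →
    ((c + m : ℤ) : ZMod n) ≠ i →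
    twist σ (e i - e (i + 1)) i (kProd t e c m v) =
      kProd t e c m (twist σ (e i - e (i + 1)) i v) := by
  induction m using Nat.twoStepInduction with
  | zero => exact fun _ _ _ => rfl
  | one =>
    intro c hc hcm
    have hi : ((c + 1 : ℤ) : ZMod n) ≠ i + 1 := by simpa using hc
    exact twist_kOp ht (he.of_ne _ (by simpa using hcm) hi) (by simpa using hcm) hi _ _
  | more m ih₂ ih₁ =>
    intro c hc hcm
    have hsucc : ((c + 1 + (m + 1 : ℕ) : ℤ) : ZMod n) ≠ i := by
      convert hcm using 2; push_cast; ring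
    by_cases hi : ((c + 1 : ℤ) : ZMod n) = i
    · have hi₂ : ((c + 1 + 1 : ℤ) : ZMod n) = i + 1 := by rw [← hi]; push_cast; rfl
      have hcm₂ : ((c + 1 + 1 + m : ℤ) : ZMod n) ≠ i := by convert hcm using 2; push_cast; ring
      have hpair := twist_kOp_kOp_succ ht he.left he.right (c + 1) (kProd t e (c + 1 + 1) m v)
      rw [hi] at hpair
      simp only [kProd, Module.End.mul_apply, hi, hi₂]
      rw [hpair, ih₂ _ (hi₂ ▸ zmod_succ_ne i) hcm₂]
    · have hi₂ : ((c + 1 : ℤ) : ZMod n) ≠ i + 1 := by simpa using hc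
      rw [kProd, Module.End.mul_apply, Module.End.mul_apply,
        twist_kOp ht (he.of_ne _ hi hi₂) hi hi₂, ih₁ _ hi hsucc]

theorem kOp_basisVec_of_pos (t e : R) {c : ℤ} {w : W n} (h : 0 < pos w c) :
    kOp n t e c (basisVec R w) =
      (1 - t * e) • basisVec R w + t • ∑ y ∈ markedCovers c w, basisVec R y := by
  rw [kOp, LinearMap.add_apply, LinearMap.sub_apply, LinearMap.smul_apply, LinearMap.smul_apply,
    posOp_of_pos h, coverOp_basisVec, Module.End.one_apply, sub_smul, one_smul]

theorem kOp_basisVec_of_nonpos (t e : R) {c : ℤ} {w : W n} (h : pos w c ≤ 0) :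
    kOp n t e c (basisVec R w) = basisVec R w := by
  rw [kOp, LinearMap.add_apply, LinearMap.sub_apply, LinearMap.smul_apply, LinearMap.smul_apply,
    posOp_of_nonpos h, coverOp_of_nonpos h, Module.End.one_apply, smul_zero, sub_zero, smul_zero,
    add_zero]

theorem kOp_basisVec_of_length_lt (t e : R) {c : ℤ} {w : W n} (h : length w < c) :
    kOp n t e c (basisVec R w) = (1 - t * e) • basisVec R w := by
  rw [kOp_basisVec_of_pos t e (pos_pos_of_length_lt h), Finset.sum_eq_zero, smul_zero, add_zero]
  intro y hy
  have := (mem_markedCovers.1 hy).lt_length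
  omega

theorem kProd_succ_basisVec_of_length_le (t : R) (e : ZMod n → R) {c : ℤ} {m : ℕ} {w : W n}
    (h : length w ≤ c + m) : kProd t e c (m + 1) (basisVec R w) =
      (1 - t * e ((c + m + 1 : ℤ) : ZMod n)) • kProd t e c m (basisVec R w) := by
  rw [kProd_succ_right, Module.End.mul_apply, kOp_basisVec_of_length_lt _ _ (by omega), map_smul]

/-- The submodule spanned by the `w` of length at most `l`. -/
def lengthLE (n : ℕ) [n.AtLeastTwo] (R : Type*) [CommRing R] (l : ℕ) :
    Submodule R (W n →₀ R) := Submodule.span R (basisVec R '' {w | length w ≤ l})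

theorem basisVec_mem_lengthLE {w : W n} {l : ℕ} (h : length w ≤ l) :
    basisVec R w ∈ lengthLE n R l :=
  Submodule.subset_span ⟨w, h, rfl⟩

theorem kOp_mem_lengthLE (t e : R) (c : ℤ) {l : ℕ} {v : W n →₀ R} (hv : v ∈ lengthLE n R l) :
    kOp n t e c v ∈ lengthLE n R l := by
  refine (Submodule.span_le (p := (lengthLE n R l).comap (kOp n t e c))).2 ?_ hv
  rintro _ ⟨w, hw : length w ≤ l, rfl⟩
  change kOp n t e c (basisVec R w) ∈ lengthLE n R l
  rcases lt_or_ge 0 (pos w c) with h | h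
  · rw [kOp_basisVec_of_pos t e h]
    refine add_mem (Submodule.smul_mem _ _ (basisVec_mem_lengthLE hw))
      (Submodule.smul_mem _ _ (sum_mem fun y hy => basisVec_mem_lengthLE ?_))
    have := (mem_markedCovers.1 hy).length_add_one
    omega
  · rw [kOp_basisVec_of_nonpos t e h]
    exact basisVec_mem_lengthLE hw

theorem kProd_mem_lengthLE (t : R) (e : ZMod n → R) (m : ℕ) : ∀ (c : ℤ) {l : ℕ} {v : W n →₀ R},
    v ∈ lengthLE n R l → kProd t e c m v ∈ lengthLE n R l := by
  induction m with
  | zero => exact fun _ _ _ hv => hv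
  | succ m ih =>
    intro _ l v hv
    rw [kProd, Module.End.mul_apply]
    exact kOp_mem_lengthLE _ _ _ (ih _ hv)

theorem kOp_of_mem_lengthLE (t e : R) {c : ℤ} {l : ℕ} (hc : c ≤ -l) {v : W n →₀ R}
    (hv : v ∈ lengthLE n R l) : kOp n t e c v = v := by
  refine LinearMap.eqOn_span (g := LinearMap.id) ?_ hv
  rintro _ ⟨w, hw : length w ≤ l, rfl⟩
  exact kOp_basisVec_of_nonpos t e (pos_nonpos_of_le_neg_length (by omega))

theorem kProd_succ_basisVec_of_le_neg_length (t : R) (e : ZMod n → R) {c : ℤ} {m : ℕ} {w : W n}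
    (h : c + 1 ≤ -length w) :
    kProd t e c (m + 1) (basisVec R w) = kProd t e (c + 1) m (basisVec R w) := by
  rw [kProd, Module.End.mul_apply]
  exact kOp_of_mem_lengthLE _ _ h (kProd_mem_lengthLE _ _ _ _ (basisVec_mem_lengthLE le_rfl))

end Operators

/-! ### Counting strong strips -/

namespace StrongStrip

variable {w u : W n} {l : ℕ}

theorem ext_vertex_mark {x y : StrongStrip w u l} (h₁ : x.vertex = y.vertex)
    (h₂ : x.mark = y.mark) : x = y := by
  cases x; cases y; cases h₁; cases h₂; rfl

theorem length_vertex (x : StrongStrip w u l) (j : Fin (l + 1)) :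
    length (x.vertex j) + j = length w := by
  induction j using Fin.induction with
  | zero => rw [x.vertex_zero]; simp
  | succ j ih =>
    have := (x.cover j).length_add_one
    simp only [Fin.val_castSucc, Fin.val_succ] at ih ⊢
    omega

theorem length_add (x : StrongStrip w u l) : length u + l = length w := by
  have := x.length_vertex (Fin.last l)
  rwa [x.vertex_last, Fin.val_last] at this

theorem mark_mem_Icc (x : StrongStrip w u l) (j : Fin l) :
    x.mark j ∈ Set.Icc (-(length w : ℤ)) (length w) := by
  have := (x.cover j).lt_length
  have := (x.cover j).neg_length_lt
  have := x.length_vertex j.castSucc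
  constructor <;> omega

/-- The strip `w → y → ⋯ → u` obtained by prepending a marked strong cover `w → y` to a strip
from `y` to `u`. -/
def cons {y : W n} {a : ℤ} (h : MarkedStrongCover w a y) (x : StrongStrip y u l)
    (hx : ∀ j, x.mark j < a) : StrongStrip w u (l + 1) where
  vertex := Fin.cons w x.vertex
  mark := Fin.cons a x.mark
  vertex_zero := rfl
  vertex_last := by rw [← Fin.succ_last, Fin.cons_succ, x.vertex_last]
  cover j := by
    refine Fin.cases ?_ (fun j => ?_) j
    · rwa [Fin.castSucc_zero, Fin.cons_zero, Fin.cons_succ, x.vertex_zero, Fin.cons_zero]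
    · rw [← Fin.succ_castSucc, Fin.cons_succ, Fin.cons_succ, Fin.cons_succ]
      exact x.cover j
  mark_anti := by
    intro i j hij
    induction j using Fin.cases with
    | zero => exact absurd hij (Fin.not_lt_zero i)
    | succ j =>
      induction i using Fin.cases with
      | zero => exact hx j
      | succ i => exact x.mark_anti (Fin.succ_lt_succ_iff.1 hij)

/-- The strip obtained by removing the first cover. -/
def tail (x : StrongStrip w u (l + 1)) : StrongStrip (x.vertex 1) u l where
  vertex j := x.vertex j.succ
  mark j := x.mark j.succ
  vertex_zero := rfl
  vertex_last := x.vertex_last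
  cover j := x.cover j.succ
  mark_anti := fun _ _ h => x.mark_anti (Fin.succ_lt_succ_iff.2 h)

theorem tail_mark_lt (x : StrongStrip w u (l + 1)) (j : Fin l) : x.tail.mark j < x.mark 0 :=
  x.mark_anti (Fin.succ_pos j)

theorem cover_zero (x : StrongStrip w u (l + 1)) :
    MarkedStrongCover w (x.mark 0) (x.vertex 1) := by
  have := x.cover 0
  rwa [Fin.castSucc_zero, x.vertex_zero] at this

theorem cons_tail (x : StrongStrip w u (l + 1)) :
    cons x.cover_zero x.tail x.tail_mark_lt = x := by
  refine ext_vertex_mark ?_ (Fin.cons_self_tail x.mark)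
  conv_rhs => rw [← Fin.cons_self_tail x.vertex, x.vertex_zero]
  rfl

end StrongStrip

theorem finite_length_le (l : ℕ) : {w : W n | length w ≤ l}.Finite := by
  have : NeZero n := ⟨by have : (2 : ℤ) ≤ n := two_le_period; omega⟩
  refine ((List.finite_length_le (ZMod n) l).image wordProd).subset fun w hw => ?_
  obtain ⟨m, hm, hlen⟩ := exists_reducedWord w
  exact ⟨m, by simpa [hlen] using hw, hm⟩

instance finite_sigma_strongStrip (w : W n) (i : ℕ) : Finite (Σ u : W n, StrongStrip w u i) := by
  have : Finite {v : W n | length v ≤ length w} := (finite_length_le (length w)).to_subtype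
  have : Finite (Set.Icc (-(length w : ℤ)) (length w)) := (Set.finite_Icc _ _).to_subtype
  let f : (Σ u : W n, StrongStrip w u i) →
      (Fin (i + 1) → {v : W n | length v ≤ length w}) ×
        (Fin i → Set.Icc (-(length w : ℤ)) (length w)) := fun x =>
    (fun j => ⟨x.2.vertex j, by have := x.2.length_vertex j; simp only [Set.mem_ofPred_eq]; omega⟩,
      fun j => ⟨x.2.mark j, x.2.mark_mem_Icc j⟩)
  refine Finite.of_injective f ?_
  rintro ⟨u, x⟩ ⟨v, y⟩ h
  have hv : x.vertex = y.vertex := funext fun j =>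
    congrArg Subtype.val (congrFun (congrArg Prod.fst h) j)
  have hm : x.mark = y.mark := funext fun j =>
    congrArg Subtype.val (congrFun (congrArg Prod.snd h) j)
  obtain rfl : u = v := by rw [← x.vertex_last, ← y.vertex_last, hv]
  rw [StrongStrip.ext_vertex_mark hv hm]

instance finite_strongStrip (w u : W n) (i : ℕ) : Finite (StrongStrip w u i) :=
  Finite.of_injective (fun x => (⟨u, x⟩ : Σ u : W n, StrongStrip w u i))
    (fun x y h => by simpa using h)

/-- The strong strips of length `l` from `w` to `u` with all markings at most `b`. The count of
these satisfies a recursion in `b`, obtained by asking whether the first marking is `b`. -/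
abbrev StripLE (w u : W n) (l : ℕ) (b : ℤ) : Type :=
  {x : StrongStrip w u l // ∀ j, x.mark j ≤ b}

namespace StripLE

variable {w u : W n} {l : ℕ} {b : ℤ}

theorem mark_zero_lt (x : StripLE w u (l + 1) (b - 1)) : x.1.mark 0 < b :=
  Int.lt_of_le_sub_one (x.2 0)

/-- Weakening of the bound on the markings by one. -/
def relax (x : StripLE w u l (b - 1)) : StripLE w u l b :=
  ⟨x.1, fun j => (x.2 j).trans (by omega)⟩

/-- The strip obtained by prepending a cover marked `b` to a strip with smaller markings. -/
def cons {y : W n} (h : MarkedStrongCover w b y) (x : StripLE y u l (b - 1)) :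
    StripLE w u (l + 1) b :=
  ⟨x.1.cons h fun j => Int.lt_of_le_sub_one (x.2 j),
    Fin.cases le_rfl fun j => (x.2 j).trans (by omega)⟩

theorem cons_injective {y y' : W n} {h : MarkedStrongCover w b y} {h' : MarkedStrongCover w b y'}
    {x : StripLE y u l (b - 1)} {x' : StripLE y' u l (b - 1)} (hx : cons h x = cons h' x') :
    y = y' ∧ HEq x x' := by
  have hv : x.1.vertex = x'.1.vertex :=
    Fin.cons_right_injective (α := fun _ => W n) _ (congrArg (fun z => z.1.vertex) hx)
  have hm : x.1.mark = x'.1.mark :=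
    Fin.cons_right_injective (α := fun _ => ℤ) _ (congrArg (fun z => z.1.mark) hx)
  obtain rfl : y = y' := by rw [← x.1.vertex_zero, hv, x'.1.vertex_zero]
  exact ⟨rfl, heq_of_eq (Subtype.ext (StrongStrip.ext_vertex_mark hv hm))⟩

/-- A strip with markings at most `b` either has markings at most `b - 1`, or starts with a cover
marked `b`. -/
def split (w u : W n) (l : ℕ) (b : ℤ) :
    (StripLE w u (l + 1) (b - 1) ⊕ Σ y : markedCovers b w, StripLE y.1 u l (b - 1)) →
      StripLE w u (l + 1) b :=
  Sum.elim relax fun x => cons (mem_markedCovers.1 x.1.2) x.2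

theorem split_injective (w u : W n) (l : ℕ) (b : ℤ) : Function.Injective (split w u l b) := by
  refine Function.Injective.sumElim ?_ ?_ ?_
  · exact fun x x' h => Subtype.ext (congrArg (fun z => z.1) h)
  · rintro ⟨⟨y, hy⟩, x⟩ ⟨⟨y', hy'⟩, x'⟩ h
    obtain ⟨rfl, hx⟩ := cons_injective h
    obtain rfl : x = x' := eq_of_heq hx
    rfl
  · exact fun x y h => x.mark_zero_lt.ne (congrArg (fun z => z.1.mark 0) h)

theorem split_surjective (w u : W n) (l : ℕ) (b : ℤ) : Function.Surjective (split w u l b) := by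
  rintro ⟨x, hx⟩
  by_cases h : x.mark 0 = b
  · subst h
    exact ⟨.inr ⟨⟨x.vertex 1, mem_markedCovers.2 x.cover_zero⟩,
      ⟨x.tail, fun j => Int.le_sub_one_of_lt (x.tail_mark_lt j)⟩⟩, Subtype.ext x.cons_tail⟩
  · have h₀ : x.mark 0 < b := lt_of_le_of_ne (hx 0) h
    exact ⟨.inl ⟨x, fun j => Int.le_sub_one_of_lt
      ((x.mark_anti.antitone (Fin.zero_le j)).trans_lt h₀)⟩, rfl⟩

theorem card_succ (w u : W n) (l : ℕ) (b : ℤ) :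
    Nat.card (StripLE w u (l + 1) b) = Nat.card (StripLE w u (l + 1) (b - 1)) +
      ∑ y ∈ markedCovers b w, Nat.card (StripLE y u l (b - 1)) := by
  rw [← Nat.card_congr (Equiv.ofBijective _ ⟨split_injective w u l b, split_surjective w u l b⟩),
    Nat.card_sum, Nat.card_sigma,
    Finset.sum_coe_sort (markedCovers b w) fun y => Nat.card (StripLE y u l (b - 1))]

theorem card_eq_zero_of_length (h : length u + l ≠ length w) : Nat.card (StripLE w u l b) = 0 := by
  have : IsEmpty (StripLE w u l b) := ⟨fun x => h x.1.length_add⟩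
  exact Nat.card_of_isEmpty

theorem card_zero (w u : W n) (b : ℤ) [Decidable (w = u)] :
    Nat.card (StripLE w u 0 b) = if w = u then 1 else 0 := by
  split_ifs with h
  · subst h
    refine Nat.card_eq_one_iff_unique.2
      ⟨⟨fun x y => Subtype.ext (StrongStrip.ext_vertex_mark ?_ (funext fun j => j.elim0))⟩,
        ⟨⟨⟨fun _ => w, fun j => j.elim0, rfl, rfl, fun j => j.elim0, fun j => j.elim0⟩,
          fun j => j.elim0⟩⟩⟩
    funext j
    rw [Fin.fin_one_eq_zero j, x.1.vertex_zero, y.1.vertex_zero]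
  · have : IsEmpty (StripLE w u 0 b) := ⟨fun x => h (x.1.vertex_zero.symm.trans x.1.vertex_last)⟩
    exact Nat.card_of_isEmpty

theorem card_eq_zero_of_le_neg_length (h : b ≤ -length w) :
    Nat.card (StripLE w u (l + 1) b) = 0 := by
  have : IsEmpty (StripLE w u (l + 1) b) := ⟨fun x => by
    have := x.1.cover_zero.neg_length_lt
    have := x.2 0
    omega⟩
  exact Nat.card_of_isEmpty

theorem card_eq_of_length_le (h : length w ≤ b) :
    Nat.card (StripLE w u l b) = Nat.card (StrongStrip w u l) :=
  Nat.card_congr (Equiv.subtypeUnivEquiv fun x j => (x.mark_mem_Icc j).2.trans h)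

theorem card_succ_of_nonpos (h : pos w b ≤ 0) :
    Nat.card (StripLE w u l b) = Nat.card (StripLE w u l (b - 1)) := by
  classical
  cases l with
  | zero => rw [card_zero, card_zero]
  | succ l =>
    have hempty : markedCovers b w = ∅ := Finset.eq_empty_of_forall_notMem fun y hy =>
      ((mem_markedCovers.1 hy).pos_pos).not_ge h
    rw [card_succ, hempty, Finset.sum_empty, add_zero]

end StripLE

section KProdCoefficients

open Polynomial

variable {B : Type*} [CommRing B]

theorem kProd_succ_basisVec_apply_of_pos (ε : ZMod n → B[X]) (c : ℤ) (m : ℕ) {w : W n}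
    (h : 0 < pos w (c + m + 1)) (u : W n) :
    kProd X ε c (m + 1) (basisVec B[X] w) u =
      kProd X ε c m (basisVec B[X] w) u + X *
        ((∑ y ∈ markedCovers (c + m + 1) w, kProd X ε c m (basisVec B[X] y) u) -
          ε ((c + m + 1 : ℤ) : ZMod n) * kProd X ε c m (basisVec B[X] w) u) := by
  rw [kProd_succ_right, Module.End.mul_apply, kOp_basisVec_of_pos _ _ h, map_add, map_smul,
    map_smul, map_sum, Finsupp.add_apply, Finsupp.smul_apply, Finsupp.smul_apply, smul_eq_mul,
    smul_eq_mul, Finsupp.finsetSum_apply]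
  ring

theorem kProd_succ_basisVec_of_nonpos (ε : ZMod n → B[X]) (c : ℤ) (m : ℕ) {w : W n}
    (h : pos w (c + m + 1) ≤ 0) :
    kProd X ε c (m + 1) (basisVec B[X] w) = kProd X ε c m (basisVec B[X] w) := by
  rw [kProd_succ_right, Module.End.mul_apply, kOp_basisVec_of_nonpos _ _ h]

theorem coeff_kProd_basisVec (ε : ZMod n → B) (m : ℕ) :
    ∀ (c : ℤ) (w u : W n) (j : ℕ), c ≤ -length w → length u + j ≤ length w →
      (kProd (X : B[X]) (fun r => C (ε r)) c m (basisVec B[X] w) u).coeff j =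
        (Nat.card (StripLE w u j (c + m)) : B) := by
  classical
  induction m with
  | zero =>
    intro c w u j hc hj
    rw [kProd, Module.End.one_apply, Nat.cast_zero, add_zero, basisVec, Finsupp.single_apply]
    cases j with
    | zero => rw [StripLE.card_zero]; split_ifs <;> simp
    | succ j =>
      rw [StripLE.card_eq_zero_of_le_neg_length hc, if_neg (by rintro rfl; omega)]
      simp
  | succ m ih =>
    intro c w u j hc hj
    have hb : c + ((m + 1 : ℕ) : ℤ) = c + m + 1 := by push_cast; ring
    have hb' : c + m + 1 - 1 = c + m := by ring
    rw [hb]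
    rcases le_or_gt (pos w (c + m + 1)) 0 with h | h
    · rw [kProd_succ_basisVec_of_nonpos _ _ _ h, StripLE.card_succ_of_nonpos h, hb',
        ih c w u j hc hj]
    rw [kProd_succ_basisVec_apply_of_pos _ _ _ h, coeff_add, ih c w u j hc hj]
    cases j with
    | zero =>
      rw [mul_coeff_zero, coeff_X_zero, zero_mul, add_zero, StripLE.card_zero, StripLE.card_zero]
    | succ j =>
      have hw : (kProd X (fun r => C (ε r)) c m (basisVec B[X] w) u).coeff j = 0 := by
        rw [ih c w u j hc (by omega), StripLE.card_eq_zero_of_length (by omega), Nat.cast_zero]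
      have hy : ∀ y ∈ markedCovers (c + m + 1) w,
          (kProd X (fun r => C (ε r)) c m (basisVec B[X] y) u).coeff j =
            (Nat.card (StripLE y u j (c + m)) : B) := fun y hy => by
        have := (mem_markedCovers.1 hy).length_add_one
        exact ih c y u j (by omega) (by omega)
      rw [coeff_X_mul, coeff_sub, coeff_C_mul, hw, mul_zero, sub_zero, finsetSum_coeff,
        Finset.sum_congr rfl hy, StripLE.card_succ _ _ _ (c + m + 1),
        hb', Nat.cast_add, Nat.cast_sum]

end KProdCoefficients

/-! ### The action on weights -/

theorem residue_intCast (w : W n) (k : ℤ) : residue w (k : ZMod n) = (value w k : ZMod n) :=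
  value_cast_congr w (by simp)

theorem residue_s_left (i : ZMod n) : residue (s i) i = i + 1 := by
  obtain ⟨k, rfl⟩ := ZMod.intCast_surjective i
  rw [residue_intCast, value_s, simpleFun_left, Int.cast_add, Int.cast_one]

theorem residue_s_right (i : ZMod n) : residue (s i) (i + 1) = i := by
  obtain ⟨k, rfl⟩ := ZMod.intCast_surjective i
  rw [← Int.cast_one, ← Int.cast_add, residue_intCast, value_s, simpleFun_right]

theorem residue_s_of_ne {i r : ZMod n} (h : r ≠ i) (h' : r ≠ i + 1) : residue (s i) r = r := by
  obtain ⟨k, rfl⟩ := ZMod.intCast_surjective r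
  rw [residue_intCast, value_s, simpleFun_of_ne h h']

/-- The class of `e_r` in `P ⊆ S`. -/
def weightS {m : ℕ} (r : ZMod m) : S m :=
  SymmetricAlgebra.ι ℤ (P m) ((diagonal m).mkQ (Pi.single r 1))

/-- The class of `e_r` in `P ⊆ F`. -/
def weightF (r : ZMod n) : F n := algebraMap (S n) (F n) (weightS r)

/-- The image in `S` of the simple root `α_i`. -/
def root {m : ℕ} (i : ZMod m) : S m := weightS i - weightS (i + 1)

theorem ι_simpleRoot {m : ℕ} (i : ZMod m) :
    SymmetricAlgebra.ι ℤ (P m) (simpleRoot m i) = root i := by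
  rw [simpleRoot, map_sub, map_sub, root, weightS, weightS]

theorem ι_mkQ {m : ℕ} [NeZero m] (f : ZMod m → ℤ) :
    SymmetricAlgebra.ι ℤ (P m) ((diagonal m).mkQ f) = ∑ r, f r • weightS r := by
  conv_lhs => rw [← Finset.univ_sum_single f]
  rw [map_sum, map_sum]
  refine Finset.sum_congr rfl fun r _ => ?_
  rw [weightS, ← map_zsmul, ← map_zsmul, ← Pi.single_smul, smul_eq_mul, mul_one]

theorem smul_ι (w : W n) (x : P n) :
    w • SymmetricAlgebra.ι ℤ (P n) x = SymmetricAlgebra.ι ℤ (P n) (weightMap w x) :=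
  SymmetricAlgebra.lift_ι_apply _ _

theorem smul_weightS (w : W n) (r : ZMod n) : w • weightS r = weightS (residue w r) := by
  rw [weightS, smul_ι, weightS, weightMap, Submodule.mkQ_apply, Submodule.mapQ_apply,
    Submodule.mkQ_apply]
  congr 2
  funext q
  have hq : residueHom n w⁻¹ q = r ↔ q = residue w r := by
    rw [map_inv, Equiv.Perm.inv_eq_iff_eq]; rfl
  simp only [LinearMap.funLeft_apply, Pi.single_apply, hq]

theorem smul_algebraMap (w : W n) (p : S n) :
    w • algebraMap (S n) (F n) p = algebraMap (S n) (F n) (w • p) :=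
  (algebraMap.smul' w p (F n)).symm

theorem smul_weightF (w : W n) (r : ZMod n) : w • weightF r = weightF (residue w r) := by
  rw [weightF, smul_algebraMap, smul_weightS, weightF]

theorem smul_weightF_left (i : ZMod n) : s i • weightF i = weightF (i + 1) := by
  rw [smul_weightF, residue_s_left]

theorem smul_weightF_right (i : ZMod n) : s i • weightF (i + 1) = weightF i := by
  rw [smul_weightF, residue_s_right]

theorem smul_weightF_of_ne {i r : ZMod n} (h : r ≠ i) (h' : r ≠ i + 1) :
    s i • weightF r = weightF r := by
  rw [smul_weightF, residue_s_of_ne h h']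

theorem smul_inv_F (w : W n) (f : F n) : w • f⁻¹ = (w • f)⁻¹ :=
  map_inv₀ (MulSemiringAction.toRingHom (W n) (F n) w) f

theorem root_ne_zero (i : ZMod n) : root i ≠ 0 := by
  let g : (ZMod n → ℤ) →ₗ[ℤ] ℤ := .proj i - .proj (i + 1)
  let f : P n →ₗ[ℤ] ℤ := (diagonal n).liftQ g fun x hx => by
    obtain ⟨c, hc⟩ := mem_diagonal.1 hx
    simp [g, hc]
  intro h
  have hf := congrArg (SymmetricAlgebra.lift f) h
  rw [← ι_simpleRoot, SymmetricAlgebra.lift_ι_apply, map_zero, simpleRoot, Submodule.mkQ_apply,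
    Submodule.liftQ_apply] at hf
  have := zmod_succ_ne i
  simp [g, this, this.symm] at hf

theorem algebraMap_root (i : ZMod n) :
    algebraMap (S n) (F n) (root i) = weightF i - weightF (i + 1) := by
  rw [root, map_sub, weightF, weightF]

theorem weightF_sub_ne_zero (i : ZMod n) : weightF i - weightF (i + 1) ≠ (0 : F n) := by
  rw [← algebraMap_root]
  exact (map_ne_zero_iff _ (IsFractionRing.injective (S n) (F n))).2 (root_ne_zero i)

theorem root_dvd_weightS_sub_smul (i r : ZMod n) : root i ∣ weightS r - s i • weightS r := by
  rw [smul_weightS]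
  by_cases h : r = i
  · rw [h, residue_s_left, root]
  by_cases h' : r = i + 1
  · rw [h', residue_s_right, root, ← neg_sub (weightS i)]
    exact (dvd_neg (α := S n)).2 dvd_rfl
  · rw [residue_s_of_ne h h', sub_self]
    exact dvd_zero _

theorem root_dvd_sub_smul (i : ZMod n) (p : S n) : root i ∣ p - s i • p := by
  induction p using SymmetricAlgebra.induction with
  | algebraMap r =>
    have hr : s i • algebraMap ℤ (S n) r = algebraMap ℤ (S n) r := (symMap (s i)).commutes r
    rw [hr, sub_self]
    exact dvd_zero _
  | ι x =>
    obtain ⟨f, rfl⟩ := (diagonal n).mkQ_surjective x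
    have : NeZero n := ⟨by have : (2 : ℤ) ≤ n := two_le_period; omega⟩
    rw [ι_mkQ, Finset.smul_sum, ← Finset.sum_sub_distrib]
    refine Finset.dvd_sum fun r _ => ?_
    rw [smul_comm (s i) (f r), ← smul_sub, zsmul_eq_mul]
    exact (root_dvd_weightS_sub_smul i r).mul_left _
  | mul a b ha hb =>
    have hab : a * b - s i • (a * b) = (a - s i • a) * b + s i • a * (b - s i • b) := by
      rw [smul_mul']; ring
    rw [hab]
    exact dvd_add (ha.mul_right _) (hb.mul_left _)
  | add a b ha hb =>
    rw [smul_add, add_sub_add_comm]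
    exact dvd_add ha hb

/-! ### Matsumoto's theorem -/

/-- The family `f` satisfies the Coxeter relations of type `A_{n-1}^{(1)}` other than those on
the squares `f i * f i`. For `n = 2` there are none. -/
structure SatisfiesBraidRelations {M : Type*} [Mul M] (f : ZMod n → M) : Prop where
  comm {i j : ZMod n} : j ≠ i → j ≠ i + 1 → i ≠ j + 1 → f i * f j = f j * f i
  braid {i : ZMod n} : i + 1 + 1 ≠ i → f i * f (i + 1) * f i = f (i + 1) * f i * f (i + 1)

theorem s_comm {i j : ZMod n} (h : j ≠ i) (h₁ : j ≠ i + 1) (h₂ : i ≠ j + 1) :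
    s i * s j = s j * s i := by
  obtain ⟨k, rfl⟩ := ZMod.intCast_surjective j
  rw [← reflection_succ k, s_mul_reflection, simpleFun_of_ne h h₁, simpleFun_of_ne]
  · push_cast
    exact h₂.symm
  · push_cast
    exact fun e => h (add_right_cancel e)

theorem s_mul_s_mul_s {i : ZMod n} (h : i + 1 + 1 ≠ i) :
    s i * s (i + 1) * s i = s (i + 1) * s i * s (i + 1) := by
  obtain ⟨k, rfl⟩ := ZMod.intCast_surjective i
  have hc : (k : ZMod n) + 1 = ((k + 1 : ℤ) : ZMod n) := by push_cast; rfl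
  have h₁ : s (k : ZMod n) * s ((k : ZMod n) + 1) =
      reflection k (k + 1 + 1) * s (k : ZMod n) := by
    rw [hc, ← reflection_succ (k + 1), s_mul_reflection, simpleFun_right, simpleFun_of_ne]
    · push_cast; exact h
    · push_cast; exact zmod_succ_ne _
  have h₂ : s ((k : ZMod n) + 1) * s (k : ZMod n) =
      reflection k (k + 1 + 1) * s ((k : ZMod n) + 1) := by
    rw [← reflection_succ k, s_mul_reflection, hc, simpleFun_left, simpleFun_of_ne]
    · rw [← hc]; exact (zmod_succ_ne _).symm
    · rw [← hc]; exact h.symm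
  rw [h₁, h₂, mul_assoc, mul_assoc, s_mul_s, s_mul_s]

theorem isReducedWord_cons_iff {i : ZMod n} {l : List (ZMod n)} {w : W n} :
    IsReducedWord (i :: l) w ↔ IsReducedWord l (s i * w) ∧ ¬ IsLeftAscent i w := by
  constructor
  · rintro ⟨rfl, hlen⟩
    have hl : s i * wordProd (i :: l) = wordProd l := by rw [wordProd_cons, s_mul_s_mul]
    have := length_wordProd_le l
    have hs := length_s_mul_le i (wordProd l)
    rw [← wordProd_cons, ← hlen, List.length_cons] at hs
    refine ⟨⟨hl.symm, by rw [hl]; omega⟩, ?_⟩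
    rw [IsLeftAscent, hl, ← hlen, List.length_cons]
    omega
  · rintro ⟨⟨h, hlen⟩, hi⟩
    exact ⟨by rw [wordProd_cons, h, s_mul_s_mul],
      by rw [List.length_cons, hlen, length_s_mul_of_not_isLeftAscent hi]⟩

theorem exists_isReducedWord_comm {i j : ZMod n} (h : j ≠ i) (h₁ : j ≠ i + 1) (h₂ : i ≠ j + 1)
    {w : W n} (hi : ¬ IsLeftAscent i w) (hj : ¬ IsLeftAscent j w) :
    ∃ l, IsReducedWord (i :: j :: l) w ∧ IsReducedWord (j :: i :: l) w := by
  have descent {i j : ZMod n} (h : j ≠ i) (h₁ : j ≠ i + 1) (h₂ : i ≠ j + 1)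
      (hj : ¬ IsLeftAscent j w) : ¬ IsLeftAscent j (s i * w) := by
    obtain ⟨k, rfl⟩ := ZMod.intCast_surjective j
    have h₃ : ((k + 1 : ℤ) : ZMod n) ≠ i + 1 := by
      push_cast; exact fun e => h (add_right_cancel e)
    have h₄ : ((k + 1 : ℤ) : ZMod n) ≠ i := by push_cast; exact h₂.symm
    rw [not_isLeftAscent_iff] at hj ⊢
    rwa [pos_s_mul, pos_s_mul, simpleFun_of_ne h h₁, simpleFun_of_ne h₄ h₃]
  obtain ⟨l, hl⟩ := exists_reducedWord (s j * (s i * w))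
  refine ⟨l, isReducedWord_cons_iff.2 ⟨isReducedWord_cons_iff.2 ⟨hl, descent h h₁ h₂ hj⟩, hi⟩,
    isReducedWord_cons_iff.2 ⟨isReducedWord_cons_iff.2 ⟨?_, descent h.symm h₂ h₁ hi⟩, hj⟩⟩
  rwa [← mul_assoc, s_comm h h₁ h₂, mul_assoc]

theorem succ_succ_ne_of_not_isLeftAscent {i : ZMod n} {w : W n} (h₀ : ¬ IsLeftAscent i w)
    (h₁ : ¬ IsLeftAscent (i + 1) w) : i + 1 + 1 ≠ i := by
  obtain ⟨k, rfl⟩ := ZMod.intCast_surjective i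
  rw [← Int.cast_one, ← Int.cast_add] at h₁
  rw [not_isLeftAscent_iff] at h₀ h₁
  intro e
  obtain ⟨m, hm⟩ : ∃ m : ℤ, k + 1 + 1 = k + m * n :=
    exists_eq_add_mul (by push_cast; exact e.symm)
  rw [hm, pos_add_mul] at h₁
  have : 0 < m * (n : ℤ) := by omega
  omega

theorem exists_isReducedWord_braid {i : ZMod n} {w : W n} (h₀ : ¬ IsLeftAscent i w)
    (h₁ : ¬ IsLeftAscent (i + 1) w) :
    ∃ l, IsReducedWord (i :: (i + 1) :: i :: l) w ∧
      IsReducedWord ((i + 1) :: i :: (i + 1) :: l) w := by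
  have hne := succ_succ_ne_of_not_isLeftAscent h₀ h₁
  obtain ⟨l, hl⟩ := exists_reducedWord (s i * (s (i + 1) * (s i * w)))
  have hl' : IsReducedWord l (s (i + 1) * (s i * (s (i + 1) * w))) := by
    rwa [← mul_assoc, ← mul_assoc, ← s_mul_s_mul_s hne, mul_assoc, mul_assoc]
  refine ⟨l, ?_⟩
  obtain ⟨k, rfl⟩ := ZMod.intCast_surjective i
  have hfix : simpleFun n (k : ZMod n) (k + 1 + 1) = k + 1 + 1 :=
    simpleFun_of_ne (by push_cast; exact hne) (by push_cast; exact zmod_succ_ne _)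
  have hfix' : simpleFun n ((k + 1 : ℤ) : ZMod n) k = k :=
    simpleFun_of_ne (by push_cast; exact (zmod_succ_ne _).symm) (by push_cast; exact hne.symm)
  have hc : (k : ZMod n) + 1 = ((k + 1 : ℤ) : ZMod n) := by push_cast; rfl
  rw [hc] at h₁ hl hl' ⊢
  simp only [isReducedWord_cons_iff, hl, hl', true_and]
  simp only [not_isLeftAscent_iff, pos_s_mul, simpleFun_left, simpleFun_right, hfix, hfix'] at *
  omega

section Matsumoto

variable {M : Type*} [Monoid M] {f : ZMod n → M}

theorem SatisfiesBraidRelations.exists_prod_map_eq (hf : SatisfiesBraidRelations f)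
    {i j : ZMod n} {w : W n} (hi : ¬ IsLeftAscent i w) (hj : ¬ IsLeftAscent j w) :
    ∃ l l', IsReducedWord (i :: l) w ∧ IsReducedWord (j :: l') w ∧
      ((i :: l).map f).prod = ((j :: l').map f).prod := by
  have braid {i : ZMod n} (hi : ¬ IsLeftAscent i w) (hi' : ¬ IsLeftAscent (i + 1) w) :
      ∃ l l', IsReducedWord (i :: l) w ∧ IsReducedWord ((i + 1) :: l') w ∧
        ((i :: l).map f).prod = (((i + 1) :: l').map f).prod := by
    obtain ⟨l, hl, hl'⟩ := exists_isReducedWord_braid hi hi'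
    refine ⟨_, _, hl, hl', ?_⟩
    simp only [List.map_cons, List.prod_cons, ← mul_assoc,
      hf.braid (succ_succ_ne_of_not_isLeftAscent hi hi')]
  by_cases h : j = i
  · subst h
    obtain ⟨l, hl⟩ := exists_reducedWord (s j * w)
    exact ⟨l, l, isReducedWord_cons_iff.2 ⟨hl, hj⟩, isReducedWord_cons_iff.2 ⟨hl, hj⟩, rfl⟩
  by_cases h₁ : j = i + 1
  · subst h₁
    exact braid hi hj
  by_cases h₂ : i = j + 1
  · subst h₂
    obtain ⟨l, l', hl, hl', e⟩ := braid hj hi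
    exact ⟨l', l, hl', hl, e.symm⟩
  obtain ⟨l, hl, hl'⟩ := exists_isReducedWord_comm h h₁ h₂ hi hj
  refine ⟨_, _, hl, hl', ?_⟩
  simp only [List.map_cons, List.prod_cons, ← mul_assoc, hf.comm h h₁ h₂]

theorem SatisfiesBraidRelations.prod_map_eq (hf : SatisfiesBraidRelations f)
    {l l' : List (ZMod n)} {w : W n} (hl : IsReducedWord l w) (hl' : IsReducedWord l' w) :
    (l.map f).prod = (l'.map f).prod := by
  induction hm : l.length generalizing l l' w with
  | zero =>
    obtain rfl := List.eq_nil_of_length_eq_zero hm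
    obtain rfl := List.eq_nil_of_length_eq_zero (hl'.2.trans hl.2.symm)
    rfl
  | succ m ih =>
    obtain ⟨i, l, rfl⟩ := List.exists_cons_of_length_eq_add_one hm
    obtain ⟨j, l', rfl⟩ := List.exists_cons_of_length_eq_add_one
      ((hl'.2.trans hl.2.symm).trans hm)
    obtain ⟨hw, hi⟩ := isReducedWord_cons_iff.1 hl
    obtain ⟨hw', hj⟩ := isReducedWord_cons_iff.1 hl'
    obtain ⟨r, r', hr, hr', e⟩ := hf.exists_prod_map_eq hi hj
    have hlen : l.length = m := Nat.succ_injective hm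
    have hlen' : r'.length = m :=
      Nat.succ_injective (((hr'.2.trans hl.2.symm).trans hm))
    calc ((i :: l).map f).prod = ((i :: r).map f).prod := by
          rw [List.map_cons, List.prod_cons, ih hw (isReducedWord_cons_iff.1 hr).1 hlen,
            List.map_cons, List.prod_cons]
      _ = ((j :: r').map f).prod := e
      _ = ((j :: l').map f).prod := by
          rw [List.map_cons, List.prod_cons, ih (isReducedWord_cons_iff.1 hr').1 hw' hlen',
            List.map_cons, List.prod_cons]

end Matsumoto

/-! ### The basis `A_w` -/

/-- The element `w` of `F_W`. -/
abbrev groupLike (w : W n) : FW n := SkewMonoidAlgebra.single w (1 : F n)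

theorem groupLike_one : groupLike (1 : W n) = 1 := rfl

theorem groupLike_mul (v w : W n) : groupLike (v * w) = groupLike v * groupLike w := by
  rw [SkewMonoidAlgebra.single_mul_single, smul_one, one_mul]

theorem groupLike_s_mul_self (i : ZMod n) : groupLike (s i) * groupLike (s i) = 1 := by
  rw [← groupLike_mul, s_mul_s, groupLike_one]

theorem groupLike_mul_smul (w : W n) (f : F n) (x : FW n) :
    groupLike w * (f • x) = (w • f) • (groupLike w * x) := by
  induction x using SkewMonoidAlgebra.induction_on with
  | zero => simp
  | single g a =>
    rw [SkewMonoidAlgebra.smul_single, SkewMonoidAlgebra.single_mul_single,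
      SkewMonoidAlgebra.single_mul_single, SkewMonoidAlgebra.smul_single]
    simp [smul_mul']
  | add x y hx hy => rw [smul_add, mul_add, hx, hy, mul_add, smul_add]

theorem coeff_groupLike_mul (v w : W n) (x : FW n) :
    (groupLike v * x).coeff w = v • x.coeff (v⁻¹ * w) := by
  rw [SkewMonoidAlgebra.coeff_single_mul, one_mul]

theorem simpleA_eq (i : ZMod n) :
    simpleA i = (weightF i - weightF (i + 1))⁻¹ • (1 - groupLike (s i)) := by
  rw [simpleA, ι_simpleRoot, algebraMap_root]

theorem simpleA_mul (i : ZMod n) (x : FW n) :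
    simpleA i * x = (weightF i - weightF (i + 1))⁻¹ • (x - groupLike (s i) * x) := by
  rw [simpleA_eq, smul_mul_assoc, sub_mul, one_mul]

theorem groupLike_s_mul_simpleA (i : ZMod n) : groupLike (s i) * simpleA i = simpleA i := by
  rw [simpleA_eq, groupLike_mul_smul, smul_inv_F, smul_sub, smul_weightF_left, smul_weightF_right,
    mul_sub, mul_one, groupLike_s_mul_self, ← neg_sub (weightF i), inv_neg, neg_smul, ← smul_neg,
    neg_sub]

theorem simpleA_mul_self (i : ZMod n) : simpleA i * simpleA i = 0 := by
  rw [simpleA_mul, groupLike_s_mul_simpleA, sub_self, smul_zero]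

section DividedDifference

variable {K E : Type*} [Field K] [Ring E] [Module K E] [IsScalarTower K E E] {σ τ : E}
  {p q : K →+* K}

theorem dividedDifference_mul_comm (hσ : ∀ (f : K) (m : E), σ * (f • m) = p f • (σ * m))
    (hτ : ∀ (f : K) (m : E), τ * (f • m) = q f • (τ * m)) (hστ : σ * τ = τ * σ) {a b : K}
    (ha : q a = a) (hb : p b = b) :
    a⁻¹ • (1 - σ) * (b⁻¹ • (1 - τ)) = b⁻¹ • (1 - τ) * (a⁻¹ • (1 - σ)) := by
  simp only [smul_mul_assoc, sub_mul, one_mul, hσ, hτ, map_inv₀, ha, hb, mul_sub, mul_one, hστ]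
  module

theorem dividedDifference_mul_mul (hσ : ∀ (f : K) (m : E), σ * (f • m) = p f • (σ * m))
    (hτ : ∀ (f : K) (m : E), τ * (f • m) = q f • (τ * m)) (hσσ : σ * σ = 1) {x y z : K}
    (hx : p x = y) (hy : p y = x) (hz : p z = z) (hx' : q x = x) (hy' : q y = z)
    (hxy : x - y ≠ 0) (hyz : y - z ≠ 0) :
    (x - y)⁻¹ • (1 - σ) * ((y - z)⁻¹ • (1 - τ)) * ((x - y)⁻¹ • (1 - σ)) =
      ((x - y) * (y - z) * (x - z))⁻¹ • (1 - σ - τ + σ * τ + τ * σ - σ * τ * σ) := by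
  have hxz : x - z ≠ 0 := by
    simpa only [map_sub, hy, hz] using (map_ne_zero p).2 hyz
  have hyx : y - x ≠ 0 := sub_ne_zero.2 (sub_ne_zero.1 hxy).symm
  simp only [mul_assoc, smul_mul_assoc, sub_mul, one_mul, hσ, hτ, map_inv₀, map_sub, hx, hy, hz,
    hx', hy', mul_sub, mul_one, hσσ]
  match_scalars <;> field_simp <;> ring

theorem dividedDifference_braid (hσ : ∀ (f : K) (m : E), σ * (f • m) = p f • (σ * m))
    (hτ : ∀ (f : K) (m : E), τ * (f • m) = q f • (τ * m)) (hσσ : σ * σ = 1) (hττ : τ * τ = 1)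
    (hστ : σ * τ * σ = τ * σ * τ) {x y z : K} (hx : p x = y) (hy : p y = x) (hz : p z = z)
    (hx' : q x = x) (hy' : q y = z) (hz' : q z = y) (hxy : x - y ≠ 0) (hyz : y - z ≠ 0) :
    (x - y)⁻¹ • (1 - σ) * ((y - z)⁻¹ • (1 - τ)) * ((x - y)⁻¹ • (1 - σ)) =
      (y - z)⁻¹ • (1 - τ) * ((x - y)⁻¹ • (1 - σ)) * ((y - z)⁻¹ • (1 - τ)) := by
  have h := dividedDifference_mul_mul hτ hσ hττ hz' hy' hx' hz hy
    (sub_ne_zero.2 (sub_ne_zero.1 hyz).symm) (sub_ne_zero.2 (sub_ne_zero.1 hxy).symm)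
  have hc : (z - y) * (y - x) * (z - x) = -((x - y) * (y - z) * (x - z)) := by ring
  rw [hc, ← neg_sub y z, ← neg_sub x y] at h
  simp only [inv_neg, neg_smul, mul_neg, neg_mul, neg_neg, neg_inj] at h
  rw [dividedDifference_mul_mul hσ hτ hσσ hx hy hz hx' hy' hxy hyz, h, hστ]
  module

end DividedDifference

theorem satisfiesBraidRelations_simpleA : SatisfiesBraidRelations (simpleA (n := n)) where
  comm {i j} h h₁ h₂ := by
    have h₃ : i + 1 ≠ j + 1 := fun e => h (add_right_cancel e).symm
    rw [simpleA_eq, simpleA_eq]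
    refine dividedDifference_mul_comm (p := MulSemiringAction.toRingHom (W n) (F n) (s i))
      (q := MulSemiringAction.toRingHom (W n) (F n) (s j)) (groupLike_mul_smul _)
      (groupLike_mul_smul _) ?_ ?_ ?_
    · rw [← groupLike_mul, s_comm h h₁ h₂, groupLike_mul]
    · rw [MulSemiringAction.toRingHom_apply, smul_sub, smul_weightF_of_ne h.symm h₂,
        smul_weightF_of_ne h₁.symm h₃]
    · rw [MulSemiringAction.toRingHom_apply, smul_sub, smul_weightF_of_ne h h₁,
        smul_weightF_of_ne h₂.symm h₃.symm]
  braid {i} h := by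
    rw [simpleA_eq, simpleA_eq]
    refine dividedDifference_braid (p := MulSemiringAction.toRingHom (W n) (F n) (s i))
      (q := MulSemiringAction.toRingHom (W n) (F n) (s (i + 1))) (groupLike_mul_smul _)
      (groupLike_mul_smul _) (groupLike_s_mul_self _) (groupLike_s_mul_self _) ?_
      (smul_weightF_left i) (smul_weightF_right i)
      (smul_weightF_of_ne h (zmod_succ_ne _)) (smul_weightF_of_ne (zmod_succ_ne i).symm h.symm)
      (smul_weightF_left _) (smul_weightF_right _) (weightF_sub_ne_zero i)
      (weightF_sub_ne_zero (i + 1))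
    simp only [← groupLike_mul, s_mul_s_mul_s h]

theorem A_eq_prod_map {l : List (ZMod n)} {w : W n} (h : IsReducedWord l w) :
    A w = (l.map simpleA).prod :=
  satisfiesBraidRelations_simpleA.prod_map_eq (exists_reducedWord w).choose_spec h

theorem A_one : A (1 : W n) = 1 :=
  A_eq_prod_map (l := []) ⟨rfl, length_one.symm⟩

theorem simpleA_mul_A_of_isLeftAscent {i : ZMod n} {w : W n} (h : IsLeftAscent i w) :
    simpleA i * A w = A (s i * w) := by
  obtain ⟨l, hl⟩ := exists_reducedWord w
  have hl' : IsReducedWord (i :: l) (s i * w) := by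
    rw [isReducedWord_cons_iff, isLeftAscent_s_mul_iff, not_not, s_mul_s_mul]
    exact ⟨hl, h⟩
  rw [A_eq_prod_map hl, A_eq_prod_map hl', List.map_cons, List.prod_cons]

theorem simpleA_mul_A_of_not_isLeftAscent {i : ZMod n} {w : W n} (h : ¬ IsLeftAscent i w) :
    simpleA i * A w = 0 := by
  rw [← s_mul_s_mul i w, ← simpleA_mul_A_of_isLeftAscent ((isLeftAscent_s_mul_iff i w).2 h),
    ← mul_assoc, simpleA_mul_self, zero_mul]

theorem coeff_A (w : W n) : (A w).coeff w ≠ 0 ∧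
    ∀ v, length w ≤ length v → v ≠ w → (A w).coeff v = 0 := by
  induction w using isLeftAscent_induction with
  | one =>
    rw [A_one]
    refine ⟨by simp, fun v _ hv => ?_⟩
    rw [SkewMonoidAlgebra.coeff_one, Finsupp.single_eq_of_ne hv]
  | step i w hi ih =>
    have hlen := hi.length_s_mul
    have hcoeff (v : W n) : (A (s i * w)).coeff v =
        (weightF i - weightF (i + 1))⁻¹ * ((A w).coeff v - s i • (A w).coeff (s i * v)) := by
      rw [← simpleA_mul_A_of_isLeftAscent hi, simpleA_mul, SkewMonoidAlgebra.coeff_smul,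
        Finsupp.smul_apply, SkewMonoidAlgebra.coeff_sub, Finsupp.sub_apply, coeff_groupLike_mul,
        s_inv, smul_eq_mul]
    constructor
    · rw [hcoeff, s_mul_s_mul, ih.2 (s i * w) (by omega) (fun e => by rw [e] at hlen; omega),
        zero_sub]
      refine mul_ne_zero (inv_ne_zero (weightF_sub_ne_zero i)) (neg_ne_zero.2 ?_)
      exact (smul_ne_zero_iff_ne _).2 ih.1
    · intro v hv hne
      have h1 := length_s_mul_le i (s i * v)
      rw [s_mul_s_mul] at h1
      rw [hcoeff, ih.2 v (by omega) (fun e => by rw [e] at hv; omega),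
        ih.2 (s i * v) (by omega) (fun e => hne (by rw [← e, s_mul_s_mul])), smul_zero, sub_zero,
        mul_zero]

theorem linearIndependent_of_triangular {ι K M : Type*} [Field K] [AddCommGroup M] [Module K M]
    (ℓ : ι → ℕ) (φ : ι → M →ₗ[K] K) {v : ι → M} (hdiag : ∀ i, φ i (v i) ≠ 0)
    (hupper : ∀ i j, ℓ j ≤ ℓ i → i ≠ j → φ i (v j) = 0) : LinearIndependent K v := by
  rw [linearIndependent_iff]
  intro c hc
  by_contra hne
  obtain ⟨i, hi, hmax⟩ := c.support.exists_max_image ℓ (Finsupp.support_nonempty_iff.2 hne)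
  have hzero : ∑ j ∈ c.support, c j * φ i (v j) = 0 := by
    simpa [Finsupp.linearCombination_apply, Finsupp.sum] using congrArg (φ i) hc
  rw [Finset.sum_eq_single_of_mem i hi fun j hj hji => by
    rw [hupper i j (hmax j hj) hji.symm, mul_zero]] at hzero
  exact mul_ne_zero (Finsupp.mem_support_iff.1 hi) (hdiag i) hzero

theorem linearIndependent_A : LinearIndependent (F n) (A (n := n)) :=
  linearIndependent_of_triangular length
    (fun w => Finsupp.lapply w ∘ₗ (SkewMonoidAlgebra.coeffLinearEquiv (S := F n)).toLinearMap)
    (fun w => (coeff_A w).1) fun v w => (coeff_A w).2 v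

/-! ### The coproduct expansion of `A_w` -/

section Expansion

variable {R K M ι : Type*} [CommRing R] [Field K] [Algebra R K] [AddCommGroup M] [Module K M]

/-- The sum `∑ x_v a_v` with coefficients `x_v` in `R`, which act through `R → K`. -/
def semilinearCombination (K : Type*) [Field K] [Algebra R K] [Module K M] (a : ι → M) :
    (ι →₀ R) →ₛₗ[algebraMap R K] M where
  toFun x := x.sum fun v r => algebraMap R K r • a v
  map_add' _ _ := Finsupp.sum_add_index' (fun _ => by simp) fun _ _ _ => by rw [map_add, add_smul]
  map_smul' r x := by
    rw [Finsupp.sum_smul_index' fun _ => by simp, Finsupp.smul_sum]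
    simp only [smul_eq_mul, map_mul, mul_smul]

theorem semilinearCombination_single (a : ι → M) (v : ι) (r : R) :
    semilinearCombination K a (Finsupp.single v r) = algebraMap R K r • a v :=
  Finsupp.sum_single_index (h := fun v r => algebraMap R K r • a v) (by simp)

theorem semilinearCombination_injective [FaithfulSMul R K] {a : ι → M}
    (ha : LinearIndependent K a) :
    Function.Injective (semilinearCombination (R := R) K a) := by
  have h (x : ι →₀ R) : semilinearCombination K a x =
      Finsupp.linearCombination K a (x.mapRange (algebraMap R K) (map_zero _)) := by
    rw [Finsupp.linearCombination_apply, Finsupp.sum_mapRange_index (by simp)]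
    rfl
  intro x y hxy
  rw [h, h] at hxy
  exact Finsupp.mapRange_injective _ (map_zero _) (FaithfulSMul.algebraMap_injective R K) (ha hxy)

/-- The sum `∑ x_{uv} a_u ⊗ a_v` with coefficients `x_{uv}` in `R`, in curried form. -/
def tensorCombination (K : Type*) [Field K] [Algebra R K] [Module K M] (a : ι → M) :
    (ι →₀ ι →₀ R) →ₛₗ[algebraMap R K] M ⊗[K] M where
  toFun x := x.sum fun u y => a u ⊗ₜ semilinearCombination K a y
  map_add' _ _ := Finsupp.sum_add_index' (fun _ => by simp) fun _ _ _ => by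
    rw [map_add, TensorProduct.tmul_add]
  map_smul' r x := by
    rw [Finsupp.sum_smul_index' fun _ => by simp, Finsupp.smul_sum]
    simp only [map_smulₛₗ, TensorProduct.tmul_smul]

theorem tensorCombination_sub (a : ι → M) (c d : ι →₀ ι →₀ R) :
    tensorCombination K a (c - d) = tensorCombination K a c - tensorCombination K a d :=
  map_sub (tensorCombination K a) c d

theorem tensorCombination_single (a : ι → M) (u : ι) (y : ι →₀ R) :
    tensorCombination K a (Finsupp.single u y) = a u ⊗ₜ[K] semilinearCombination K a y :=
  Finsupp.sum_single_index (h := fun u y => a u ⊗ₜ[K] semilinearCombination K a y) (by simp)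

theorem tensorCombination_curry (a : ι → M) (c : ι × ι →₀ R) :
    tensorCombination K a c.curry =
      semilinearCombination K (fun uv : ι × ι => a uv.1 ⊗ₜ[K] a uv.2) c := by
  refine Eq.trans ?_ (Finsupp.sum_curry_index (M := R) (N := M ⊗[K] M) c
    fun u v r => algebraMap R K r • (a u ⊗ₜ[K] a v))
  refine Finset.sum_congr rfl fun u _ => ?_
  change a u ⊗ₜ[K] (∑ v ∈ (c.curry u).support, algebraMap R K (c.curry u v) • a v) = _
  rw [TensorProduct.tmul_sum]
  exact Finset.sum_congr rfl fun v _ => TensorProduct.tmul_smul _ _ _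

theorem tensorCombination_injective [FaithfulSMul R K] {a : ι → M}
    (ha : LinearIndependent K a) :
    Function.Injective (tensorCombination (R := R) K a) := by
  intro c c' h
  rw [← Finsupp.curry_uncurry c, ← Finsupp.curry_uncurry c', tensorCombination_curry,
    tensorCombination_curry] at h
  rw [← Finsupp.curry_uncurry c,
    semilinearCombination_injective (ha.tmul_of_isDomain ha) h, Finsupp.curry_uncurry]

theorem exists_finsupp_smul_eq {x : ι →₀ M} {r : R} [Module R M] (h : ∀ v, ∃ m, r • m = x v) :
    ∃ y : ι →₀ M, r • y = x := by
  classical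
  choose f hf using h
  refine ⟨Finsupp.onFinset x.support (fun v => if x v = 0 then 0 else f v) fun v hv => ?_, ?_⟩
  · rw [Finsupp.mem_support_iff]
    exact fun h0 => hv (if_pos h0)
  · ext v
    rw [Finsupp.smul_apply, Finsupp.onFinset_apply]
    split_ifs with h0
    · rw [smul_zero, h0]
    · exact hf v

end Expansion

section TensorTwist

variable {R K M : Type*} [CommRing R] [Field K] [Algebra R K] [AddCommGroup M] [Module K M]
  {σ : R →+* R} {α : R} {i : ZMod n} {φ : K →+* K} {f : M →ₛₗ[φ] M} {a : W n → M}

open Classical in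
/-- The diagonal left multiplication by `s_i`, in coordinates with respect to the `A_u ⊗ A_v`. -/
def tensorTwist (σ : R →+* R) (α : R) (i : ZMod n) :
    (W n →₀ W n →₀ R) →+ (W n →₀ W n →₀ R) :=
  Finsupp.liftAddHom fun u => AddMonoidHom.comp
    { toFun y := Finsupp.single u y -
        if IsLeftAscent i u then α • Finsupp.single (s i * u) y else 0
      map_zero' := by simp only [Finsupp.single_zero, smul_zero, ite_self]; abel
      map_add' x y := by
        simp only [Finsupp.single_add, smul_add]
        split_ifs <;> abel } (twist σ α i)

open Classical in
theorem tensorTwist_single (u : W n) (y : W n →₀ R) :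
    tensorTwist σ α i (Finsupp.single u y) = Finsupp.single u (twist σ α i y) -
      if IsLeftAscent i u then α • Finsupp.single (s i * u) (twist σ α i y) else 0 := by
  rw [tensorTwist, Finsupp.liftAddHom_apply_single]
  rfl

open Classical in
theorem tensorTwist_apply (c : W n →₀ W n →₀ R) (u : W n) :
    tensorTwist σ α i c u = twist σ α i (c u) -
      if IsLeftAscent i u then 0 else α • twist σ α i (c (s i * u)) := by
  induction c using Finsupp.induction_linear with
  | zero => simp
  | add x y hx hy =>
    rw [map_add, Finsupp.add_apply, hx, hy]
    split_ifs
    · simp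
    · simp only [Finsupp.add_apply, map_add, smul_add]; abel
  | single v y =>
    rw [tensorTwist_single, Finsupp.sub_apply]
    congr 1
    · by_cases h : u = v
      · subst h; simp
      · simp [Ne.symm h]
    · by_cases h : s i * u = v
      · subst h
        by_cases hu : IsLeftAscent i u
        · simp [isLeftAscent_s_mul_iff i u, hu]
        · simp [isLeftAscent_s_mul_iff i u, hu, s_mul_s_mul]
      · have h' : s i * v ≠ u := fun e => h (by rw [← e, s_mul_s_mul])
        split_ifs <;> simp [h', Ne.symm h]

theorem semilinearCombination_twist (hφ : ∀ r, φ (algebraMap R K r) = algebraMap R K (σ r))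
    (ha : ∀ w, f (a w) = semilinearCombination K a (twist σ α i (basisVec R w)))
    (x : W n →₀ R) :
    semilinearCombination K a (twist σ α i x) = f (semilinearCombination K a x) := by
  induction x using Finsupp.induction_linear with
  | zero => simp
  | add x y hx hy => rw [map_add, map_add, hx, hy, map_add, map_add]
  | single w r =>
    have e : Finsupp.single w r = r • basisVec R w := by simp [basisVec]
    rw [semilinearCombination_single, map_smulₛₗ, hφ, ha, e, twist_smul, map_smulₛₗ]

theorem tensorCombination_tensorTwist (hφ : ∀ r, φ (algebraMap R K r) = algebraMap R K (σ r))
    (ha : ∀ w, f (a w) = semilinearCombination K a (twist σ α i (basisVec R w)))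
    (c : W n →₀ W n →₀ R) :
    tensorCombination K a (tensorTwist σ α i c) =
      TensorProduct.map f f (tensorCombination K a c) := by
  induction c using Finsupp.induction_linear with
  | zero => simp
  | add x y hx hy => rw [map_add, map_add, hx, hy, map_add, map_add]
  | single u y =>
    rw [tensorCombination_single, TensorProduct.map_tmul, ha, ← semilinearCombination_twist hφ ha,
      tensorTwist_single, tensorCombination_sub, tensorCombination_single]
    by_cases h : IsLeftAscent i u
    · rw [if_pos h, twist_basisVec σ α h, map_sub, map_smulₛₗ, map_smulₛₗ, basisVec, basisVec,
        tensorCombination_single, semilinearCombination_single, semilinearCombination_single,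
        map_one, one_smul, one_smul, TensorProduct.sub_tmul, TensorProduct.smul_tmul']
    · rw [if_neg h, twist_basisVec_of_not_isLeftAscent σ α h, map_zero, sub_zero, basisVec,
        semilinearCombination_single, map_one, one_smul]

theorem exists_smul_eq_sub_tensorTwist (hσ : ∀ r, α ∣ r - σ r) (c : W n →₀ W n →₀ R) :
    ∃ d : W n →₀ W n →₀ R, α • d = c - tensorTwist σ α i c := by
  classical
  refine exists_finsupp_smul_eq fun u => exists_finsupp_smul_eq fun v => ?_
  obtain ⟨q, hq⟩ := hσ (c u v)
  refine ⟨q + upOp R i (coeffMap σ (c u)) v +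
    (if IsLeftAscent i u then 0 else twist σ α i (c (s i * u))) v, ?_⟩
  have hv : twist σ α i (c u) v = σ (c u v) - α * upOp R i (coeffMap σ (c u)) v := by
    simp [twist_apply, coeffMap]
  rw [smul_add, smul_add, smul_eq_mul, ← hq, Finsupp.sub_apply, tensorTwist_apply,
    Finsupp.sub_apply, Finsupp.sub_apply, hv, smul_eq_mul]
  split_ifs
  · simp only [Finsupp.zero_apply, smul_zero]; ring
  · simp only [Finsupp.smul_apply, smul_eq_mul]; ring

end TensorTwist

/-- Left multiplication by `w` on `F_W`. -/
def leftMul (w : W n) : FW n →ₛₗ[MulSemiringAction.toRingHom (W n) (F n) w] FW n where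
  toFun x := groupLike w * x
  map_add' := mul_add _
  map_smul' := groupLike_mul_smul w

theorem leftMul_apply (w : W n) (x : FW n) : leftMul w x = groupLike w * x := rfl

theorem coproduct_single (w : W n) (f : F n) :
    coproduct n (SkewMonoidAlgebra.single w f) = f • (groupLike w ⊗ₜ[F n] groupLike w) := by
  have h : SkewMonoidAlgebra.single w f = f • groupLike w := by
    rw [SkewMonoidAlgebra.smul_single, smul_eq_mul, mul_one]
  rw [h, map_smul, coproduct]
  congr 1
  exact Module.Basis.constr_basis _ _ _ _

theorem coproduct_leftMul (w : W n) (x : FW n) :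
    coproduct n (leftMul w x) = TensorProduct.map (leftMul w) (leftMul w) (coproduct n x) := by
  induction x using SkewMonoidAlgebra.induction_on with
  | zero => simp
  | single g a =>
    rw [leftMul_apply, SkewMonoidAlgebra.single_mul_single, one_mul, coproduct_single,
      coproduct_single, map_smulₛₗ, TensorProduct.map_tmul, leftMul_apply, ← groupLike_mul,
      MulSemiringAction.toRingHom_apply]
  | add x y hx hy => rw [map_add, map_add, hx, hy, map_add, map_add]

theorem root_smul_simpleA_mul (i : ZMod n) (x : FW n) :
    algebraMap (S n) (F n) (root i) • (simpleA i * x) = x - leftMul (s i) x := by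
  rw [simpleA_mul, smul_smul, algebraMap_root, mul_inv_cancel₀ (weightF_sub_ne_zero i), one_smul,
    leftMul_apply]

theorem leftMul_A (i : ZMod n) (w : W n) :
    leftMul (s i) (A w) = semilinearCombination (F n) A
      (twist (MulSemiringAction.toRingHom (W n) (S n) (s i)) (root i) i (basisVec (S n) w)) := by
  rw [← sub_sub_self (A w) (leftMul (s i) (A w)), ← root_smul_simpleA_mul]
  by_cases h : IsLeftAscent i w
  · rw [simpleA_mul_A_of_isLeftAscent h, twist_basisVec _ _ h, map_sub, map_smulₛₗ, basisVec,
      basisVec, semilinearCombination_single, semilinearCombination_single, map_one, one_smul,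
      one_smul]
  · rw [simpleA_mul_A_of_not_isLeftAscent h, twist_basisVec_of_not_isLeftAscent _ _ h, smul_zero,
      sub_zero, basisVec, semilinearCombination_single, map_one, one_smul]

theorem isCoproductExpansion_iff {w : W n} {c : W n × W n →₀ S n} :
    IsCoproductExpansion w c ↔ tensorCombination (F n) A c.curry = coproduct n (A w) := by
  rw [tensorCombination_curry, eq_comm]
  rfl

theorem tensorCombination_A_injective :
    Function.Injective (tensorCombination (R := S n) (F n) (A (n := n))) :=
  tensorCombination_injective linearIndependent_A

theorem isCoproductExpansion_unique {w : W n} {c c' : W n × W n →₀ S n}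
    (h : IsCoproductExpansion w c) (h' : IsCoproductExpansion w c') : c = c' := by
  have := tensorCombination_A_injective
    ((isCoproductExpansion_iff.1 h).trans (isCoproductExpansion_iff.1 h').symm)
  rw [← Finsupp.uncurry_curry c, this, Finsupp.uncurry_curry]

theorem tensorCombination_eq_coproduct_s_mul {i : ZMod n} {w : W n} (hi : IsLeftAscent i w)
    {c d : W n →₀ W n →₀ S n} (hc : tensorCombination (F n) A c = coproduct n (A w))
    (hd : root i • d =
      c - tensorTwist (MulSemiringAction.toRingHom (W n) (S n) (s i)) (root i) i c) :
    tensorCombination (F n) A d = coproduct n (A (s i * w)) := by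
  have h0 : algebraMap (S n) (F n) (root i) ≠ 0 := by
    rw [algebraMap_root]; exact weightF_sub_ne_zero i
  refine smul_right_injective _ h0 ?_
  change algebraMap (S n) (F n) (root i) • _ = algebraMap (S n) (F n) (root i) • _
  rw [← map_smulₛₗ, hd, tensorCombination_sub,
    tensorCombination_tensorTwist (smul_algebraMap (s i)) (leftMul_A i), hc, ← coproduct_leftMul]
  refine (map_sub (coproduct n) _ _).symm.trans ?_
  rw [← root_smul_simpleA_mul, map_smul, simpleA_mul_A_of_isLeftAscent hi]

theorem tensorCombination_one :
    tensorCombination (F n) A (Finsupp.single 1 (basisVec (S n) 1)) =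
      coproduct n (A (1 : W n)) := by
  rw [tensorCombination_single, basisVec, semilinearCombination_single, map_one, one_smul, A_one,
    ← groupLike_one, coproduct_single, one_smul]

theorem exists_isCoproductExpansion (w : W n) : ∃ c, IsCoproductExpansion w c := by
  suffices ∃ c : W n →₀ W n →₀ S n, tensorCombination (F n) A c = coproduct n (A w) by
    obtain ⟨c, hc⟩ := this
    exact ⟨c.uncurry, isCoproductExpansion_iff.2 (by rwa [Finsupp.curry_uncurry])⟩
  induction w using isLeftAscent_induction with
  | one => exact ⟨_, tensorCombination_one⟩
  | step i w hi ih =>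
    obtain ⟨c, hc⟩ := ih
    obtain ⟨d, hd⟩ := exists_smul_eq_sub_tensorTwist (i := i) (root_dvd_sub_smul i) c
    exact ⟨d, tensorCombination_eq_coproduct_s_mul hi hc hd⟩

/-- The family `p^w_{u, v}` of structure constants, as a function of `u` and then `v`. -/
def structureConsts (w : W n) : W n →₀ W n →₀ S n := (exists_isCoproductExpansion w).choose.curry

theorem structureConsts_apply (w u v : W n) : structureConsts w u v = structureConst w u v := by
  rw [structureConst, dif_pos (exists_isCoproductExpansion w)]
  exact Finsupp.curry_apply _ _ _

theorem tensorCombination_structureConsts (w : W n) :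
    tensorCombination (F n) A (structureConsts w) = coproduct n (A w) :=
  isCoproductExpansion_iff.1 (exists_isCoproductExpansion w).choose_spec

theorem structureConsts_one :
    structureConsts (1 : W n) = Finsupp.single 1 (basisVec (S n) 1) :=
  tensorCombination_A_injective
    ((tensorCombination_structureConsts 1).trans tensorCombination_one.symm)

theorem root_smul_structureConsts {i : ZMod n} {w : W n} (hi : IsLeftAscent i w) :
    root i • structureConsts (s i * w) = structureConsts w -
      tensorTwist (MulSemiringAction.toRingHom (W n) (S n) (s i)) (root i) i
        (structureConsts w) := by
  obtain ⟨d, hd⟩ := exists_smul_eq_sub_tensorTwist (i := i)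
    (σ := MulSemiringAction.toRingHom (W n) (S n) (s i)) (root_dvd_sub_smul i) (structureConsts w)
  rw [tensorCombination_A_injective ((tensorCombination_structureConsts (s i * w)).trans
    (tensorCombination_eq_coproduct_s_mul hi (tensorCombination_structureConsts w) hd).symm), hd]

/-! ### The recursion for the structure constants -/

section Recursion

open Polynomial

/-- The product `y_{m+1} ⋯ y_N`. -/
def yProd {m : ℕ} {R : Type*} [CommRing R] (y : ZMod m → R) (k N : ℕ) : R :=
  ∏ j ∈ Finset.Ioc k N, y (j : ZMod m)

section YProd

variable {R : Type*} [CommRing R]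

theorem yProd_self {m : ℕ} (y : ZMod m → R) (N : ℕ) : yProd y N N = 1 := by
  rw [yProd, Finset.Ioc_self, Finset.prod_empty]

theorem yProd_succ_right {m : ℕ} (y : ZMod m → R) {k N : ℕ} (h : k ≤ N) :
    yProd y k (N + 1) = yProd y k N * y ((N : ZMod m) + 1) := by
  rw [yProd, Finset.prod_Ioc_succ_top (by omega), Nat.cast_succ, yProd]

theorem yProd_eq_mul {m : ℕ} (y : ZMod m → R) {k N : ℕ} (h : k < N) :
    yProd y k N = y ((k : ZMod m) + 1) * yProd y (k + 1) N := by
  rw [yProd, ← Finset.prod_Ioc_consecutive _ k.le_succ h, Nat.Ioc_succ_singleton,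
    Finset.prod_singleton, Nat.cast_succ, yProd]

theorem SwapsWeights.map_yProd {σ : R →+* R} {i : ZMod n} {y : ZMod n → R}
    (h : SwapsWeights σ i y) {k N : ℕ} (hk : (k : ZMod n) ≠ i) (hN : (N : ZMod n) ≠ i) :
    σ (yProd y k N) = yProd y k N := by
  induction hd : N - k using Nat.strong_induction_on generalizing k with
  | _ d ih =>
    rcases le_or_gt N k with hNk | hkN
    · rw [yProd, Finset.Ioc_eq_empty (by omega), Finset.prod_empty, map_one]
    rw [yProd_eq_mul y hkN, map_mul]
    by_cases hi : (k : ZMod n) + 1 = i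
    · have hkN' : k + 1 < N := lt_of_le_of_ne hkN fun e => hN (by rw [← e, Nat.cast_succ, hi])
      have hk₂ : ((k + 1 + 1 : ℕ) : ZMod n) ≠ i := by
        rw [Nat.cast_succ, Nat.cast_succ, hi]; exact zmod_succ_ne i
      rw [yProd_eq_mul y hkN', map_mul, ih _ (by omega) hk₂ rfl, Nat.cast_succ, hi, h.left, h.right,
        mul_left_comm]
    · rw [h.of_ne _ hi fun e => hk (add_right_cancel e),
        ih _ (by omega) (by rwa [Nat.cast_succ]) rfl]

end YProd

variable {B : Type*} [CommRing B]

/-- The elements `y_r = 1 - t e_r`, where `t` is the polynomial variable. -/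
def yElt {m : ℕ} (ε : ZMod m → B) (r : ZMod m) : B[X] := 1 - X * C (ε r)

theorem yElt_coeff_zero {m : ℕ} (ε : ZMod m → B) (r : ZMod m) : (yElt ε r).coeff 0 = 1 := by
  simp [yElt]

theorem yElt_ne_zero {m : ℕ} [Nontrivial B] (ε : ZMod m → B) (r : ZMod m) : yElt ε r ≠ 0 := by
  intro e
  have := yElt_coeff_zero ε r
  simp [e] at this

theorem yProd_yElt_coeff_zero {m : ℕ} (ε : ZMod m → B) (k N : ℕ) :
    (yProd (yElt ε) k N).coeff 0 = 1 := by
  rw [yProd, coeff_zero_prod]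
  exact Finset.prod_eq_one fun _ _ => yElt_coeff_zero _ _

theorem SwapsWeights.map_C {m : ℕ} {σ : B →+* B} {i : ZMod m} {ε : ZMod m → B}
    (h : SwapsWeights σ i ε) : SwapsWeights (mapRingHom σ) i fun r => C (ε r) where
  left := by simp [h.left]
  right := by simp [h.right]
  of_ne r h₁ h₂ := by simp [h.of_ne r h₁ h₂]

theorem SwapsWeights.map_yElt {m : ℕ} {σ : B →+* B} {i : ZMod m} {ε : ZMod m → B}
    (h : SwapsWeights σ i ε) : SwapsWeights (mapRingHom σ) i (yElt ε) where
  left := by simp [yElt, h.left]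
  right := by simp [yElt, h.right]
  of_ne r h₁ h₂ := by simp [yElt, h.of_ne r h₁ h₂]

theorem SwapsWeights.yProd_sub_map {σ : B →+* B} {i : ZMod n} {ε : ZMod n → B}
    (h : SwapsWeights σ i ε) {k N : ℕ} (hkN : k < N) (hN : (N : ZMod n) ≠ i) :
    yProd (yElt ε) k N - mapRingHom σ (yProd (yElt ε) k N) =
      if (k : ZMod n) = i then X * C (ε i - ε (i + 1)) * yProd (yElt ε) (k + 1) N else 0 := by
  split_ifs with hk
  · have hk' : ((k + 1 : ℕ) : ZMod n) ≠ i := by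
      rw [Nat.cast_succ, hk]; exact zmod_succ_ne i
    rw [yProd_eq_mul _ hkN, map_mul, h.map_yElt.map_yProd hk' hN, hk, h.map_yElt.right, yElt, yElt,
      C_sub]
    ring
  · rw [h.map_yElt.map_yProd hk hN, sub_self]

theorem coeffMap_C_twist (σ : B →+* B) (α : B) (i : ZMod n) (x : W n →₀ B) :
    coeffMap C (twist σ α i x) = twist (mapRingHom σ) (C α) i (coeffMap C x) :=
  coeffMap_twist (by ext; simp) α i x

/-- The generating function `∑_{m ≤ N} t^m y_{m+1} ⋯ y_N D_m`. -/
def genFun (ε : ZMod n → B) (N : ℕ) (D : ℕ → (W n →₀ B)) : W n →₀ B[X] :=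
  ∑ m ∈ Finset.range (N + 1), (X ^ m * yProd (yElt ε) m N) • coeffMap C (D m)

theorem genFun_succ (ε : ZMod n → B) (N : ℕ) {D : ℕ → (W n →₀ B)} (h : D (N + 1) = 0) :
    genFun ε (N + 1) D = yElt ε ((N : ZMod n) + 1) • genFun ε N D := by
  rw [genFun, Finset.sum_range_succ, h, map_zero, smul_zero, add_zero, genFun, Finset.smul_sum]
  refine Finset.sum_congr rfl fun m hm => ?_
  rw [yProd_succ_right _ (Nat.lt_succ_iff.1 (Finset.mem_range.1 hm)), smul_smul]
  congr 1
  ring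

theorem SwapsWeights.genFun_sub_twist {σ : B →+* B} {i : ZMod n} {ε : ZMod n → B}
    (h : SwapsWeights σ i ε) {N : ℕ} (hN : (N : ZMod n) ≠ i) (D : ℕ → (W n →₀ B)) :
    genFun ε N D - twist (mapRingHom σ) (C (ε i - ε (i + 1))) i (genFun ε N D) =
      ∑ m ∈ Finset.range (N + 1), (X ^ m * yProd (yElt ε) m N) •
        coeffMap C (D m - twist σ (ε i - ε (i + 1)) i (D m)) +
      ∑ m ∈ Finset.range N, (X ^ (m + 1) * yProd (yElt ε) (m + 1) N) •
        coeffMap C (if (m : ZMod n) = i then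
          (ε i - ε (i + 1)) • twist σ (ε i - ε (i + 1)) i (D m) else 0) := by
  have term (m : ℕ) : (X ^ m * yProd (yElt ε) m N) • coeffMap C (D m) -
      twist (mapRingHom σ) (C (ε i - ε (i + 1))) i
        ((X ^ m * yProd (yElt ε) m N) • coeffMap C (D m)) =
      (X ^ m * yProd (yElt ε) m N) • coeffMap C (D m - twist σ (ε i - ε (i + 1)) i (D m)) +
        (X ^ m * (yProd (yElt ε) m N - mapRingHom σ (yProd (yElt ε) m N))) •
          coeffMap C (twist σ (ε i - ε (i + 1)) i (D m)) := by
    rw [twist_smul, map_mul, map_pow, coe_mapRingHom, map_X,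
      map_sub (coeffMap (n := n) (C : B →+* B[X])), coeffMap_C_twist]
    module
  rw [genFun, map_sum, ← Finset.sum_sub_distrib, Finset.sum_congr rfl fun m _ => term m,
    Finset.sum_add_distrib]
  congr 1
  rw [Finset.sum_range_succ, yProd_self, map_one, sub_self, mul_zero, zero_smul, add_zero]
  refine Finset.sum_congr rfl fun m hm => ?_
  rw [h.yProd_sub_map (Finset.mem_range.1 hm) hN]
  split_ifs
  · rw [coeffMap_smul, smul_smul]
    congr 1
    ring
  · rw [mul_zero, zero_smul, map_zero, smul_zero]

/-- The vector `K_{1-M} ⋯ K_0 K_1 ⋯ K_N w`, where `K_c` has parameters `t` and `ε_c`. -/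
def kVec (ε : ZMod n → B) (w : W n) (M N : ℕ) : W n →₀ B[X] :=
  kProd (X : B[X]) (fun r => C (ε r)) (-M) (M + N) (basisVec B[X] w)

theorem kVec_succ_left (ε : ZMod n → B) {w : W n} {M : ℕ} (h : length w ≤ M) (N : ℕ) :
    kVec ε w (M + 1) N = kVec ε w M N := by
  rw [kVec, show M + 1 + N = M + N + 1 by ring, kProd_succ_basisVec_of_le_neg_length _ _
    (by push_cast; omega), kVec]
  congr 2
  push_cast
  ring

theorem kVec_succ_right (ε : ZMod n → B) {w : W n} (M : ℕ) {N : ℕ} (h : length w ≤ N) :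
    kVec ε w M (N + 1) = yElt ε ((N : ZMod n) + 1) • kVec ε w M N := by
  have hcast : ((-(M : ℤ) + (M + N : ℕ) + 1 : ℤ) : ZMod n) = (N : ZMod n) + 1 := by
    push_cast; ring
  rw [kVec, ← add_assoc, kProd_succ_basisVec_of_length_le _ _ (by push_cast; omega), hcast]
  rfl

theorem kVec_one (ε : ZMod n → B) (M N : ℕ) :
    kVec ε 1 M N = yProd (yElt ε) 0 N • basisVec B[X] 1 := by
  induction N with
  | zero =>
    rw [yProd_self, one_smul]
    induction M with
    | zero => rfl
    | succ M ih => rw [kVec_succ_left ε (by rw [length_one]; omega), ih]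
  | succ N ih =>
    rw [kVec_succ_right ε M (by rw [length_one]; omega), ih, yProd_succ_right _ N.zero_le,
      smul_smul, mul_comm]

theorem exists_kVec_eq (ε : ZMod n → B) {w : W n} {M : ℕ} (h : length w ≤ M) (i : ZMod n) :
    ∃ M', length w ≤ M' ∧ -(M' : ZMod n) ≠ i ∧ ∀ N, kVec ε w M' N = kVec ε w M N := by
  by_cases hM : -(M : ZMod n) = i
  · refine ⟨M + 1, by omega, fun e => zmod_succ_ne (M : ZMod n) ?_, kVec_succ_left ε h⟩
    rw [← hM, Nat.cast_succ] at e
    exact neg_injective e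
  · exact ⟨M, h, hM, fun _ => rfl⟩

theorem SwapsWeights.smul_kVec {σ : B →+* B} {i : ZMod n} {ε : ZMod n → B}
    (h : SwapsWeights σ i ε) {w : W n} (hi : IsLeftAscent i w) {M N : ℕ}
    (hM : -(M : ZMod n) ≠ i) (hN : (N : ZMod n) ≠ i) :
    C (ε i - ε (i + 1)) • kVec ε (s i * w) M N = kVec ε w M N -
      twist (mapRingHom σ) (C (ε i - ε (i + 1))) i (kVec ε w M N) := by
  have hcomm := twist_kProd (t := (X : B[X])) (by simp) h.map_C (basisVec B[X] w) (M + N) (-(M : ℤ))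
    (by push_cast; exact hM) (by push_cast; simpa using hN)
  rw [← C_sub] at hcomm
  rw [kVec, kVec, hcomm, twist_basisVec _ _ hi, LinearMap.map_sub, sub_sub_cancel,
    map_smul]

/-- The recursion for `D_m(w) = p^w_{ρ_m, ·}` along left ascents. -/
structure IsPieriRecursion (τ : ZMod n → B →+* B) (ε : ZMod n → B) (D : W n → ℕ → (W n →₀ B)) :
    Prop where
  one_zero : D 1 0 = basisVec B 1
  one_succ : ∀ m, D 1 (m + 1) = 0
  zero : ∀ {i w}, IsLeftAscent i w → (ε i - ε (i + 1)) • D (s i * w) 0 =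
    D w 0 - twist (τ i) (ε i - ε (i + 1)) i (D w 0)
  succ : ∀ {i w}, IsLeftAscent i w → ∀ m : ℕ,
    (ε i - ε (i + 1)) • D (s i * w) (m + 1) =
      D w (m + 1) - twist (τ i) (ε i - ε (i + 1)) i (D w (m + 1)) +
        if (m : ZMod n) = i then (ε i - ε (i + 1)) • twist (τ i) (ε i - ε (i + 1)) i (D w m) else 0
  swapsWeights : ∀ i, SwapsWeights (τ i) i ε
  sub_ne_zero : ∀ i, ε i - ε (i + 1) ≠ 0

namespace IsPieriRecursion

variable {τ : ZMod n → B →+* B} {ε : ZMod n → B} {D : W n → ℕ → (W n →₀ B)}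

theorem smul_genFun (h : IsPieriRecursion τ ε D) {i : ZMod n} {w : W n} (hi : IsLeftAscent i w)
    {N : ℕ} (hN : (N : ZMod n) ≠ i) : C (ε i - ε (i + 1)) • genFun ε N (D (s i * w)) =
      genFun ε N (D w) -
        twist (mapRingHom (τ i)) (C (ε i - ε (i + 1))) i (genFun ε N (D w)) := by
  rw [(h.swapsWeights i).genFun_sub_twist hN, genFun, Finset.sum_range_succ',
    Finset.sum_range_succ', smul_add, Finset.smul_sum, add_right_comm, ← Finset.sum_add_distrib]
  simp only [smul_comm (C (ε i - ε (i + 1))), ← coeffMap_smul, h.zero hi, h.succ hi, ← smul_add,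
    ← map_add]

theorem genFun_one (h : IsPieriRecursion τ ε D) (N : ℕ) :
    genFun ε N (D 1) = yProd (yElt ε) 0 N • basisVec B[X] 1 := by
  rw [genFun, Finset.sum_range_succ', Finset.sum_eq_zero, zero_add, h.one_zero, coeffMap_basisVec,
    pow_zero, one_mul]
  intro m _
  rw [h.one_succ, map_zero, smul_zero]

variable [IsDomain B]

theorem eq_zero (h : IsPieriRecursion τ ε D) (w : W n) : ∀ m, length w < m → D w m = 0 := by
  induction w using isLeftAscent_induction with
  | one =>
    intro m hm
    obtain ⟨m, rfl⟩ := Nat.exists_eq_succ_of_ne_zero (Nat.ne_zero_of_lt hm)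
    exact h.one_succ m
  | step i w hi ih =>
    intro m hm
    rw [hi.length_s_mul] at hm
    obtain ⟨m, rfl⟩ := Nat.exists_eq_succ_of_ne_zero (Nat.ne_zero_of_lt hm)
    refine (smul_eq_zero_iff_right (h.sub_ne_zero i)).1 ?_
    rw [h.succ hi, ih (m + 1) (by omega), ih m (by omega)]
    simp

theorem genFun_eq_kVec (h : IsPieriRecursion τ ε D) (w : W n) : ∀ N M : ℕ, length w ≤ N →
    length w ≤ M → genFun ε N (D w) = kVec ε w M N := by
  induction w using isLeftAscent_induction with
  | one => intro N M _ _; rw [h.genFun_one, kVec_one]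
  | step i w hi ih =>
    have hlen := hi.length_s_mul
    intro N M hN hM
    obtain ⟨M, hM, hMi, hM'⟩ := exists_kVec_eq ε hM i
    rw [← hM']
    have of_ne (N : ℕ) (hN : length (s i * w) ≤ N) (hNi : (N : ZMod n) ≠ i) :
        genFun ε N (D (s i * w)) = kVec ε (s i * w) M N := by
      refine smul_right_injective _ (C_ne_zero.2 (h.sub_ne_zero i)) ?_
      change C _ • _ = C _ • _
      rw [h.smul_genFun hi hNi, ih N M (by omega) (by omega),
        (h.swapsWeights i).smul_kVec hi hMi hNi]
    by_cases hNi : (N : ZMod n) = i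
    · have hsucc := of_ne (N + 1) (by omega) (by
        rw [Nat.cast_succ, hNi]; exact zmod_succ_ne i)
      rw [genFun_succ _ _ (h.eq_zero _ _ (by omega)), kVec_succ_right ε M hN] at hsucc
      exact smul_right_injective _ (yElt_ne_zero ε _) hsucc
    · exact of_ne N hN hNi

theorem apply_eq_card_strongStrip (h : IsPieriRecursion τ ε D) (w u : W n) (j : ℕ) :
    length u + j ≤ length w → D w j u = (Nat.card (StrongStrip w u j) : B) := by
  induction j using Nat.strong_induction_on with
  | _ j ih =>
    intro hj
    have hcoeff := congrArg (fun x : W n →₀ B[X] => (x u).coeff j)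
      (h.genFun_eq_kVec w (length w) (length w) le_rfl le_rfl)
    rw [kVec, coeff_kProd_basisVec _ _ _ _ _ _ le_rfl hj,
      StripLE.card_eq_of_length_le (by push_cast; omega), genFun, Finsupp.finsetSum_apply,
      finsetSum_coeff, Finset.sum_eq_single j] at hcoeff
    · rw [← hcoeff, Finsupp.smul_apply, coeffMap_apply, smul_eq_mul, mul_assoc, coeff_X_pow_mul',
        if_pos le_rfl, Nat.sub_self, mul_coeff_zero, yProd_yElt_coeff_zero, coeff_C_zero, one_mul]
    · intro m _ hm
      rw [Finsupp.smul_apply, coeffMap_apply, smul_eq_mul]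
      rcases lt_or_gt_of_ne hm with hlt | hgt
      · have : IsEmpty (StrongStrip w u m) := ⟨fun x => by have := x.length_add; omega⟩
        rw [ih m hlt (by omega), Nat.card_of_isEmpty, Nat.cast_zero, C_0, mul_zero, coeff_zero]
      · rw [mul_assoc, coeff_X_pow_mul', if_neg (by omega)]
    · exact fun hj => absurd (Finset.mem_range.2 (by omega)) hj

end IsPieriRecursion

end Recursion

/-! ### The elements `ρ_m` -/

theorem pos_rho_succ (m : ℕ) (k : ℤ) :
    pos (rho n (m + 1)) k = pos (rho n m) (simpleFun n (m : ZMod n) k) := by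
  rw [rho, pos_s_mul]

theorem pos_rho_self (m : ℕ) : pos (rho n m) m = 0 := by
  induction m with
  | zero => exact pos_one 0
  | succ m ih =>
    have h := simpleFun_right (n := n) m
    rw [Int.cast_natCast] at h
    rw [pos_rho_succ, Nat.cast_add, Nat.cast_one, h, ih]

theorem pos_rho_pos (m : ℕ) : ∀ k : ℤ, m < k → (k : ZMod n) ≠ m → 0 < pos (rho n m) k := by
  induction m with
  | zero =>
    intro k hk _
    change 0 < pos 1 k
    rw [pos_one]
    exact_mod_cast hk
  | succ m ih =>
    intro k hk hne
    push_cast at hk hne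
    rw [pos_rho_succ]
    refine ih _ ?_ (simpleFun_cast_eq_iff.not.2 hne)
    by_cases hi : (k : ZMod n) = m
    · rw [← hi, simpleFun_left]
      omega
    · rw [simpleFun_of_ne hi hne]
      omega

theorem pos_rho_lt (m : ℕ) : ∀ k l : ℤ, k < l → (k : ZMod n) ≠ m → (l : ZMod n) ≠ m →
    pos (rho n m) k < pos (rho n m) l := by
  induction m with
  | zero =>
    intro k l hkl _ _
    change pos 1 k < pos 1 l
    rwa [pos_one, pos_one]
  | succ m ih =>
    intro k l hkl hk hl
    push_cast at hk hl
    rw [pos_rho_succ, pos_rho_succ]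
    refine ih _ _ (lt_of_not_ge fun hle => ?_) (simpleFun_cast_eq_iff.not.2 hk)
      (simpleFun_cast_eq_iff.not.2 hl)
    rcases hle.lt_or_eq with h | h
    · obtain ⟨hki, rfl⟩ := eq_succ_of_simpleFun_lt hkl h
      push_cast at hl
      exact hl (by rw [hki])
    · exact hkl.ne' ((simpleFun_involutive n (m : ZMod n)).injective h)

theorem isLeftAscent_rho_of_ne {i : ZMod n} {m : ℕ} (h : i + 1 ≠ m) :
    IsLeftAscent i (rho n m) := by
  obtain ⟨k, rfl⟩ := ZMod.intCast_surjective i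
  rw [isLeftAscent_iff]
  by_cases hk : (k : ZMod n) = m
  · obtain ⟨q, hq⟩ := exists_eq_add_mul (n := n) (k := m) (l := k) (by push_cast; exact hk.symm)
    have hpos := pos_rho_pos (n := n) m (m + 1) (by omega) (by push_cast; exact zmod_succ_ne _)
    rw [hq, show (m : ℤ) + q * n + 1 = m + 1 + q * n by ring, pos_add_mul, pos_add_mul,
      pos_rho_self]
    omega
  · exact pos_rho_lt m k (k + 1) (by omega) hk (by push_cast; exact h)

theorem isLeftAscent_rho_self (m : ℕ) : IsLeftAscent (m : ZMod n) (rho n m) :=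
  isLeftAscent_rho_of_ne (zmod_succ_ne _)

theorem isLeftAscent_rho_zero (i : ZMod n) : IsLeftAscent i (rho n 0) := by
  obtain ⟨k, rfl⟩ := ZMod.intCast_surjective i
  rw [isLeftAscent_iff]
  change pos 1 k < pos 1 (k + 1)
  rw [pos_one, pos_one]
  omega

theorem not_isLeftAscent_rho_succ (m : ℕ) : ¬ IsLeftAscent (m : ZMod n) (rho n (m + 1)) := by
  rw [rho, isLeftAscent_s_mul_iff]
  exact not_not.2 (isLeftAscent_rho_self m)

theorem length_rho (m : ℕ) : length (rho n m) = m := by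
  induction m with
  | zero => exact length_one
  | succ m ih => rw [rho, (isLeftAscent_rho_self m).length_s_mul, ih]

/-! ### The structure constants `p^w_{ρ_m,u}` -/

theorem swapsWeights_weightS (i : ZMod n) :
    SwapsWeights (MulSemiringAction.toRingHom (W n) (S n) (s i)) i weightS where
  left := by
    rw [MulSemiringAction.toRingHom_apply, smul_weightS, residue_s_left]
  right := by
    rw [MulSemiringAction.toRingHom_apply, smul_weightS, residue_s_right]
  of_ne r h h' := by
    rw [MulSemiringAction.toRingHom_apply, smul_weightS, residue_s_of_ne h h']

open Classical in
theorem root_smul_structureConsts_apply {i : ZMod n} {w : W n} (hi : IsLeftAscent i w) (u : W n) :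
    root i • structureConsts (s i * w) u = structureConsts w u -
      (twist (MulSemiringAction.toRingHom (W n) (S n) (s i)) (root i) i (structureConsts w u) -
        if IsLeftAscent i u then 0 else root i •
          twist (MulSemiringAction.toRingHom (W n) (S n) (s i)) (root i) i
            (structureConsts w (s i * u))) := by
  rw [← tensorTwist_apply]
  exact DFunLike.congr_fun (root_smul_structureConsts hi) u

theorem isPieriRecursion_structureConsts :
    IsPieriRecursion (fun i => MulSemiringAction.toRingHom (W n) (S n) (s i)) weightS
      fun (w : W n) m => structureConsts w (rho n m) where
  one_zero := by
    rw [structureConsts_one]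
    exact Finsupp.single_eq_same
  one_succ m := by
    rw [structureConsts_one]
    refine Finsupp.single_eq_of_ne fun e => ?_
    have hlen := length_rho (n := n) (m + 1)
    rw [e, length_one] at hlen
    omega
  zero {i w} hi := by
    refine (root_smul_structureConsts_apply hi _).trans ?_
    rw [if_pos (isLeftAscent_rho_zero i), sub_zero]
    rfl
  succ {i w} hi m := by
    refine (root_smul_structureConsts_apply hi _).trans ?_
    by_cases hm : (m : ZMod n) = i
    · subst hm
      rw [if_neg (not_isLeftAscent_rho_succ m), if_pos rfl,
        show s (m : ZMod n) * rho n (m + 1) = rho n m by rw [rho, s_mul_s_mul]]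
      exact (sub_add _ _ _).symm
    · rw [if_neg hm, if_pos (isLeftAscent_rho_of_ne
        (fun e => hm (add_right_cancel (e.trans (Nat.cast_succ m))).symm)), sub_zero, add_zero]
      rfl
  swapsWeights := swapsWeights_weightS
  sub_ne_zero := root_ne_zero

theorem structureConst_rho {w u : W n} {i : ℕ} (h : length w = length u + i) :
    structureConst w (rho n i) u = (Nat.card (StrongStrip w u i) : S n) := by
  rw [← structureConsts_apply]
  exact isPieriRecursion_structureConsts.apply_eq_card_strongStrip w u i h.ge

/-! ### The operators on the nilCoxeter ring -/

theorem submodule_eq_top_of_closure {E : Type*} [Ring E] {t : Set E} {T : Subring E}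
    (hT : T = Subring.closure t) (N : Submodule ℤ T) (one_mem : 1 ∈ N)
    (mul_mem : ∀ x : T, (x : E) ∈ t → ∀ y ∈ N, x * y ∈ N) : N = ⊤ := by
  subst hT
  suffices ∀ x (hx : x ∈ Subring.closure t), ∀ y ∈ N, ⟨x, hx⟩ * y ∈ N from
    eq_top_iff.2 fun x _ => mul_one x ▸ this x x.2 1 one_mem
  intro x hx
  induction hx using Subring.closure_induction with
  | mem x hx => exact mul_mem _ hx
  | zero => exact fun y _ => (zero_mul y).symm ▸ N.zero_mem
  | one => exact fun y hy => (one_mul y).symm ▸ hy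
  | add x z hx hz ihx ihz =>
    exact fun y hy => (add_mul ⟨x, hx⟩ ⟨z, hz⟩ y).symm ▸ N.add_mem (ihx y hy) (ihz y hy)
  | neg x hx ih => exact fun y hy => (neg_mul ⟨x, hx⟩ y).symm ▸ N.neg_mem (ih y hy)
  | mul x z hx hz ihx ihz =>
    exact fun y hy => (mul_assoc ⟨x, hx⟩ ⟨z, hz⟩ y).symm ▸ ihx _ (ihz y hy)

theorem span_A0 : Submodule.span ℤ (Set.range (A0 (n := n))) = ⊤ := by
  refine submodule_eq_top_of_closure (T := nilCoxeter n) rfl _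
    (Submodule.subset_span ⟨1, Subtype.ext A_one⟩) ?_
  rintro x ⟨i, hx⟩ y hy
  induction hy using Submodule.span_induction with
  | mem y hy =>
    obtain ⟨w, rfl⟩ := hy
    by_cases hi : IsLeftAscent i w
    · refine Submodule.subset_span ⟨s i * w, Subtype.ext ?_⟩
      exact (simpleA_mul_A_of_isLeftAscent hi).symm.trans (congrArg (· * A w) hx)
    · have hzero : x * A0 w = 0 :=
        Subtype.ext ((congrArg (· * A w) hx.symm).trans (simpleA_mul_A_of_not_isLeftAscent hi))
      rw [hzero]
      exact zero_mem _
  | zero => rw [mul_zero]; exact zero_mem _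
  | add y z _ _ hy hz => rw [mul_add]; exact add_mem hy hz
  | smul r y _ hy => rw [mul_smul_comm]; exact Submodule.smul_mem _ r hy

theorem linearIndependent_A0 : LinearIndependent ℤ (A0 (n := n)) := by
  have hinj : Function.Injective fun r : ℤ => r • (1 : F n) := by
    intro a b h
    simp only [zsmul_eq_mul, mul_one] at h
    have hS : algebraMap (S n) (F n) (algebraMap ℤ (S n) a) =
        algebraMap (S n) (F n) (algebraMap ℤ (S n) b) := by simpa using h
    exact (SymmetricAlgebra.algebraMap_leftInverse (P n)).injective
      (IsFractionRing.injective (S n) (F n) hS)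
  have h := (linearIndependent_A (n := n)).restrict_scalars (R := ℤ) hinj
  exact LinearIndependent.of_comp (nilCoxeter n).subtype.toIntAlgHom.toLinearMap h

/-- The basis `A_w` of the nilCoxeter ring `𝔸₀` over `ℤ`. -/
def basisA0 (n : ℕ) [n.AtLeastTwo] : Module.Basis (W n) ℤ (nilCoxeter n) :=
  Module.Basis.mk linearIndependent_A0 span_A0.ge

theorem basisA0_apply (w : W n) : basisA0 n w = A0 w := by rw [basisA0, Module.Basis.mk_apply]

theorem forall_apply_A0_eq_iff (f : W n → nilCoxeter n) (D : nilCoxeter n →ₗ[ℤ] nilCoxeter n) :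
    (∀ w, D (A0 w) = f w) ↔ D = (basisA0 n).constr ℤ f := by
  constructor
  · intro h
    refine (basisA0 n).ext fun w => ?_
    rw [Module.Basis.constr_basis, basisA0_apply, h]
  · rintro rfl w
    rw [← basisA0_apply, Module.Basis.constr_basis]

theorem finsum_strongStrip {E : Type*} [AddCommMonoid E] (w : W n) (i : ℕ) (f : W n → E) :
    ∑ᶠ x : Σ u : W n, StrongStrip w u i, f x.1 =
      ∑ v ∈ (finite_length_le (n := n) (length w)).toFinset,
        Nat.card (StrongStrip w v i) • f v := by
  have : Fintype (Σ u : W n, StrongStrip w u i) := Fintype.ofFinite _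
  have : ∀ u : W n, Fintype (StrongStrip w u i) := fun u => Fintype.ofFinite _
  have huniv : (Finset.univ : Finset (Σ u : W n, StrongStrip w u i)) =
      (finite_length_le (n := n) (length w)).toFinset.sigma fun _ => Finset.univ := by
    refine (Finset.eq_univ_of_forall fun x => ?_).symm
    have := x.2.length_add
    simp only [Finset.mem_sigma, Set.Finite.mem_toFinset, Set.mem_ofPred_eq, Finset.mem_univ,
      and_true]
    omega
  rw [finsum_eq_sum_of_fintype, huniv, Finset.sum_sigma]
  refine Finset.sum_congr rfl fun v _ => ?_
  rw [Nat.card_eq_fintype_card, ← Finset.card_univ]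
  exact Finset.sum_const (f v)

theorem finsum_structureConst_rho (w : W n) (i : ℕ) :
    ∑ᶠ (v : W n) (_ : length v + length (rho n i) = length w),
        evalZero n (structureConst w (rho n i) v) • A0 v =
      ∑ᶠ x : Σ u : W n, StrongStrip w u i, A0 x.1 := by
  classical
  rw [finsum_strongStrip w i A0, length_rho, finsum_eq_sum_of_support_subset]
  · refine Finset.sum_congr rfl fun v _ => ?_
    rw [finsum_eq_if]
    split_ifs with h
    · rw [structureConst_rho h.symm, map_natCast, natCast_zsmul]
    · have : IsEmpty (StrongStrip w v i) := ⟨fun x => h x.length_add⟩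
      rw [Nat.card_of_isEmpty, zero_nsmul]
  · intro v hv
    rw [Function.mem_support, finsum_eq_if] at hv
    have h : length v + i = length w := (ite_ne_right_iff.1 hv).1
    rw [Set.Finite.coe_toFinset, Set.mem_ofPred_eq]
    omega

theorem isCapOperator_rho_iff {i : ℕ} {D : nilCoxeter n →ₗ[ℤ] nilCoxeter n} :
    IsCapOperator (rho n i) D ↔ IsPieriOperator i D := by
  simp only [IsCapOperator, IsPieriOperator, finsum_structureConst_rho]

end AffinePieri

end

open AffinePieri in
/-- The affine Pieri rule. -/
theorem theorem1p1 (n : ℕ) [n.AtLeastTwo] :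
    (∀ w : W n, ∃! c : W n × W n →₀ S n, IsCoproductExpansion w c) ∧
    (∀ (w : W n) (i : ℕ), Finite (Σ u : W n, StrongStrip w u i)) ∧
    (∀ (w u : W n) (i : ℕ), length w = length u + i →
      structureConst w (rho n i) u = (Nat.card (StrongStrip w u i) : S n)) ∧
    (∀ i : ℕ, ∃ D : nilCoxeter n →ₗ[ℤ] nilCoxeter n,
      (∀ D', IsCapOperator (rho n i) D' ↔ D' = D) ∧ (∀ D', IsPieriOperator i D' ↔ D' = D)) := by
  refine ⟨fun w => ?_, finite_sigma_strongStrip, fun w u i => structureConst_rho, fun i => ?_⟩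
  · obtain ⟨c, hc⟩ := exists_isCoproductExpansion w
    exact ⟨c, hc, fun c' hc' => isCoproductExpansion_unique hc' hc⟩
  · exact ⟨(basisA0 n).constr ℤ fun w => ∑ᶠ x : Σ u : W n, StrongStrip w u i, A0 x.1,
      fun D => isCapOperator_rho_iff.trans (forall_apply_A0_eq_iff _ D),
      forall_apply_A0_eq_iff _⟩
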